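/- Let $n\ge 1$. A $2n$-tangle consists of $n$ disjoint arcs and finitely many simple closed curves properly embedded in the $3$-ball, up to ambient isotopy fixing the boundary; equivalently, it is a diagram in a disc up to Reidemeister moves. A $2n$-tangle $\tau$ embeds in a link $\ell$ if some diagram of $\tau$ extends to a diagram of $\ell$. A Catalan tangle is a $2n$-tangle given by a diagram without crossings and without closed components, and $\tau^c$ denotes the link obtained by joining the corresponding ends of $\tau$ and $c$ without introducing crossings. For an oriented link $\ell$ let $V_\ell\in\mathbb Z[t^{\pm 1/2}]$ be its Jones polynomial, normalized to be $1$ on the unknot, and let $\det(\ell)=|\Delta_\ell(-1)|$, where $\Delta_\ell$ is the one-variable Alexander polynomial. Let $\tau$ be a $2n$-tangle that embeds in a link $\ell$. Choose any orientation of $\ell$ and, for each Catalan tangle $c$, any orientation of $\tau^c$. Then: (i) $V_\ell$ lies in the ideal of $\mathbb Z[t^{\pm1/2}]$ generated by the Jones polynomials $V_{\tau^c}$, where $c$ ranges over all Catalan $2n$-tangles. (ii) The greatest common divisor of the determinants $\det(\tau^c)$, where $c$ ranges over all Catalan $2n$-tangles, divides $\det(\ell)$. -/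

import Mathlib

open scoped LaurentPolynomial

/-! ### Sliced diagrams of tangles and links

A diagram in general position with respect to the height function is recorded by the list of its
critical levels, read from the bottom to the top.  Between two consecutive critical levels it
consists of vertical strands, numbered `0, 1, 2, …` from left to right. -/

/-- The kinds of critical levels: a local minimum `∪`, a local maximum `∩`, and the two crossings.
At `pos` the strand from bottom left to top right passes over the other one; at `neg` the strand
from bottom right to top left passes over. -/
inductive Kind
  | cup
  | cap
  | pos
  | neg

/-- The number of strands that enter from below. -/
def Kind.ins : Kind → ℕ
  | .cup => 0
  | .cap => 2
  | .pos => 2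
  | .neg => 2

/-- The number of strands that leave upwards. -/
def Kind.outs : Kind → ℕ
  | .cup => 2
  | .cap => 0
  | .pos => 2
  | .neg => 2

/-- A critical level: one minimum, maximum or crossing, with `at_` vertical strands to its left. -/
structure Piece where
  kind : Kind
  at_ : ℕ

/-- The piece with `k` more strands on its left. -/
def Piece.shift (k : ℕ) (p : Piece) : Piece := ⟨p.kind, k + p.at_⟩

/-- The number of strands above the piece `p` if there are `m` strands below it. -/
def Piece.above (m : ℕ) (p : Piece) : ℕ := m - p.kind.ins + p.kind.outs

/-- `Fits m w n`: the list `w` of critical levels leads from `m` strands at the bottom to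
`n` strands at the top. -/
def Fits : ℕ → List Piece → ℕ → Prop
  | m, [], n => m = n
  | m, p :: w, n => p.at_ + p.kind.ins ≤ m ∧ Fits (p.above m) w n

theorem Fits.append {v w : List Piece} {m n r : ℕ} (hv : Fits m v n) (hw : Fits n w r) :
    Fits m (v ++ w) r := by
  induction v generalizing m with
  | nil => cases hv; exact hw
  | cons p v ih => exact ⟨hv.1, ih hv.2⟩

/-- A tangle diagram in a strip with `m` ends at the bottom and `n` ends at the top. -/
structure Diagram (m n : ℕ) where
  pieces : List Piece
  fits : Fits m pieces n

/-- A diagram of a `2n`-tangle: `n` arcs and any number of closed curves in a disc (ball), whose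
`2n` ends are placed at the top. -/
abbrev TangleDiagram (n : ℕ) := Diagram 0 (2 * n)

/-- A link diagram. -/
abbrev LinkDiagram := Diagram 0 0

/-- Stacking `E` on top of `D`, joining corresponding ends. -/
def Diagram.glue {m n r : ℕ} (D : Diagram m n) (E : Diagram n r) : Diagram m r :=
  ⟨D.pieces ++ E.pieces, D.fits.append E.fits⟩

/-! ### Isotopy: planar isotopy and the Reidemeister moves -/

/-- The local moves: planar isotopies of sliced diagrams (`far`, `zigzag`, `slide`), and the
Reidemeister moves `R1`, `R2`, `R3`.  The remaining variants of the moves follow from these. -/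
inductive LocalMove : List Piece → List Piece → Prop
  /-- Two pieces side by side exchange their heights. -/
  | far (a b : Kind) (i d : ℕ) :
      LocalMove [⟨a, i⟩, ⟨b, i + a.outs + d⟩] [⟨b, i + a.ins + d⟩, ⟨a, i⟩]
  | zigzag (i : ℕ) : LocalMove [⟨.cup, i⟩, ⟨.cap, i + 1⟩] []
  | zigzag' (i : ℕ) : LocalMove [⟨.cup, i + 1⟩, ⟨.cap, i⟩] []
  | slide_cap_pos (i : ℕ) :
      LocalMove [⟨.pos, i⟩, ⟨.cap, i + 1⟩] [⟨.neg, i + 1⟩, ⟨.cap, i⟩]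
  | slide_cap_neg (i : ℕ) :
      LocalMove [⟨.neg, i⟩, ⟨.cap, i + 1⟩] [⟨.pos, i + 1⟩, ⟨.cap, i⟩]
  | slide_cup_pos (i : ℕ) :
      LocalMove [⟨.cup, i⟩, ⟨.pos, i + 1⟩] [⟨.cup, i + 1⟩, ⟨.neg, i⟩]
  | slide_cup_neg (i : ℕ) :
      LocalMove [⟨.cup, i⟩, ⟨.neg, i + 1⟩] [⟨.cup, i + 1⟩, ⟨.pos, i⟩]
  | R1_cap_pos (i : ℕ) : LocalMove [⟨.pos, i⟩, ⟨.cap, i⟩] [⟨.cap, i⟩]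
  | R1_cap_neg (i : ℕ) : LocalMove [⟨.neg, i⟩, ⟨.cap, i⟩] [⟨.cap, i⟩]
  | R1_cup_pos (i : ℕ) : LocalMove [⟨.cup, i⟩, ⟨.pos, i⟩] [⟨.cup, i⟩]
  | R1_cup_neg (i : ℕ) : LocalMove [⟨.cup, i⟩, ⟨.neg, i⟩] [⟨.cup, i⟩]
  | R2_pos_neg (i : ℕ) : LocalMove [⟨.pos, i⟩, ⟨.neg, i⟩] []
  | R2_neg_pos (i : ℕ) : LocalMove [⟨.neg, i⟩, ⟨.pos, i⟩] []
  | R3_pos (i : ℕ) :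
      LocalMove [⟨.pos, i⟩, ⟨.pos, i + 1⟩, ⟨.pos, i⟩] [⟨.pos, i + 1⟩, ⟨.pos, i⟩, ⟨.pos, i + 1⟩]
  | R3_neg (i : ℕ) :
      LocalMove [⟨.neg, i⟩, ⟨.neg, i + 1⟩, ⟨.neg, i⟩] [⟨.neg, i + 1⟩, ⟨.neg, i⟩, ⟨.neg, i + 1⟩]

/-- `E` arises from `D` by one local move. -/
def Diagram.Move {m n : ℕ} (D E : Diagram m n) : Prop :=
  ∃ u v L R, LocalMove L R ∧ D.pieces = u ++ L ++ v ∧ E.pieces = u ++ R ++ v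

/-- `D` and `E` represent the same tangle (the same link, if there are no ends). -/
def Diagram.Isotopic {m n : ℕ} : Diagram m n → Diagram m n → Prop :=
  Relation.EqvGen Diagram.Move

/-- The link diagram `D` extends the tangle diagram `t`: some disc, with all ends of the tangle on
its top side, meets `D` in `t`.  The rest of `D` may have strands on both sides of the disc. -/
def Diagram.ExtendsTo {n : ℕ} (t : TangleDiagram n) (D : LinkDiagram) : Prop :=
  ∃ (below above : List Piece) (k : ℕ),
    D.pieces = below ++ t.pieces.map (Piece.shift k) ++ above

/-- The tangle represented by `t` embeds in the link represented by `l`: some diagram of the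
tangle extends to a diagram of the link. -/
def Embeds {n : ℕ} (t : TangleDiagram n) (l : LinkDiagram) : Prop :=
  ∃ (t' : TangleDiagram n) (l' : LinkDiagram),
    t.Isotopic t' ∧ l.Isotopic l' ∧ t'.ExtendsTo l'

/-! ### Points and strands

The point `(k, i)` of a diagram is the `i`-th point, from the left, on the horizontal line just
after the first `k` pieces. -/

/-- The number of points after the first `k` pieces, if there are `m` at the bottom. -/
def width (m : ℕ) (w : List Piece) (k : ℕ) : ℕ := (w.take k).foldl Piece.above m

/-- The points of a list `w` of critical levels with `m` ends at the bottom. -/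
def Point (m : ℕ) (w : List Piece) : Type :=
  {x : ℕ × ℕ // x.1 ≤ w.length ∧ x.2 < width m w x.1}

/-- The pieces of strand that pass a critical level to the left or to the right of its
minimum, maximum or crossing. -/
inductive Beside (w : List Piece) : ℕ × ℕ → ℕ × ℕ → Prop
  | left {k i : ℕ} {p : Piece} (h : w[k]? = some p) (hi : i < p.at_) :
      Beside w (k, i) (k + 1, i)
  | right {k : ℕ} {p : Piece} (i : ℕ) (h : w[k]? = some p) :
      Beside w (k, p.at_ + p.kind.ins + i) (k + 1, p.at_ + p.kind.outs + i)

/-- The pieces of strand at a minimum or a maximum. -/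
inductive Turn (w : List Piece) : ℕ × ℕ → ℕ × ℕ → Prop
  | cup {k i : ℕ} (h : w[k]? = some ⟨.cup, i⟩) : Turn w (k + 1, i) (k + 1, i + 1)
  | cap {k i : ℕ} (h : w[k]? = some ⟨.cap, i⟩) : Turn w (k, i) (k, i + 1)

/-- The upper strands at the crossings. -/
inductive Over (w : List Piece) : ℕ × ℕ → ℕ × ℕ → Prop
  | pos {k i : ℕ} (h : w[k]? = some ⟨.pos, i⟩) : Over w (k, i) (k + 1, i + 1)
  | neg {k i : ℕ} (h : w[k]? = some ⟨.neg, i⟩) : Over w (k, i + 1) (k + 1, i)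

/-- The lower strands at the crossings. -/
inductive Under (w : List Piece) : ℕ × ℕ → ℕ × ℕ → Prop
  | pos {k i : ℕ} (h : w[k]? = some ⟨.pos, i⟩) : Under w (k, i + 1) (k + 1, i)
  | neg {k i : ℕ} (h : w[k]? = some ⟨.neg, i⟩) : Under w (k, i) (k + 1, i + 1)

/-- Two points that are neighbours on a strand. -/
def Adjacent (m : ℕ) (w : List Piece) (x y : Point m w) : Prop :=
  Beside w x.1 y.1 ∨ Turn w x.1 y.1 ∨ Over w x.1 y.1 ∨ Under w x.1 y.1

/-- Two points that are neighbours on a strand, not separated by an undercrossing. -/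
def AdjacentOver (m : ℕ) (w : List Piece) (x y : Point m w) : Prop :=
  Beside w x.1 y.1 ∨ Turn w x.1 y.1 ∨ Over w x.1 y.1

/-- The components (curves) of a diagram. -/
def Component (m : ℕ) (w : List Piece) : Type := Quot (Adjacent m w)

/-- The arcs of a diagram: the parts of its curves from one undercrossing to the next. -/
def Arc (m : ℕ) (w : List Piece) : Type := Quot (AdjacentOver m w)

/-- A Catalan tangle (drawn in the complementary disc, with its ends at the bottom): there are no
crossings, and no closed components, that is, each point is connected to an end. -/
def Diagram.IsCatalan {n : ℕ} (c : Diagram (2 * n) 0) : Prop :=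
  (∀ p ∈ c.pieces, p.kind = .cup ∨ p.kind = .cap) ∧
    ∀ x : Point (2 * n) c.pieces, ∃ e : Point (2 * n) c.pieces,
      e.1.1 = 0 ∧ Relation.EqvGen (Adjacent (2 * n) c.pieces) x e

/-- The Catalan `2n`-tangles. -/
def CatalanTangle (n : ℕ) : Type := {c : Diagram (2 * n) 0 // c.IsCatalan}

/-- The closure `t^c` of a `2n`-tangle by a Catalan tangle. -/
def Diagram.close {n : ℕ} (t : TangleDiagram n) (c : CatalanTangle n) : LinkDiagram :=
  t.glue c.1

/-! ### Orientations, the Kauffman bracket and the Jones polynomial -/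

/-- An orientation of the components: `up (k, i)` says whether the strand through the point
`(k, i)` runs upwards there. -/
structure DiagramOrientation (D : LinkDiagram) where
  up : ℕ × ℕ → Bool
  beside : ∀ x y, Beside D.pieces x y → up x = up y
  turn : ∀ x y, Turn D.pieces x y → up x = !up y
  upper : ∀ x y, Over D.pieces x y → up x = up y
  lower : ∀ x y, Under D.pieces x y → up x = up y

/-- The sign of the piece number `k` if that is a crossing, else `0`. -/
def DiagramOrientation.sign {D : LinkDiagram} (o : DiagramOrientation D) (k : ℕ) : ℤ :=
  match D.pieces[k]? with
  | some ⟨.pos, i⟩ => if o.up (k, i) = o.up (k, i + 1) then 1 else -1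
  | some ⟨.neg, i⟩ => if o.up (k, i) = o.up (k, i + 1) then -1 else 1
  | _ => 0

/-- The writhe: the sum of the signs of the crossings. -/
def DiagramOrientation.writhe {D : LinkDiagram} (o : DiagramOrientation D) : ℤ :=
  ∑ k ∈ Finset.range D.pieces.length, o.sign k

/-- The Kauffman bracket, in the variable `T = A`, of the diagram `u ++ w` with `u` free of
crossings.  A crossing is replaced by its two smoothings: two vertical strands, or a maximum
with a minimum above it.  A diagram of `r ≥ 1` closed curves without crossings has the bracket
`(-A² - A⁻²) ^ (r - 1)`. -/
noncomputable def bracketFrom (u : List Piece) : List Piece → ℤ[T;T⁻¹]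
  | [] => (-LaurentPolynomial.T 2 - LaurentPolynomial.T (-2)) ^ (Nat.card (Component 0 u) - 1)
  | ⟨.cup, i⟩ :: w => bracketFrom (u ++ [⟨.cup, i⟩]) w
  | ⟨.cap, i⟩ :: w => bracketFrom (u ++ [⟨.cap, i⟩]) w
  | ⟨.pos, i⟩ :: w =>
      LaurentPolynomial.T 1 * bracketFrom u w +
        LaurentPolynomial.T (-1) * bracketFrom (u ++ [⟨.cap, i⟩, ⟨.cup, i⟩]) w
  | ⟨.neg, i⟩ :: w =>
      LaurentPolynomial.T 1 * bracketFrom (u ++ [⟨.cap, i⟩, ⟨.cup, i⟩]) w +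
        LaurentPolynomial.T (-1) * bracketFrom u w

/-- The Kauffman bracket polynomial of a link diagram, in the variable `T = A`. -/
noncomputable def bracket (D : LinkDiagram) : ℤ[T;T⁻¹] := bracketFrom [] D.pieces

/-- The normalized bracket `(-A³)^(-w) ⟨D⟩`, with `w` the writhe. -/
noncomputable def normalizedBracket (D : LinkDiagram) (o : DiagramOrientation D) : ℤ[T;T⁻¹] :=
  ((-1 : ℤˣ) ^ o.writhe : ℤˣ).val • (LaurentPolynomial.T (-3 * o.writhe) * bracket D)

/-- The Jones polynomial of an oriented link diagram, an element of `ℤ[t^{±1/2}]` with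
`T = t^{1/2}`.  It arises from the normalized bracket, whose exponents are all even, by
`t^{1/2} = A⁻²`: the coefficient of `t^{k/2}` is that of `A^{-2k}`. -/
noncomputable def jones (D : LinkDiagram) (o : DiagramOrientation D) : ℤ[T;T⁻¹] :=
  AddMonoidAlgebra.comapDomain (fun k : ℤ => -2 * k)
    (mul_right_injective₀ (by norm_num)) (normalizedBracket D o)

/-! ### The Alexander polynomial and the determinant -/

/-- `g` is a greatest common divisor of the set `S`. -/
def IsGcd {R : Type*} [CommSemiring R] (S : Set R) (g : R) : Prop :=
  (∀ a ∈ S, g ∣ a) ∧ ∀ e, (∀ a ∈ S, e ∣ a) → e ∣ g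

open scoped Classical in
/-- `1` if the arc `a` passes through the point `x`, else `0`. -/
noncomputable def Arc.ind {m : ℕ} {w : List Piece} (a : Arc m w) (x : ℕ × ℕ) : ℤ[T;T⁻¹] :=
  if ∃ y : Point m w, y.1 = x ∧ Quot.mk _ y = a then 1 else 0

/-- The relation at the piece number `k`, if that is a crossing, in the Alexander module, which has
the arcs as generators: `(1 - x) a + x b - c = 0`, where `a` is the upper arc and `b` and `c`
are the lower arcs on the left and on the right of `a`, as seen along the orientation of `a`.
The variable is `T = x`. -/
noncomputable def DiagramOrientation.relation {D : LinkDiagram} (o : DiagramOrientation D) (k : ℕ)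
    (α : Arc 0 D.pieces) : ℤ[T;T⁻¹] :=
  let rel (a b c : ℕ × ℕ) : ℤ[T;T⁻¹] :=
    (1 - LaurentPolynomial.T 1) * α.ind a + LaurentPolynomial.T 1 * α.ind b - α.ind c
  match D.pieces[k]? with
  | some ⟨.pos, i⟩ =>
      if o.up (k, i) then rel (k, i) (k + 1, i) (k, i + 1)
      else rel (k, i) (k, i + 1) (k + 1, i)
  | some ⟨.neg, i⟩ =>
      if o.up (k, i + 1) then rel (k, i + 1) (k, i) (k + 1, i + 1)
      else rel (k, i + 1) (k + 1, i + 1) (k, i)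
  | _ => 0

/-- The minors of size `q - 1` of the matrix of the relations, with `q` the number of arcs (the
pieces that are not crossings contribute zero rows). -/
def DiagramOrientation.minors {D : LinkDiagram} (o : DiagramOrientation D) : Set ℤ[T;T⁻¹] :=
  {d | ∃ (r : Fin (Nat.card (Arc 0 D.pieces) - 1) → Fin D.pieces.length)
      (c : Fin (Nat.card (Arc 0 D.pieces) - 1) → Arc 0 D.pieces),
      d = (Matrix.of fun i j => o.relation (r i) (c j)).det}

instance (m : ℕ) (w : List Piece) : Finite (Point m w) := by
  refine Set.Finite.subset (s := ⋃ k ∈ Set.Iic w.length, (fun i => (k, i)) '' Set.Iio (width m w k))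
    ?_ ?_
  · exact (Set.finite_Iic _).biUnion fun k _ => (Set.finite_Iio _).image _
  · rintro ⟨k, i⟩ ⟨hk, hi⟩
    simp only [Set.mem_iUnion]
    exact ⟨k, hk, i, hi, rfl⟩

instance (m : ℕ) (w : List Piece) : Finite (Arc m w) := inferInstanceAs (Finite (Quot _))

theorem DiagramOrientation.minors_finite {D : LinkDiagram} (o : DiagramOrientation D) : o.minors.Finite := by
  refine (Set.finite_range fun rc : (Fin (Nat.card (Arc 0 D.pieces) - 1) → Fin D.pieces.length) ×
    (Fin (Nat.card (Arc 0 D.pieces) - 1) → Arc 0 D.pieces) =>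
      (Matrix.of fun i j => o.relation (rc.1 i) (rc.2 j)).det).subset ?_
  rintro d ⟨r, c, rfl⟩
  exact ⟨(r, c), rfl⟩

theorem exists_isGcd {S : Set ℤ[T;T⁻¹]} (hS : S.Finite) : ∃ g, IsGcd S g := by
  have : UniqueFactorizationMonoid ℤ[T;T⁻¹] :=
    UniqueFactorizationMonoid.of_isLocalization
      (Submonoid.powers (Polynomial.X : Polynomial ℤ)) ℤ[T;T⁻¹]
  let := UniqueFactorizationMonoid.toGCDMonoid ℤ[T;T⁻¹]
  induction S, hS using Set.Finite.induction_on with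
  | empty => exact ⟨0, by simp [IsGcd]⟩
  | insert _ _ ih =>
    rename_i a S _ _
    obtain ⟨g, h1, h2⟩ := ih
    refine ⟨gcd a g, ?_, fun e he => ?_⟩
    · rintro b (rfl | hb)
      · exact gcd_dvd_left _ _
      · exact (gcd_dvd_right _ _).trans (h1 b hb)
    · exact dvd_gcd (he a (Set.mem_insert _ _)) (h2 e fun b hb => he b (Set.mem_insert_of_mem _ hb))

/-- The Alexander polynomial (well defined up to a unit `±x^k`): the greatest common divisor of the
minors of size `q - 1` of the presentation matrix with `q` generators. -/
noncomputable def alexanderPolynomial (D : LinkDiagram) (o : DiagramOrientation D) : ℤ[T;T⁻¹] :=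
  (exists_isGcd o.minors_finite).choose

/-- The determinant: the absolute value of the Alexander polynomial at `-1`. -/
noncomputable def determinant (D : LinkDiagram) (o : DiagramOrientation D) : ℕ :=
  (LaurentPolynomial.eval₂ (RingHom.id ℤ) (-1 : ℤˣ) (alexanderPolynomial D o)).natAbs

/-! Both parts rest on one reduction. Draw the tangle inside a diagram of the link and resolve every
crossing outside it by a skein relation with two smoothings, leaving the tangle untouched. A
crossingless outside joins the ends of the tangle in a planar way, so up to some closed curves it is
a Catalan tangle consisting of maxima only (`exists_caps_outside`). Hence an invariant with a
suitable skein relation is controlled by the closures (`stateSum_extension_mem`,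
`exists_hasDet_extension`).

The common tool is `count`, the number of colourings of the strands by a finite abelian group, where
the lower colours `b`, `c` and the upper colour `a` at a crossing satisfy `2a = b + c`. It is
invariant under all moves (`LocalMove.count_eq`). For a closed crossingless diagram it is the order
of the group to the power of the number of components (`count_crossingless`). So colourings modulo 2
count closed curves, and agreement up to `j` closed curves becomes a factor `|T| ^ j` between
counts.

For (i) the skein relation is that of the Kauffman bracket. The sum over states with one `loopValue`
per closed curve is invariant up to units, by the Temperley–Lieb relations
(`LocalMove.stateSum_eq`), and is `loopValue` times the bracket of a nonempty diagram. The common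
factor `loopValue` is cancelled at the end (`Embeds.bracket_mem`). Normalizing by the writhe only
multiplies by units. The passage from `A` to `t^{1/2}` uses that normalized brackets have even
exponents and that forgetting odd exponents is linear over polynomials with even exponents
(`unsubst_mul_subst`).

For (ii) the determinant is recovered from colourings. The Alexander matrix has one redundant row,
up to units, and one redundant column, so a single minor generates the ideal of all minors. At the
variable `-1` its solutions modulo `N`, together with one free translation, are the colourings
(`hasDet_colourings`). Conversely the counts for all `N` determine the absolute value of the
determinant of the system (`HasDet.unique`). This gives isotopy invariance and permits another
square system for the same counts, read off the diagram from bottom to top. In it a crossing and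
both of its smoothings are the operation `mix α β` for different coefficients, and these enter a
single row. Linearity in that row yields a skein relation `det = ±(x ± y)` with coherent signs
(`exists_hasDet_skein`), through which common divisors propagate. Extra closed curves make the
determinant zero, which every number divides. -/

section

/-! ### Colour counts -/

/-- Elementary operations on sequences of colours of strands. -/
inductive StrandOp
  | cup (i : ℕ)
  | cap (i : ℕ)
  | mix (α β : ℤ) (i : ℕ)

/-- The operation performed by a critical level on colours. -/
def Piece.toOp : Piece → StrandOp
  | ⟨.cup, i⟩ => .cup i
  | ⟨.cap, i⟩ => .cap i
  | ⟨.pos, i⟩ => .mix 1 (-1) i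
  | ⟨.neg, i⟩ => .mix 1 1 i

section Sequences
variable {T : Type*}

/-- Insert `x`, `y` at the places `i`, `i + 1`. -/
def pad (i : ℕ) (x y : T) (a : ℕ → T) : ℕ → T := fun j =>
  if j < i then a j else if j = i then x else if j = i + 1 then y else a (j - 2)

/-- Delete the places `i`, `i + 1`. -/
def del (i : ℕ) (a : ℕ → T) : ℕ → T := fun j => if j < i then a j else a (j + 2)

/-- Add `z` at the places `i`, `i + 1`. -/
def bump [Add T] (i : ℕ) (z : T) (a : ℕ → T) : ℕ → T := fun j =>
  if j = i ∨ j = i + 1 then a j + z else a j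

/-- Insert the first `r` entries of `b` into `a` at the place `k`. -/
def wrap (k r : ℕ) (b a : ℕ → T) : ℕ → T := fun j =>
  if j < k then a j else if j < k + r then b (j - k) else a (j - r)

end Sequences

variable {T : Type*} [AddCommGroup T] [Fintype T] [DecidableEq T]

/-- The weighted number of colourings of `w` that start with the colours `a`; the weight `φ` depends
on the final colours. -/
def cnt : List StrandOp → (ℕ → T) → ((ℕ → T) → ℕ) → ℕ
  | [], a, φ => φ a
  | .cup i :: w, a, φ => ∑ x : T, cnt w (pad i x x a) φ
  | .cap i :: w, a, φ => if a i = a (i + 1) then cnt w (del i a) φ else 0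
  | .mix α β i :: w, a, φ =>
      ∑ z : T, if α • z + β • (a i - a (i + 1)) = 0 then cnt w (bump i z a) φ else 0

/-- The number of colourings of the diagram `w` that start with the colours `a`. -/
def count (w : List Piece) (a : ℕ → T) : ℕ := cnt (w.map Piece.toOp) a fun _ => 1

/-- The weight on the final colours exists for this: it turns stacking of diagrams into composition.
-/
theorem cnt_append (v w : List StrandOp) (a : ℕ → T) (φ : (ℕ → T) → ℕ) :
    cnt (v ++ w) a φ = cnt v a fun b => cnt w b φ := by
  induction v generalizing a with
  | nil => rfl
  | cons p v ih => cases p <;> simp [cnt, ih]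

theorem cnt_sum {ι : Type*} (s : Finset ι) (v : List StrandOp) (a : ℕ → T) (φ : ι → (ℕ → T) → ℕ) :
    cnt v a (fun b => ∑ i ∈ s, φ i b) = ∑ i ∈ s, cnt v a (φ i) := by
  induction v generalizing a with
  | nil => rfl
  | cons p v ih =>
    cases p with
    | cup i => simp only [cnt, ih]; exact Finset.sum_comm
    | cap i => simp only [cnt, ih]; split_ifs <;> simp
    | mix α β i =>
      simp only [cnt, ih]
      rw [Finset.sum_comm]
      refine Finset.sum_congr rfl fun z _ => ?_
      split_ifs <;> simp

theorem cnt_zero (v : List StrandOp) (a : ℕ → T) : cnt v a (fun _ => 0) = 0 := by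
  simpa using cnt_sum (∅ : Finset ℕ) v a (fun _ _ => 0)

theorem cnt_ite (v : List StrandOp) (a : ℕ → T) (P : Prop) [Decidable P] (φ : (ℕ → T) → ℕ) :
    cnt v a (fun b => if P then φ b else 0) = if P then cnt v a φ else 0 := by
  split_ifs
  · rfl
  · exact cnt_zero v a

theorem cnt_mul_left (n : ℕ) (v : List StrandOp) (a : ℕ → T) (φ : (ℕ → T) → ℕ) :
    cnt v a (fun b => n * φ b) = n * cnt v a φ := by
  simpa [cnt_sum] using cnt_sum (Finset.range n) v a (fun _ => φ)

/-- Two diagrams that share no strands can be coloured in either order. This lets the tangle be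
coloured before the part of the diagram below it. -/
theorem cnt_comm {S : Type*} [AddCommGroup S] [Fintype S] [DecidableEq S]
    (v : List StrandOp) (w : List StrandOp) (a : ℕ → T) (b : ℕ → S) (φ : (ℕ → T) → (ℕ → S) → ℕ) :
    cnt v a (fun x => cnt w b (φ x)) = cnt w b (fun y => cnt v a fun x => φ x y) := by
  induction v generalizing a with
  | nil => rfl
  | cons p v ih =>
    cases p with
    | cup i => simp only [cnt, ih]; rw [cnt_sum]
    | cap i => simp only [cnt, ih]; rw [cnt_ite]
    | mix α β i =>
      simp only [cnt, ih]; rw [cnt_sum]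
      exact Finset.sum_congr rfl fun z _ => (cnt_ite ..).symm

theorem count_append (v w : List Piece) (a : ℕ → T) :
    count (v ++ w) a = cnt (v.map Piece.toOp) a (count w) := by
  simp only [count, List.map_append, cnt_append]; rfl

theorem count_nil (a : ℕ → T) : count [] a = 1 := rfl

theorem count_cup (i : ℕ) (w : List Piece) (a : ℕ → T) :
    count (⟨.cup, i⟩ :: w) a = ∑ x, count w (pad i x x a) := rfl

theorem count_cap (i : ℕ) (w : List Piece) (a : ℕ → T) :
    count (⟨.cap, i⟩ :: w) a = if a i = a (i + 1) then count w (del i a) else 0 := rfl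

theorem count_pos (i : ℕ) (w : List Piece) (a : ℕ → T) :
    count (⟨.pos, i⟩ :: w) a = count w (bump i (a i - a (i + 1)) a) := by
  simp only [count, List.map_cons, Piece.toOp, cnt]
  rw [Finset.sum_eq_single (a i - a (i + 1))]
  · simp
  · intro z _ hz
    rw [if_neg]
    intro h
    apply hz
    rw [one_smul, neg_smul, one_smul] at h
    exact add_neg_eq_zero.mp h
  · simp

theorem count_neg (i : ℕ) (w : List Piece) (a : ℕ → T) :
    count (⟨.neg, i⟩ :: w) a = count w (bump i (a (i + 1) - a i) a) := by
  simp only [count, List.map_cons, Piece.toOp, cnt]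
  rw [Finset.sum_eq_single (a (i + 1) - a i)]
  · simp
  · intro z _ hz
    rw [if_neg]
    intro h
    apply hz
    rw [one_smul, one_smul] at h
    rw [eq_neg_of_add_eq_zero_left h]; abel
  · simp

/-! #### Side by side -/

/-- The operation with `k` more strands on its left. -/
def StrandOp.shift (k : ℕ) : StrandOp → StrandOp
  | .cup i => .cup (k + i)
  | .cap i => .cap (k + i)
  | .mix α β i => .mix α β (k + i)

theorem Piece.toOp_shift (k : ℕ) (p : Piece) : (p.shift k).toOp = p.toOp.shift k := by
  obtain ⟨_ | _ | _ | _, i⟩ := p <;> rfl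

/-- The number of strands before and after. -/
def OpFits : ℕ → List StrandOp → ℕ → Prop
  | m, [], n => m = n
  | m, .cup i :: w, n => i ≤ m ∧ OpFits (m + 2) w n
  | m, .cap i :: w, n => ∃ m', m = m' + 2 ∧ i ≤ m' ∧ OpFits m' w n
  | m, .mix _ _ i :: w, n => i + 2 ≤ m ∧ OpFits m w n

theorem Fits.opFits {m n : ℕ} {w : List Piece} (h : Fits m w n) : OpFits m (w.map Piece.toOp) n := by
  induction w generalizing m with
  | nil => exact h
  | cons p w ih =>
    obtain ⟨h1, h2⟩ := h
    have h3 := ih h2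
    obtain ⟨_ | _ | _ | _, i⟩ := p <;>
      simp only [Kind.ins, Piece.above, Kind.outs, Piece.toOp, List.map_cons, OpFits] at h1 h3 ⊢
    · exact ⟨h1, h3⟩
    · exact ⟨m - 2, by omega, by omega, h3⟩
    · exact ⟨h1, by rwa [Nat.sub_add_cancel (by omega)] at h3⟩
    · exact ⟨h1, by rwa [Nat.sub_add_cancel (by omega)] at h3⟩


/-- Colours are infinite sequences, of which only the first `m` entries lie on strands; the
remaining entries are never consulted. -/
theorem cnt_congr {m n : ℕ} {w : List StrandOp} (h : OpFits m w n) {a b : ℕ → T}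
    (hab : ∀ j < m, a j = b j) {φ ψ : (ℕ → T) → ℕ}
    (hφ : ∀ a b : ℕ → T, (∀ j < n, a j = b j) → φ a = ψ b) : cnt w a φ = cnt w b ψ := by
  induction w generalizing m a b with
  | nil => cases h; exact hφ _ _ hab
  | cons p w ih =>
    cases p with
    | cup i =>
      obtain ⟨_, h⟩ := h
      refine Finset.sum_congr rfl fun x _ => ih h fun j hj => ?_
      unfold pad
      split_ifs <;> first | rfl | exact hab _ (by omega)
    | cap i =>
      obtain ⟨m', rfl, hi, h⟩ := h
      simp only [cnt]
      rw [hab i (by omega), hab (i + 1) (by omega)]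
      congr 1
      refine ih h fun j hj => ?_
      unfold del
      split_ifs <;> exact hab _ (by omega)
    | mix α β i =>
      obtain ⟨hi, h⟩ := h
      simp only [cnt]
      rw [hab i (by omega), hab (i + 1) (by omega)]
      refine Finset.sum_congr rfl fun x _ => ?_
      congr 1
      refine ih h fun j hj => ?_
      unfold bump
      rw [hab _ hj]

theorem count_congr {m n : ℕ} {w : List Piece} (h : Fits m w n) {a b : ℕ → T}
    (hab : ∀ j < m, a j = b j) : count w a = count w b :=
  cnt_congr h.opFits hab fun _ _ _ => rfl

theorem wrap_zero {T : Type*} (k : ℕ) (b a : ℕ → T) : wrap k 0 b a = a := by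
  ext j; simp only [wrap]; split_ifs <;> first | rfl | omega

/-- Strands on both sides of `w` pass through. -/
theorem cnt_shift {m n : ℕ} {w : List StrandOp} (h : OpFits m w n) (k : ℕ) (b a : ℕ → T)
    (φ : (ℕ → T) → ℕ) :
    cnt (w.map (StrandOp.shift k)) (wrap k m b a) φ = cnt w b fun b' => φ (wrap k n b' a) := by
  induction w generalizing m b with
  | nil => cases h; rfl
  | cons p w ih =>
    cases p with
    | cup i =>
      obtain ⟨_, h⟩ := h
      refine Finset.sum_congr rfl fun x _ => ?_
      rw [← ih h]
      congr 1
      ext j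
      simp only [pad, wrap]
      grind
    | cap i =>
      obtain ⟨m', rfl, hi, h⟩ := h
      simp only [cnt, List.map_cons, StrandOp.shift]
      rw [← ih h]
      have h1 : wrap k (m' + 2) b a (k + i) = b i := by simp only [wrap]; grind
      have h2 : wrap k (m' + 2) b a (k + i + 1) = b (i + 1) := by simp only [wrap]; grind
      rw [h1, h2]
      congr 2
      ext j
      simp only [del, wrap]
      grind
    | mix α β i =>
      obtain ⟨hi, h⟩ := h
      simp only [cnt, List.map_cons, StrandOp.shift]
      have h1 : wrap k m b a (k + i) = b i := by simp only [wrap]; grind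
      have h2 : wrap k m b a (k + i + 1) = b (i + 1) := by simp only [wrap]; grind
      rw [h1, h2]
      refine Finset.sum_congr rfl fun x _ => ?_
      rw [← ih h]
      congr 2
      ext j
      simp only [bump, wrap]
      grind

theorem cnt_shift_zero {n : ℕ} {w : List StrandOp} (h : OpFits 0 w n) (k : ℕ) (b a : ℕ → T)
    (φ : (ℕ → T) → ℕ) :
    cnt (w.map (StrandOp.shift k)) a φ = cnt w b fun b' => φ (wrap k n b' a) := by
  rw [← cnt_shift h, wrap_zero]

theorem count_shift {n : ℕ} {w : List Piece} (h : Fits 0 w n) (k : ℕ) (v : List Piece)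
    (a b : ℕ → T) :
    count (w.map (Piece.shift k) ++ v) a =
      cnt (w.map Piece.toOp) b fun b' => count v (wrap k n b' a) := by
  rw [count_append, List.map_map, ← cnt_shift_zero h.opFits, List.map_map]
  congr 2
  funext p
  exact Piece.toOp_shift k p

end

section

variable {T : Type*} [AddCommGroup T] [Fintype T] [DecidableEq T]

/-! ### Crossingless outsides -/

/-- The diagram consisting of maxima only, at the given places. -/
def caps (c : List ℕ) : List Piece := c.map fun i => ⟨.cap, i⟩

/-- There are no crossings. -/
def Crossingless (w : List Piece) : Prop := ∀ p ∈ w, p.kind = .cup ∨ p.kind = .cap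

theorem crossingless_caps (c : List ℕ) : Crossingless (caps c) := by
  intro p hp
  obtain ⟨i, -, rfl⟩ := List.mem_map.mp hp
  exact .inr rfl

theorem caps_cons (i : ℕ) (c : List ℕ) : caps (i :: c) = ⟨.cap, i⟩ :: caps c := rfl

theorem fits_cap {m i n : ℕ} {w : List Piece} :
    Fits (m + 2) (⟨.cap, i⟩ :: w) n ↔ i ≤ m ∧ Fits m w n := by
  simp [Fits, Piece.above, Kind.ins, Kind.outs]

theorem fits_cup {m i n : ℕ} {w : List Piece} :
    Fits m (⟨.cup, i⟩ :: w) n ↔ i ≤ m ∧ Fits (m + 2) w n := by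
  simp [Fits, Piece.above, Kind.ins, Kind.outs]

theorem Fits.cap_elim {m i n : ℕ} {w : List Piece} (h : Fits m (⟨.cap, i⟩ :: w) n) :
    ∃ m', m = m' + 2 ∧ i ≤ m' ∧ Fits m' w n := by
  have : 2 ≤ m := by have := h.1; simp only [Kind.ins] at this; omega
  obtain ⟨m', rfl⟩ := Nat.exists_eq_add_of_le' this
  exact ⟨m', rfl, fits_cap.mp h⟩

/-- A minimum below maxima can be removed, with a closed curve at most. -/
theorem exists_caps_cup (c : List ℕ) {m i : ℕ} (hc : Fits (m + 2) (caps c) 0) (hi : i ≤ m) :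
    ∃ c' j, Fits m (caps c') 0 ∧
      ∀ (T : Type) [AddCommGroup T] [Fintype T] [DecidableEq T] (a : ℕ → T),
        count (⟨.cup, i⟩ :: caps c) a = Fintype.card T ^ j * count (caps c') a := by
  induction c generalizing m i with
  | nil => cases hc
  | cons l c ih =>
    obtain ⟨hl, hd⟩ := fits_cap.mp hc
    -- The minimum at `i` meets the lowest maximum at `l`. Distance one is a zigzag and straightens,
    -- distance zero closes a curve, and at larger distance the two pieces exchange heights and the
    -- induction continues.
    rcases lt_trichotomy l i with h | rfl | h
    · obtain h | h := (show l + 1 = i ∨ l + 2 ≤ i by omega)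
      · subst h
        refine ⟨c, 0, hd, fun T _ _ _ a => ?_⟩
        simp only [count_cup, caps_cons, count_cap, pow_zero, one_mul]
        rw [Finset.sum_eq_single (a l)]
        · rw [if_pos (by simp only [pad]; grind)]
          congr 1; ext j; simp only [pad, del]; grind
        · intro x _ hx
          rw [if_neg]; simp only [pad]; grind
        · simp
      · obtain ⟨m, rfl⟩ := Nat.exists_eq_add_of_le' (show 2 ≤ m by omega)
        obtain ⟨c', j, hc', H⟩ := ih (i := i - 2) hd (by omega)
        refine ⟨l :: c', j, fits_cap.mpr ⟨by omega, hc'⟩, fun T _ _ _ a => ?_⟩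
        have h1 (x : T) : pad i x x a l = a l := by simp only [pad]; grind
        have h2 (x : T) : pad i x x a (l + 1) = a (l + 1) := by simp only [pad]; grind
        have h3 (x : T) : del l (pad i x x a) = pad (i - 2) x x (del l a) := by
          ext j; simp only [pad, del]; grind
        have := H T (del l a)
        simp only [count_cup, caps_cons, count_cap, h1, h2, h3] at this ⊢
        split_ifs
        · exact this
        · simp
    · refine ⟨c, 1, hd, fun T _ _ _ a => ?_⟩
      have h1 (x : T) : del l (pad l x x a) = a := by
        ext j; simp only [pad, del]; grind
      simp [count_cup, caps_cons, count_cap, h1, pad]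
    · obtain h | h := (show l = i + 1 ∨ i + 2 ≤ l by omega)
      · subst h
        refine ⟨c, 0, hd, fun T _ _ _ a => ?_⟩
        simp only [count_cup, caps_cons, count_cap, pow_zero, one_mul]
        rw [Finset.sum_eq_single (a i)]
        · rw [if_pos (by simp only [pad]; grind)]
          congr 1; ext j; simp only [pad, del]; grind
        · intro x _ hx
          rw [if_neg]; simp only [pad]; grind
        · simp
      · obtain ⟨l, rfl⟩ := Nat.exists_eq_add_of_le' (show 2 ≤ l by omega)
        obtain ⟨m, rfl⟩ := Nat.exists_eq_add_of_le' (show 2 ≤ m by omega)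
        obtain ⟨c', j, hc', H⟩ := ih (i := i) hd (by omega)
        refine ⟨l :: c', j, fits_cap.mpr ⟨by omega, hc'⟩, fun T _ _ _ a => ?_⟩
        have h1 (x : T) : pad i x x a (l + 2) = a l := by simp only [pad]; grind
        have h2 (x : T) : pad i x x a (l + 2 + 1) = a (l + 1) := by simp only [pad]; grind
        have h3 (x : T) : del (l + 2) (pad i x x a) = pad i x x (del l a) := by
          ext j; simp only [pad, del]; grind
        have := H T (del l a)
        simp only [count_cup, caps_cons, count_cap, h1, h2, h3] at this ⊢
        split_ifs
        · exact this
        · simp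

/-- Crossingless diagrams without upper ends reduce to maxima and closed curves. -/
theorem exists_caps (w : List Piece) (hw : Crossingless w) {m : ℕ} (h : Fits m w 0) :
    ∃ c j, Fits m (caps c) 0 ∧
      ∀ (T : Type) [AddCommGroup T] [Fintype T] [DecidableEq T] (a : ℕ → T),
        count w a = Fintype.card T ^ j * count (caps c) a := by
  induction w generalizing m with
  | nil => exact ⟨[], 0, h, fun T _ _ _ a => by simp [caps]⟩
  | cons p w ih =>
    obtain ⟨hp, hv⟩ := List.forall_mem_cons.mp hw
    obtain ⟨κ, i⟩ := p
    obtain rfl | rfl : κ = .cup ∨ κ = .cap := hp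
    · obtain ⟨hi, h⟩ := fits_cup.mp h
      obtain ⟨c, j, hc, H⟩ := ih hv h
      obtain ⟨c', j', hc', H'⟩ := exists_caps_cup c hc hi
      refine ⟨c', j + j', hc', fun T _ _ _ a => ?_⟩
      have := H' T a
      rw [count_cup] at this ⊢
      simp_rw [H, ← Finset.mul_sum, this, pow_add, mul_assoc]
    · obtain ⟨m, rfl, hi, h⟩ := h.cap_elim
      obtain ⟨c, j, hc, H⟩ := ih hv h
      refine ⟨i :: c, j, fits_cap.mpr ⟨hi, hc⟩, fun T _ _ _ a => ?_⟩
      simp only [caps_cons, count_cap, H]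
      split_ifs <;> simp

/-- The first of `m` places becomes the last one. -/
def rotate {T : Type*} (m : ℕ) (a : ℕ → T) : ℕ → T := fun j => if j + 1 < m then a (j + 1) else a 0

theorem caps_append (c d : List ℕ) : caps (c ++ d) = caps c ++ caps d := List.map_append

theorem caps_shift (k : ℕ) (c : List ℕ) : caps (c.map (k + ·)) = (caps c).map (Piece.shift k) := by
  simp [caps, Piece.shift, Function.comp_def]

theorem cnt_caps_zero (c : List ℕ) (a : ℕ → T) (x : ℕ) :
    cnt ((caps c).map Piece.toOp) a (fun _ => x) = count (caps c) a * x := by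
  induction c generalizing a with
  | nil => simp [caps, cnt, count]
  | cons i c ih =>
    simp only [caps_cons, List.map_cons, Piece.toOp, cnt, count_cap, ih]
    split_ifs <;> simp

theorem Fits.shift {m n : ℕ} {w : List Piece} (h : Fits m w n) (k l : ℕ) :
    Fits (k + m + l) (w.map (Piece.shift k)) (k + n + l) := by
  induction w generalizing m with
  | nil => cases h; rfl
  | cons p w ih =>
    obtain ⟨h1, h2⟩ := h
    refine ⟨?_, ?_⟩
    · simp only [Piece.shift]; omega
    · have := ih h2
      convert this using 1
      simp only [Piece.above, Piece.shift]; omega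

/-- The ends of a planar matching lie on a circle, so the choice of the first end is immaterial. -/
theorem exists_caps_rotate (c : List ℕ) {m : ℕ} (hc : Fits m (caps c) 0) :
    ∃ c', Fits m (caps c') 0 ∧
      ∀ (T : Type) [AddCommGroup T] [Fintype T] [DecidableEq T] (a : ℕ → T),
        count (caps c') a = count (caps c) (rotate m a) := by
  induction c generalizing m with
  | nil => exact ⟨[], hc, fun T _ _ _ a => by simp [caps, count_nil]⟩
  | cons j c ih =>
    obtain ⟨m, rfl, hj, hd⟩ := hc.cap_elim
    obtain h | rfl := hj.lt_or_eq
    · obtain ⟨c', hc', H⟩ := ih hd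
      refine ⟨(j + 1) :: c', fits_cap.mpr ⟨h, hc'⟩, fun T _ _ _ a => ?_⟩
      simp only [caps_cons, count_cap, H]
      rw [show rotate (m + 2) a j = a (j + 1) by simp only [rotate]; grind,
        show rotate (m + 2) a (j + 1) = a (j + 1 + 1) by simp only [rotate]; grind]
      congr 1
      refine count_congr hd fun i hi => ?_
      simp only [rotate, del]; grind
    -- Here the lowest maximum uses the rotated strand, which is now the first one. It becomes the
    -- outermost maximum, drawn last, with all others shifted inside it.
    · refine ⟨c.map (1 + ·) ++ [0], ?_, fun T _ _ _ a => ?_⟩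
      · rw [caps_append, caps_shift]
        have := fun h => Fits.shift (w := caps c) (m := j) (n := 0) h 1 1
        rw [show 1 + j + 1 = j + 2 by ring] at this
        exact (this hd).append ⟨le_rfl, rfl⟩
      · have h1 : a = wrap 1 j (fun i => a (i + 1)) (fun i => if i = 0 then a 0 else a (i + j)) := by
          ext i; simp only [wrap]; grind
        have h2 : count (caps (j :: c)) (rotate (j + 2) a) =
            if a 0 = a (j + 1) then count (caps c) (fun i => a (i + 1)) else 0 := by
          rw [caps_cons, count_cap]
          rw [show rotate (j + 2) a j = a (j + 1) by simp only [rotate]; grind,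
            show rotate (j + 2) a (j + 1) = a 0 by simp only [rotate]; grind]
          simp only [eq_comm (a := a (j + 1))]
          congr 1
          refine count_congr hd fun i hi => ?_
          simp only [rotate, del]; grind
        rw [h2]
        conv_lhs => rw [h1]
        rw [caps_append, caps_shift, count_append, List.map_map,
          show Piece.toOp ∘ Piece.shift 1 = StrandOp.shift 1 ∘ Piece.toOp from
            funext (Piece.toOp_shift 1), ← List.map_map, cnt_shift (Fits.opFits (w := caps c) hd)]
        simp_rw [wrap_zero]
        rw [cnt_caps_zero, caps_cons, count_cap]
        simp [caps, count_nil, add_comm]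

/-- A closing by maxima, with one strand passing below the tangle. -/
theorem exists_caps_around (c : List ℕ) {r : ℕ} (hc : Fits (r + 2) (caps c) 0) :
    ∃ c' j, Fits r (caps c') 0 ∧
      ∀ (T : Type) [AddCommGroup T] [Fintype T] [DecidableEq T] (b : ℕ → T),
        ∑ x, count (caps c) (fun j => if j = 0 then x else if j = r + 1 then x else b (j - 1)) =
          Fintype.card T ^ j * count (caps c') b := by
  -- Rotation makes the two ends of the strand around the tangle neighbours, so that the strand
  -- becomes an ordinary minimum at the left.
  obtain ⟨d, hd, H⟩ := exists_caps_rotate c hc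
  obtain ⟨c', j, hc', H'⟩ := exists_caps_cup d hd (Nat.zero_le r)
  refine ⟨c', j, hc', fun T _ _ _ b => ?_⟩
  rw [← H', count_cup]
  refine Finset.sum_congr rfl fun x _ => ?_
  rw [H]
  refine count_congr hc fun i hi => ?_
  simp only [rotate, pad]; grind

theorem Fits.append_elim {v w : List Piece} {m r : ℕ} (h : Fits m (v ++ w) r) :
    ∃ n, Fits m v n ∧ Fits n w r := by
  induction v generalizing m with
  | nil => exact ⟨m, rfl, h⟩
  | cons p v ih =>
    obtain ⟨n, h1, h2⟩ := ih h.2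
    exact ⟨n, ⟨h.1, h1⟩, h2⟩

/-- A crossingless outside of a tangle with `r` ends closes it as maxima do. -/
theorem exists_caps_outside_aux (below : List Piece) (hb : Crossingless below) (c : List ℕ)
    {k l r : ℕ} (hfb : Fits 0 below (k + l)) (hc : Fits (k + r + l) (caps c) 0) :
    ∃ c' j, Fits r (caps c') 0 ∧
      ∀ (T : Type) [AddCommGroup T] [Fintype T] [DecidableEq T] (b : ℕ → T),
        cnt (below.map Piece.toOp) 0 (fun a => count (caps c) (wrap k r b a)) =
          Fintype.card T ^ j * count (caps c') b := by
  induction below using List.reverseRecOn generalizing c k l r with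
  | nil =>
    obtain ⟨rfl, rfl⟩ : k = 0 ∧ l = 0 := by have : 0 = k + l := hfb; omega
    refine ⟨c, 0, by simpa using hc, fun T _ _ _ b => ?_⟩
    rw [pow_zero, one_mul]
    refine count_congr hc fun i hi => ?_
    simp only [wrap]; grind
  | append_singleton below p ih =>
    have hb' : Crossingless below := fun q hq => hb q (List.mem_append_left _ hq)
    obtain ⟨n, hn, hp⟩ := hfb.append_elim
    obtain ⟨κ, i⟩ := p
    simp only [List.map_append, cnt_append, List.map_cons, List.map_nil]
    obtain rfl | rfl : κ = .cup ∨ κ = .cap := hb ⟨κ, i⟩ (by simp)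
    · obtain ⟨hi, hn'⟩ := fits_cup.mp hp
      change n + 2 = k + l at hn'
      simp only [Piece.toOp, cnt]
      -- The highest minimum below the tangle lies to its left, has one strand on either side of it,
      -- or lies to its right. In the outer cases the minimum slides up past the tangle and is
      -- absorbed by the maxima.
      obtain h | h | h : i + 2 ≤ k ∨ i + 1 = k ∨ k ≤ i := by omega
      · obtain ⟨k, rfl⟩ := Nat.exists_eq_add_of_le' (show 2 ≤ k by omega)
        rw [show k + 2 + r + l = (k + r + l) + 2 by ring] at hc
        obtain ⟨d, j, hd, H⟩ := exists_caps_cup c (i := i) hc (by omega)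
        obtain ⟨c', j', hc', H'⟩ := ih hb' d (k := k) (l := l) (r := r)
          (by rwa [show k + l = n by omega]) hd
        refine ⟨c', j + j', hc', fun T _ _ _ b => ?_⟩
        rw [pow_add, mul_assoc, ← H', ← cnt_mul_left]
        congr 1; ext a
        rw [← H, count_cup]
        refine Finset.sum_congr rfl fun x _ => ?_
        congr 1; ext q; simp only [wrap, pad]; grind
      · subst h
        obtain ⟨l, rfl⟩ := Nat.exists_eq_add_of_le' (show 1 ≤ l by omega)
        -- The two strands beside the tangle are treated as further ends, and afterwards joined
        -- below it.
        obtain ⟨d, j, hd, H⟩ := ih hb' c (k := i) (l := l) (r := r + 2)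
          (by rwa [show i + l = n by omega])
          (by rwa [show i + (r + 2) + l = i + 1 + r + (l + 1) by ring])
        obtain ⟨c', j', hc', H'⟩ := exists_caps_around d hd
        refine ⟨c', j + j', hc', fun T _ _ _ b => ?_⟩
        rw [pow_add, mul_assoc, ← H', Finset.mul_sum, cnt_sum]
        refine Finset.sum_congr rfl fun x _ => ?_
        rw [← H]
        congr 1; ext a
        congr 1; ext q; simp only [wrap, pad]; grind
      · obtain ⟨l, rfl⟩ := Nat.exists_eq_add_of_le' (show 2 ≤ l by omega)
        rw [show k + r + (l + 2) = (k + r + l) + 2 by ring] at hc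
        obtain ⟨d, j, hd, H⟩ := exists_caps_cup c (i := i + r) hc (by omega)
        obtain ⟨c', j', hc', H'⟩ := ih hb' d (k := k) (l := l) (r := r)
          (by rwa [show k + l = n by omega]) hd
        refine ⟨c', j + j', hc', fun T _ _ _ b => ?_⟩
        rw [pow_add, mul_assoc, ← H', ← cnt_mul_left]
        congr 1; ext a
        rw [← H, count_cup]
        refine Finset.sum_congr rfl fun x _ => ?_
        congr 1; ext q; simp only [wrap, pad]; grind
    · obtain ⟨n, rfl, hi, hn'⟩ := hp.cap_elim
      change n = k + l at hn'
      subst hn'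
      simp only [Piece.toOp, cnt]
      -- A maximum below the tangle moves up past it, to the left or right, and joins the maxima
      -- above.
      obtain h | h : i < k ∨ k ≤ i := by omega
      · obtain ⟨c', j, hc', H⟩ := ih hb' (i :: c) (k := k + 2) (l := l) (r := r)
          (by rwa [show k + 2 + l = k + l + 2 by ring])
          (by rw [show k + 2 + r + l = k + r + l + 2 by ring]; exact fits_cap.mpr ⟨by omega, hc⟩)
        refine ⟨c', j, hc', fun T _ _ _ b => ?_⟩
        rw [← H]
        congr 1; ext a
        rw [caps_cons, count_cap]
        rw [show wrap (k + 2) r b a i = a i by simp only [wrap]; grind,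
          show wrap (k + 2) r b a (i + 1) = a (i + 1) by simp only [wrap]; grind]
        congr 2; ext q; simp only [wrap, del]; grind
      · obtain ⟨c', j, hc', H⟩ := ih hb' ((i + r) :: c) (k := k) (l := l + 2) (r := r)
          (by rwa [show k + (l + 2) = k + l + 2 by ring])
          (by rw [show k + r + (l + 2) = k + r + l + 2 by ring]
              exact fits_cap.mpr ⟨by omega, hc⟩)
        refine ⟨c', j, hc', fun T _ _ _ b => ?_⟩
        rw [← H]
        congr 1; ext a
        rw [caps_cons, count_cap]
        rw [show wrap k r b a (i + r) = a i by simp only [wrap]; grind,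
          show wrap k r b a (i + r + 1) = a (i + 1) by simp only [wrap]; grind]
        congr 2; ext q; simp only [wrap, del]; grind

/-- If the outside of a tangle with `r` ends is crossingless, then some system of maxima joins the
ends as the outside does, up to closed curves. -/
theorem exists_caps_outside {below above : List Piece} (hb : Crossingless below)
    (ha : Crossingless above) {k l r : ℕ} (hfb : Fits 0 below (k + l))
    (hfa : Fits (k + r + l) above 0) :
    ∃ c j, Fits r (caps c) 0 ∧
      ∀ (T : Type) [AddCommGroup T] [Fintype T] [DecidableEq T] (t : List Piece), Fits 0 t r →
        count (below ++ t.map (Piece.shift k) ++ above) (0 : ℕ → T) =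
          Fintype.card T ^ j * count (t ++ caps c) (0 : ℕ → T) := by
  obtain ⟨d, j, hd, H⟩ := exists_caps above ha hfa
  obtain ⟨c, j', hc, H'⟩ := exists_caps_outside_aux below hb d hfb hd
  refine ⟨c, j + j', hc, fun T _ _ _ t ht => ?_⟩
  rw [List.append_assoc, count_append, count_append]
  have h1 (a : ℕ → T) : count (t.map (Piece.shift k) ++ above) a =
      Fintype.card T ^ j * cnt (t.map Piece.toOp) 0 fun b => count (caps d) (wrap k r b a) := by
    rw [count_shift ht k above a 0, ← cnt_mul_left]
    simp_rw [H]
  have h2 : (count (t.map (Piece.shift k) ++ above) : (ℕ → T) → ℕ) = fun a =>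
      Fintype.card T ^ j * cnt (t.map Piece.toOp) 0 fun b => count (caps d) (wrap k r b a) :=
    funext h1
  -- After the exchange the tangle is coloured first, and the outside is evaluated for fixed colours
  -- of the ends.
  rw [h2, cnt_mul_left, cnt_comm, pow_add, mul_assoc, ← cnt_mul_left]
  simp_rw [H', cnt_mul_left]

end

section

variable {T : Type*} [AddCommGroup T] [Fintype T] [DecidableEq T]

/-! ### Invariance of the counts -/

theorem cnt_far_cup (x : StrandOp) (i d : ℕ) (w : List StrandOp) (a : ℕ → T) (φ : (ℕ → T) → ℕ) :
    cnt (.cup i :: x.shift (i + 2 + d) :: w) a φ = cnt (x.shift (i + d) :: .cup i :: w) a φ := by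
  cases x with
  | cup j =>
    simp only [cnt, StrandOp.shift]
    rw [Finset.sum_comm]
    refine Finset.sum_congr rfl fun x _ => Finset.sum_congr rfl fun y _ => ?_
    congr 1; ext q; simp only [pad]; grind (splits := 20)
  | cap j =>
    simp only [cnt, StrandOp.shift]
    have h1 (x : T) : pad i x x a (i + 2 + d + j) = a (i + d + j) := by simp only [pad]; grind
    have h2 (x : T) : pad i x x a (i + 2 + d + j + 1) = a (i + d + j + 1) := by
      simp only [pad]; grind
    simp only [h1, h2]
    split_ifs
    · refine Finset.sum_congr rfl fun y _ => ?_
      congr 1; ext q; simp only [pad, del]; grind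
    · simp
  | mix α β j =>
    simp only [cnt, StrandOp.shift]
    have h1 (x : T) : pad i x x a (i + 2 + d + j) = a (i + d + j) := by simp only [pad]; grind
    have h2 (x : T) : pad i x x a (i + 2 + d + j + 1) = a (i + d + j + 1) := by
      simp only [pad]; grind
    simp only [h1, h2]
    rw [Finset.sum_comm]
    refine Finset.sum_congr rfl fun z _ => ?_
    split_ifs
    · refine Finset.sum_congr rfl fun y _ => ?_
      congr 1; ext q; simp only [pad, bump]; grind
    · simp

theorem cnt_far_cap (x : StrandOp) (i d : ℕ) (w : List StrandOp) (a : ℕ → T) (φ : (ℕ → T) → ℕ) :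
    cnt (.cap i :: x.shift (i + d) :: w) a φ = cnt (x.shift (i + 2 + d) :: .cap i :: w) a φ := by
  cases x with
  | cup j =>
    simp only [cnt, StrandOp.shift]
    have h1 (x : T) : pad (i + 2 + d + j) x x a i = a i := by simp only [pad]; grind
    have h2 (x : T) : pad (i + 2 + d + j) x x a (i + 1) = a (i + 1) := by
      simp only [pad]; grind
    simp only [h1, h2]
    split_ifs
    · refine Finset.sum_congr rfl fun y _ => ?_
      congr 1; ext q; simp only [pad, del]; grind
    · simp
  | cap j =>
    simp only [cnt, StrandOp.shift]
    rw [show del i a (i + d + j) = a (i + 2 + d + j) by simp only [del]; grind,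
      show del i a (i + d + j + 1) = a (i + 2 + d + j + 1) by simp only [del]; grind,
      show del (i + 2 + d + j) a i = a i by simp only [del]; grind,
      show del (i + 2 + d + j) a (i + 1) = a (i + 1) by simp only [del]; grind,
      show del (i + d + j) (del i a) = del i (del (i + 2 + d + j) a) by
        ext q; simp only [del]; grind]
    split_ifs <;> rfl
  | mix α β j =>
    simp only [cnt, StrandOp.shift]
    have h1 (z : T) : bump (i + 2 + d + j) z a i = a i := by simp only [bump]; grind
    have h2 (z : T) : bump (i + 2 + d + j) z a (i + 1) = a (i + 1) := by
      simp only [bump]; grind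
    rw [show del i a (i + d + j) = a (i + 2 + d + j) by simp only [del]; grind,
      show del i a (i + d + j + 1) = a (i + 2 + d + j + 1) by simp only [del]; grind]
    simp only [h1, h2]
    have h3 (z : T) : bump (i + d + j) z (del i a) = del i (bump (i + 2 + d + j) z a) := by
      ext q; simp only [del, bump]; grind
    simp only [h3]
    by_cases h : a i = a (i + 1) <;> simp [h]

theorem cnt_far_mix (x : StrandOp) (α β : ℤ) (i d : ℕ) (w : List StrandOp) (a : ℕ → T)
    (φ : (ℕ → T) → ℕ) :
    cnt (.mix α β i :: x.shift (i + 2 + d) :: w) a φ =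
      cnt (x.shift (i + 2 + d) :: .mix α β i :: w) a φ := by
  cases x with
  | cup j =>
    simp only [cnt, StrandOp.shift]
    have h1 (x : T) : pad (i + 2 + d + j) x x a i = a i := by simp only [pad]; grind
    have h2 (x : T) : pad (i + 2 + d + j) x x a (i + 1) = a (i + 1) := by
      simp only [pad]; grind
    simp only [h1, h2]
    rw [Finset.sum_comm]
    refine Finset.sum_congr rfl fun z _ => ?_
    split_ifs
    · refine Finset.sum_congr rfl fun y _ => ?_
      congr 1; ext q; simp only [pad, bump]; grind
    · simp
  | cap j =>
    simp only [cnt, StrandOp.shift]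
    have h1 (z : T) : bump i z a (i + 2 + d + j) = a (i + 2 + d + j) := by
      simp only [bump]; grind
    have h2 (z : T) : bump i z a (i + 2 + d + j + 1) = a (i + 2 + d + j + 1) := by
      simp only [bump]; grind
    rw [show del (i + 2 + d + j) a i = a i by simp only [del]; grind,
      show del (i + 2 + d + j) a (i + 1) = a (i + 1) by simp only [del]; grind]
    simp only [h1, h2]
    have h3 (z : T) : bump i z (del (i + 2 + d + j) a) = del (i + 2 + d + j) (bump i z a) := by
      ext q; simp only [del, bump]; grind
    simp only [h3]
    by_cases h : a (i + 2 + d + j) = a (i + 2 + d + j + 1) <;> simp [h]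
  | mix α' β' j =>
    simp only [cnt, StrandOp.shift]
    have h1 (z : T) : bump i z a (i + 2 + d + j) = a (i + 2 + d + j) := by
      simp only [bump]; grind
    have h2 (z : T) : bump i z a (i + 2 + d + j + 1) = a (i + 2 + d + j + 1) := by
      simp only [bump]; grind
    have h3 (z : T) : bump (i + 2 + d + j) z a i = a i := by simp only [bump]; grind
    have h4 (z : T) : bump (i + 2 + d + j) z a (i + 1) = a (i + 1) := by
      simp only [bump]; grind
    have h5 (y z : T) : bump (i + 2 + d + j) y (bump i z a) =
        bump i z (bump (i + 2 + d + j) y a) := by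
      ext q; simp only [bump]; grind
    simp only [h1, h2, h3, h4, h5]
    simp_rw [← Finset.sum_filter]
    exact Finset.sum_comm

theorem count_zigzag (i : ℕ) (v : List Piece) (a : ℕ → T) :
    count (⟨.cup, i⟩ :: ⟨.cap, i + 1⟩ :: v) a = count v a := by
  simp only [count_cup, count_cap]
  rw [Finset.sum_eq_single (a i)]
  · rw [if_pos (by simp only [pad]; grind)]
    congr 1; ext j; simp only [pad, del]; grind
  · intro x _ hx
    rw [if_neg]; simp only [pad]; grind
  · simp

theorem count_zigzag' (i : ℕ) (v : List Piece) (a : ℕ → T) :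
    count (⟨.cup, i + 1⟩ :: ⟨.cap, i⟩ :: v) a = count v a := by
  simp only [count_cup, count_cap]
  rw [Finset.sum_eq_single (a i)]
  · rw [if_pos (by simp only [pad]; grind)]
    congr 1; ext j; simp only [pad, del]; grind
  · intro x _ hx
    rw [if_neg]; simp only [pad]; grind
  · simp

theorem count_loop (i : ℕ) (v : List Piece) (a : ℕ → T) :
    count (⟨.cup, i⟩ :: ⟨.cap, i⟩ :: v) a = Fintype.card T * count v a := by
  have h1 (x : T) : del i (pad i x x a) = a := by ext j; simp only [pad, del]; grind
  simp [count_cup, count_cap, h1, pad]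

theorem count_far (p q : Kind) (i d : ℕ) (v : List Piece) (a : ℕ → T) :
    count (⟨p, i⟩ :: ⟨q, i + p.outs + d⟩ :: v) a = count (⟨q, i + p.ins + d⟩ :: ⟨p, i⟩ :: v) a := by
  have h (k : ℕ) : Piece.toOp ⟨q, k⟩ = (Piece.toOp ⟨q, 0⟩).shift k := Piece.toOp_shift k ⟨q, 0⟩
  simp only [count, List.map_cons]
  rw [h (i + p.outs + d), h (i + p.ins + d)]
  cases p
  · exact cnt_far_cup ..
  · exact cnt_far_cap ..
  · exact cnt_far_mix ..
  · exact cnt_far_mix ..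


theorem count_ite_congr {P Q : Prop} [Decidable P] [Decidable Q] {v : List Piece} {a b : ℕ → T}
    (h : P ↔ Q) (hab : P → a = b) :
    (if P then count v a else 0) = if Q then count v b else 0 := by
  by_cases hP : P
  · rw [if_pos hP, if_pos (h.mp hP), hab hP]
  · rw [if_neg hP, if_neg (h.not.mp hP)]

/-- The colouring rule is that of the dihedral quandle `(a, b) ↦ 2a - b`, whose axioms correspond to
the Reidemeister moves. Equality holds for every colouring of the bottom, so it persists inside any
diagram. -/
theorem LocalMove.count_eq {L R : List Piece} (h : LocalMove L R) (v : List Piece) (a : ℕ → T) :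
    count (L ++ v) a = count (R ++ v) a := by
  cases h with
  | far p q i d => exact count_far p q i d v a
  | zigzag i => exact count_zigzag i v a
  | zigzag' i => exact count_zigzag' i v a
  | slide_cap_pos i =>
    simp only [List.cons_append, List.nil_append, count_pos, count_neg, count_cap]
    refine count_ite_congr ?_ fun h => ?_
    · simp only [bump]; grind
    · ext j; simp only [bump, del] at h ⊢; grind
  | slide_cap_neg i =>
    simp only [List.cons_append, List.nil_append, count_pos, count_neg, count_cap]
    refine count_ite_congr ?_ fun h => ?_
    · simp only [bump]; grind
    · ext j; simp only [bump, del] at h ⊢; grind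
  | slide_cup_pos i =>
    simp only [List.cons_append, List.nil_append, count_pos, count_neg, count_cup]
    refine Finset.sum_congr rfl fun x _ => ?_
    congr 1; ext j; simp only [bump, pad]; grind
  | slide_cup_neg i =>
    simp only [List.cons_append, List.nil_append, count_pos, count_neg, count_cup]
    -- The end of the minimum that is summed over lies on different sides of the upper strand in the
    -- two diagrams, whence the reflection `x ↦ 2 a i - x`.
    refine Fintype.sum_equiv ((Equiv.subLeft (a i)).trans (Equiv.addRight (a i))) _ _ fun x => ?_
    congr 1; ext j; simp only [bump, pad, Equiv.trans_apply, Equiv.subLeft_apply, Equiv.coe_addRight]; grind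
  | R1_cap_pos i =>
    simp only [List.cons_append, List.nil_append, count_pos, count_cap]
    refine count_ite_congr ?_ fun h => ?_
    · simp only [bump]; grind
    · ext j; simp only [bump, del] at h ⊢; grind
  | R1_cap_neg i =>
    simp only [List.cons_append, List.nil_append, count_neg, count_cap]
    refine count_ite_congr ?_ fun h => ?_
    · simp only [bump]; grind
    · ext j; simp only [bump, del] at h ⊢; grind
  | R1_cup_pos i =>
    simp only [List.cons_append, List.nil_append, count_pos, count_cup]
    refine Finset.sum_congr rfl fun x _ => ?_
    congr 1; ext j; simp only [bump, pad]; grind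
  | R1_cup_neg i =>
    simp only [List.cons_append, List.nil_append, count_neg, count_cup]
    refine Finset.sum_congr rfl fun x _ => ?_
    congr 1; ext j; simp only [bump, pad]; grind
  | R2_pos_neg i =>
    simp only [List.cons_append, List.nil_append, count_pos, count_neg]
    congr 1; ext j; simp only [bump]; grind
  | R2_neg_pos i =>
    simp only [List.cons_append, List.nil_append, count_pos, count_neg]
    congr 1; ext j; simp only [bump]; grind
  | R3_pos i =>
    simp only [List.cons_append, List.nil_append, count_pos]
    congr 1; ext j; simp only [bump]; grind
  | R3_neg i =>
    simp only [List.cons_append, List.nil_append, count_neg]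
    congr 1; ext j; simp only [bump]; grind

theorem LocalMove.count_append_eq {L R : List Piece} (h : LocalMove L R) (u v : List Piece)
    (a : ℕ → T) : count (u ++ L ++ v) a = count (u ++ R ++ v) a := by
  rw [List.append_assoc, List.append_assoc, count_append, count_append]
  congr 1
  exact funext (h.count_eq v)

theorem Diagram.Isotopic.count_eq {m n : ℕ} {D E : Diagram m n} (h : D.Isotopic E) (a : ℕ → T) :
    count D.pieces a = count E.pieces a := by
  induction h with
  | rel D E h =>
    obtain ⟨u, v, L, R, h, h1, h2⟩ := h
    rw [h1, h2, h.count_append_eq]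
  | refl => rfl
  | symm _ _ _ ih => exact ih.symm
  | trans _ _ _ _ _ h1 h2 => exact h1.trans h2

theorem Diagram.Isotopic.glue {m n r : ℕ} {D E : Diagram m n} (h : D.Isotopic E)
    (F : Diagram n r) : (D.glue F).Isotopic (E.glue F) := by
  induction h with
  | rel D E h =>
    obtain ⟨u, v, L, R, h, h1, h2⟩ := h
    exact .rel _ _ ⟨u, v ++ F.pieces, L, R, h, by simp [Diagram.glue, h1], by simp [Diagram.glue, h2]⟩
  | refl => exact .refl _
  | symm _ _ _ ih => exact ih.symm
  | trans _ _ _ _ _ h1 h2 => exact h1.trans _ _ _ h2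

end

section

variable {T : Type*} [AddCommGroup T] [Fintype T] [DecidableEq T]

/-! ### Counts and functions on the points of a diagram -/

/-- The colours below and above a critical level. -/
def StepRel {T : Type*} [AddCommGroup T] (p : Piece) (a b : ℕ → T) : Prop :=
  (∀ j < p.at_, a j = b j) ∧ (∀ j, a (p.at_ + p.kind.ins + j) = b (p.at_ + p.kind.outs + j)) ∧
  match p.kind with
  | .cup => b p.at_ = b (p.at_ + 1)
  | .cap => a p.at_ = a (p.at_ + 1)
  | .pos => a p.at_ = b (p.at_ + 1) ∧ (2 : ℤ) • a p.at_ - b p.at_ - a (p.at_ + 1) = 0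
  | .neg => a (p.at_ + 1) = b p.at_ ∧ (2 : ℤ) • a (p.at_ + 1) - a p.at_ - b (p.at_ + 1) = 0

section
variable {T : Type*} [AddCommGroup T]

theorem stepRel_cup {i : ℕ} {a b : ℕ → T} :
    StepRel ⟨.cup, i⟩ a b ↔ b = pad i (b i) (b i) a := by
  simp only [StepRel, Kind.ins, Kind.outs]
  constructor
  · rintro ⟨h1, h2, h3⟩
    ext j
    simp only [pad]
    split_ifs with h h' h'
    · exact (h1 j h).symm
    · rw [h']
    · rw [h', h3]
    · have := h2 (j - 2 - i)
      rw [show i + 0 + (j - 2 - i) = j - 2 by omega, show i + 2 + (j - 2 - i) = j by omega] at this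
      exact this.symm
  · intro h
    refine ⟨fun j hj => ?_, fun j => ?_, ?_⟩ <;> rw [h] <;> simp only [pad] <;> grind

theorem stepRel_cap {i : ℕ} {a b : ℕ → T} :
    StepRel ⟨.cap, i⟩ a b ↔ a i = a (i + 1) ∧ b = del i a := by
  simp only [StepRel, Kind.ins, Kind.outs]
  constructor
  · rintro ⟨h1, h2, h3⟩
    refine ⟨h3, ?_⟩
    ext j
    simp only [del]
    split_ifs with h
    · exact (h1 j h).symm
    · have := h2 (j - i)
      rw [show i + 2 + (j - i) = j + 2 by omega, show i + 0 + (j - i) = j by omega] at this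
      exact this.symm
  · rintro ⟨h, rfl⟩
    refine ⟨fun j hj => ?_, fun j => ?_, h⟩ <;> simp only [del] <;> grind

theorem stepRel_pos {i : ℕ} {a b : ℕ → T} :
    StepRel ⟨.pos, i⟩ a b ↔ b = bump i (a i - a (i + 1)) a := by
  simp only [StepRel, Kind.ins, Kind.outs]
  constructor
  · rintro ⟨h1, h2, h3, h4⟩
    ext j
    simp only [bump]
    split_ifs with h
    · grind
    · obtain h | h : j < i ∨ i + 2 ≤ j := by omega
      · exact (h1 j h).symm
      · have := h2 (j - 2 - i)
        rw [show i + 2 + (j - 2 - i) = j by omega] at this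
        exact this.symm
  · rintro rfl
    refine ⟨fun j hj => ?_, fun j => ?_, ?_, ?_⟩ <;> simp only [bump] <;> grind

theorem stepRel_neg {i : ℕ} {a b : ℕ → T} :
    StepRel ⟨.neg, i⟩ a b ↔ b = bump i (a (i + 1) - a i) a := by
  simp only [StepRel, Kind.ins, Kind.outs]
  constructor
  · rintro ⟨h1, h2, h3, h4⟩
    ext j
    simp only [bump]
    split_ifs with h
    · grind
    · obtain h | h : j < i ∨ i + 2 ≤ j := by omega
      · exact (h1 j h).symm
      · have := h2 (j - 2 - i)
        rw [show i + 2 + (j - 2 - i) = j by omega] at this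
        exact this.symm
  · rintro rfl
    refine ⟨fun j hj => ?_, fun j => ?_, ?_, ?_⟩ <;> simp only [bump] <;> grind

/-- The colourings of all levels, starting with `a`. -/
def LevelColouring (w : List Piece) (a : ℕ → T) : Type _ :=
  {F : ℕ → ℕ → T // F 0 = a ∧ (∀ k p, w[k]? = some p → StepRel p (F k) (F (k + 1))) ∧
    ∀ k ≥ w.length, F (k + 1) = F k}

/-- A colouring starts with a step. -/
def LevelColouring.consEquiv (p : Piece) (w : List Piece) (a : ℕ → T) :
    LevelColouring (p :: w) a ≃ Σ b : {b : ℕ → T // StepRel p a b}, LevelColouring w b.1 where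
  toFun F := ⟨⟨F.1 1, by have := F.2.2.1 0 p rfl; rwa [F.2.1] at this⟩,
    ⟨fun k => F.1 (k + 1), rfl, fun k q hq => F.2.2.1 (k + 1) q (by simpa using hq),
      fun k hk => F.2.2.2 (k + 1) (by simpa using hk)⟩⟩
  invFun G := ⟨fun k => k.casesOn a G.2.1, rfl, by
    rintro (_ | k) q hq
    · obtain rfl : p = q := by simpa using hq
      have := G.1.2
      rw [← G.2.2.1] at this
      exact this
    · exact G.2.2.2.1 k q (by simpa using hq), by
    rintro (_ | k) hk
    · simp at hk
    · exact G.2.2.2.2 k (by simpa using hk)⟩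
  left_inv F := by
    apply Subtype.ext
    funext k
    cases k with
    | zero => exact F.2.1.symm
    | succ k => rfl
  right_inv G := by
    obtain ⟨⟨b, hb⟩, ⟨F, h0, hF⟩⟩ := G
    obtain rfl : F 0 = b := h0
    rfl
end

/-- The recursion for `cnt` enumerates colourings level by level: a minimum has one continuation for
each colour, a maximum at most one, a crossing exactly one. -/
theorem levelColouring_card (w : List Piece) (a : ℕ → T) :
    Finite (LevelColouring w a) ∧ Nat.card (LevelColouring w a) = count w a := by
  induction w generalizing a with
  | nil =>
    have : Unique (LevelColouring [] a) :=
      { default := ⟨fun _ => a, rfl, by simp, by simp⟩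
        uniq := fun F => Subtype.ext <| funext fun k => by
          induction k with
          | zero => exact F.2.1
          | succ k ih => rw [F.2.2.2 k (Nat.zero_le _), ih] }
    exact ⟨inferInstance, by simp [count_nil]⟩
  | cons p w ih =>
    have := fun a => (ih a).1
    have ih := fun a => (ih a).2
    have e := LevelColouring.consEquiv p w a
    have key : ∀ (S : Finset (ℕ → T)), (∀ b, StepRel p a b ↔ b ∈ S) →
        Finite (LevelColouring (p :: w) a) ∧
          Nat.card (LevelColouring (p :: w) a) = ∑ b ∈ S, count w b := by
      intro S hS
      have : Fintype {b : ℕ → T // StepRel p a b} := Fintype.subtype S fun b => (hS b).symm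
      refine ⟨Finite.of_equiv _ e.symm, ?_⟩
      rw [Nat.card_congr e, Nat.card_sigma, Finset.sum_subtype S fun b => (hS b).symm]
      exact Finset.sum_congr rfl fun b _ => ih _
    obtain ⟨_ | _ | _ | _, i⟩ := p
    · have hinj : Function.Injective fun x : T => pad i x x a := fun x y h => by
        simpa [pad] using congrFun h i
      convert key (Finset.univ.map ⟨_, hinj⟩) fun b => ?_
      · rw [count_cup, Finset.sum_map]; rfl
      · rw [stepRel_cup]
        simp only [Finset.mem_map, Finset.mem_univ, true_and, Function.Embedding.coeFn_mk]
        constructor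
        · exact fun h => ⟨_, h.symm⟩
        · rintro ⟨x, rfl⟩
          simp [pad]
    · convert key (if a i = a (i + 1) then {del i a} else ∅) fun b => ?_
      · rw [count_cap]; split_ifs <;> simp
      · rw [stepRel_cap]; split_ifs with h <;> simp [h]
    · convert key {bump i (a i - a (i + 1)) a} fun b => ?_
      · rw [count_pos]; simp
      · rw [stepRel_pos]; simp
    · convert key {bump i (a (i + 1) - a i) a} fun b => ?_
      · rw [count_neg]; simp
      · rw [stepRel_neg]; simp

theorem width_succ {m k : ℕ} {w : List Piece} {p : Piece} (h : w[k]? = some p) :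
    width m w (k + 1) = p.above (width m w k) := by
  simp [width, List.take_add_one, h, List.foldl_append]

theorem width_zero (m : ℕ) (w : List Piece) : width m w 0 = m := rfl

theorem Fits.width_length {m n : ℕ} {w : List Piece} (h : Fits m w n) {k : ℕ} (hk : w.length ≤ k) :
    width m w k = n := by
  rw [width, List.take_of_length_le hk]
  induction w generalizing m k with
  | nil => exact h
  | cons p w ih => exact ih h.2 le_rfl

theorem Fits.le_width {m n : ℕ} {w : List Piece} (h : Fits m w n) {k : ℕ} {p : Piece}
    (hk : w[k]? = some p) : p.at_ + p.kind.ins ≤ width m w k := by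
  induction w generalizing m k with
  | nil => simp at hk
  | cons q w ih =>
    cases k with
    | zero =>
      obtain rfl : q = p := by simpa using hk
      exact h.1
    | succ k => exact ih h.2 (by simpa using hk)

/-- Extension of a function on the points by zero. -/
def Point.extend {T : Type*} [Zero T] {m : ℕ} {w : List Piece} (f : Point m w → T) (x : ℕ × ℕ) : T :=
  if h : x.1 ≤ w.length ∧ x.2 < width m w x.1 then f ⟨x, h⟩ else 0

theorem Point.extend_coe {T : Type*} [Zero T] {m : ℕ} {w : List Piece} (f : Point m w → T)
    (x : Point m w) : Point.extend f x.1 = f x := dif_pos x.2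

/-- The defect of the colouring rule at the crossing number `k`. -/
def crossingDefect {T : Type*} [AddCommGroup T] (w : List Piece) (v : ℕ × ℕ → T) (k : ℕ) : T :=
  match w[k]? with
  | some ⟨.pos, i⟩ => (2 : ℤ) • v (k, i) - v (k + 1, i) - v (k, i + 1)
  | some ⟨.neg, i⟩ => (2 : ℤ) • v (k, i + 1) - v (k, i) - v (k + 1, i + 1)
  | _ => 0

/-- The colourings of the points. -/
def IsColouring {T : Type*} [AddCommGroup T] (m : ℕ) (w : List Piece) (f : Point m w → T) : Prop :=
  (∀ x y, AdjacentOver m w x y → f x = f y) ∧ ∀ k, crossingDefect w (Point.extend f) k = 0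

/-- Entries to the right of all strands are only transported, so they keep their initial value zero.
This makes extension by zero inverse to restriction to the points. -/
theorem LevelColouring.eq_zero {T : Type*} [AddCommGroup T] {w : List Piece} (h : Fits 0 w 0)
    (F : LevelColouring w (0 : ℕ → T)) (k i : ℕ) (hi : width 0 w k ≤ i) : F.1 k i = 0 := by
  induction k generalizing i with
  | zero => rw [F.2.1]; rfl
  | succ k ih =>
    by_cases hk : k < w.length
    · have hp : w[k]? = some w[k] := List.getElem?_eq_getElem hk
      have h1 := h.le_width hp
      rw [width_succ hp, Piece.above] at hi
      have h2 := (F.2.2.1 k _ hp).2.1 (i - (w[k].at_ + w[k].kind.outs))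
      rw [show w[k].at_ + w[k].kind.outs + (i - (w[k].at_ + w[k].kind.outs)) = i by omega] at h2
      rw [← h2]
      exact ih _ (by omega)
    · rw [F.2.2.2 k (by omega)]
      rw [h.width_length (by omega)] at hi
      exact ih _ (by rw [h.width_length (by omega)]; exact hi)

theorem isColouring_of_levels {T : Type*} [AddCommGroup T] {w : List Piece} (h : Fits 0 w 0)
    (F : LevelColouring w (0 : ℕ → T)) : IsColouring 0 w fun x => F.1 x.1.1 x.1.2 := by
  have hext (k i : ℕ) (hk : k ≤ w.length) : Point.extend (fun x : Point 0 w => F.1 x.1.1 x.1.2) (k, i) =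
      F.1 k i := by
    unfold Point.extend
    split_ifs with hi
    · rfl
    · exact (F.eq_zero h k i (by simp only [hk, true_and] at hi; omega)).symm
  constructor
  · rintro ⟨x, hx⟩ ⟨y, hy⟩ (hxy | hxy | hxy) <;> simp only at hxy ⊢
    · cases hxy with
      | left h hi => exact (F.2.2.1 _ _ h).1 _ hi
      | right i h => exact (F.2.2.1 _ _ h).2.1 i
    · cases hxy with
      | cup h => exact (F.2.2.1 _ _ h).2.2
      | cap h => exact (F.2.2.1 _ _ h).2.2
    · cases hxy with
      | pos h => exact (F.2.2.1 _ _ h).2.2.1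
      | neg h => exact (F.2.2.1 _ _ h).2.2.1
  · intro k
    by_cases hk : k < w.length
    · unfold crossingDefect
      have hp : w[k]? = some w[k] := List.getElem?_eq_getElem hk
      have := F.2.2.1 _ _ hp
      rw [hp]
      generalize w[k] = p at this
      obtain ⟨_ | _ | _ | _, i⟩ := p
      · rfl
      · rfl
      · simp only [hext _ _ hk.le, hext _ _ (Nat.succ_le_of_lt hk)]
        exact this.2.2.2
      · simp only [hext _ _ hk.le, hext _ _ (Nat.succ_le_of_lt hk)]
        exact this.2.2.2
    · simp [crossingDefect, List.getElem?_eq_none (not_lt.mp hk)]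

/-- The colourings of the levels of a closed diagram are the colourings of its points. -/
def LevelColouring.pointEquiv {T : Type*} [AddCommGroup T] {w : List Piece} (h : Fits 0 w 0) :
    LevelColouring w (0 : ℕ → T) ≃ {f : Point 0 w → T // IsColouring 0 w f} where
  toFun F := ⟨fun x => F.1 x.1.1 x.1.2, isColouring_of_levels h F⟩
  invFun f := ⟨fun k i => Point.extend f.1 (k, i), by
    funext i
    simp [Point.extend, width_zero], by
    intro k p hp
    have hk : k < w.length := (List.getElem?_eq_some_iff.mp hp).1
    have h1 := h.le_width hp
    have h2 := width_succ (m := 0) hp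
    rw [Piece.above] at h2
    have hadj (i j k l : ℕ) (hi : i ≤ w.length) (hk : k ≤ w.length) (hj : j < width 0 w i)
        (hl : l < width 0 w k) (hr : Beside w (i, j) (k, l) ∨ Turn w (i, j) (k, l) ∨
          Over w (i, j) (k, l)) : Point.extend f.1 (i, j) = Point.extend f.1 (k, l) := by
      rw [Point.extend, Point.extend, dif_pos ⟨hi, hj⟩, dif_pos ⟨hk, hl⟩]
      exact f.2.1 _ _ hr
    have hz (i j : ℕ) (hj : width 0 w i ≤ j) : Point.extend f.1 (i, j) = 0 :=
      dif_neg fun h => hj.not_gt h.2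
    refine ⟨fun j hj => ?_, fun j => ?_, ?_⟩
    · exact hadj _ _ _ _ hk.le hk (by omega) (by omega) (.inl (.left hp hj))
    · by_cases hj : p.at_ + p.kind.ins + j < width 0 w k
      · exact hadj _ _ _ _ hk.le hk (by omega) (by omega) (.inl (.right j hp))
      · exact (hz _ _ (by omega)).trans (hz _ _ (by omega)).symm
    · have := f.2.2 k
      rw [crossingDefect, hp] at this
      obtain ⟨_ | _ | _ | _, i⟩ := p <;> simp only [Kind.ins, Kind.outs] at h1 h2 this ⊢
      · exact hadj _ _ _ _ hk hk (by omega) (by omega) (.inr (.inl (.cup hp)))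
      · exact hadj _ _ _ _ hk.le hk.le (by omega) (by omega) (.inr (.inl (.cap hp)))
      · exact ⟨hadj _ _ _ _ hk.le hk (by omega) (by omega) (.inr (.inr (.pos hp))), this⟩
      · exact ⟨hadj _ _ _ _ hk.le hk (by omega) (by omega) (.inr (.inr (.neg hp))), this⟩, by
    intro k hk
    funext i
    have h1 := h.width_length (k := k + 1) (by omega)
    have h2 := h.width_length (k := k) (by omega)
    simp [Point.extend, h1, h2]⟩
  left_inv F := by
    apply Subtype.ext
    funext k i
    simp only [Point.extend]
    split_ifs with hi
    · rfl
    · by_cases hk : k ≤ w.length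
      · exact (F.eq_zero h k i (by simp only [hk, true_and] at hi; omega)).symm
      · exact (F.eq_zero h k i (by rw [h.width_length (by omega)]; omega)).symm
  right_inv f := by
    apply Subtype.ext
    funext x
    exact Point.extend_coe f.1 x

theorem count_eq_card_colouring {w : List Piece} (h : Fits 0 w 0) :
    count w (0 : ℕ → T) = Nat.card {f : Point 0 w → T // IsColouring 0 w f} := by
  rw [← (levelColouring_card w 0).2, Nat.card_congr (LevelColouring.pointEquiv h)]

instance (m : ℕ) (w : List Piece) : Finite (Component m w) := inferInstanceAs (Finite (Quot _))

/-- Without crossings the rules only say that colours are constant on components. -/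
theorem count_crossingless {w : List Piece} (hw : Crossingless w) (h : Fits 0 w 0) :
    count w (0 : ℕ → T) = Fintype.card T ^ Nat.card (Component 0 w) := by
  have e : {f : Point 0 w → T // IsColouring 0 w f} ≃ (Component 0 w → T) :=
    (Equiv.subtypeEquivRight fun f => by
      have hk (k : ℕ) (i : ℕ) : w[k]? ≠ some ⟨.pos, i⟩ ∧ w[k]? ≠ some ⟨.neg, i⟩ := by
        constructor <;> intro hk <;> simpa using hw _ (List.mem_of_getElem? hk)
      show _ ↔ ∀ x y, Adjacent 0 w x y → f x = f y
      constructor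
      · rintro ⟨h1, -⟩ x y (hxy | hxy | hxy | hxy)
        · exact h1 x y (.inl hxy)
        · exact h1 x y (.inr (.inl hxy))
        · exact h1 x y (.inr (.inr hxy))
        · exfalso
          generalize x.1 = x at hxy
          generalize y.1 = y at hxy
          cases hxy with
          | pos h => exact (hk _ _).1 h
          | neg h => exact (hk _ _).2 h
      · intro h1
        refine ⟨fun x y hxy => h1 x y ?_, fun k => ?_⟩
        · obtain hxy | hxy | hxy := hxy
          exacts [.inl hxy, .inr (.inl hxy), .inr (.inr (.inl hxy))]
        · unfold crossingDefect
          split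
          · exact absurd ‹_› (hk _ _).1
          · exact absurd ‹_› (hk _ _).2
          · rfl).trans
    { toFun := fun f => Quot.lift f.1 f.2
      invFun := fun g => ⟨fun x => g (Quot.mk _ x), fun x y hxy => congrArg g (Quot.sound hxy)⟩
      left_inv := fun f => rfl
      right_inv := fun g => by funext x; obtain ⟨x, rfl⟩ := Quot.exists_rep x; rfl }
  rw [count_eq_card_colouring h, Nat.card_congr e, Nat.card_fun, Nat.card_eq_fintype_card]

end

section

/-! ### State sums -/

open LaurentPolynomial in
/-- The sum over all states of a diagram, with `f` the weight of a crossingless diagram. -/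
noncomputable def stateSum : List Piece → (List Piece → ℤ[T;T⁻¹]) → ℤ[T;T⁻¹]
  | [], f => f []
  | ⟨.cup, i⟩ :: w, f => stateSum w fun s => f (⟨.cup, i⟩ :: s)
  | ⟨.cap, i⟩ :: w, f => stateSum w fun s => f (⟨.cap, i⟩ :: s)
  | ⟨.pos, i⟩ :: w, f =>
      T 1 * stateSum w f + T (-1) * stateSum w fun s => f (⟨.cap, i⟩ :: ⟨.cup, i⟩ :: s)
  | ⟨.neg, i⟩ :: w, f =>
      T 1 * (stateSum w fun s => f (⟨.cap, i⟩ :: ⟨.cup, i⟩ :: s)) + T (-1) * stateSum w f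

/-- The value of a closed curve. -/
noncomputable def loopValue : ℤ[T;T⁻¹] := -LaurentPolynomial.T 2 - LaurentPolynomial.T (-2)

theorem stateSum_append (v w : List Piece) (f : List Piece → ℤ[T;T⁻¹]) :
    stateSum (v ++ w) f = stateSum v fun s => stateSum w fun s' => f (s ++ s') := by
  induction v generalizing f with
  | nil => rfl
  | cons p v ih => obtain ⟨_ | _ | _ | _, i⟩ := p <;> simp [stateSum, ih]

theorem stateSum_mul_left (c : ℤ[T;T⁻¹]) (w : List Piece) (f : List Piece → ℤ[T;T⁻¹]) :
    (stateSum w fun s => c * f s) = c * stateSum w f := by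
  induction w generalizing f with
  | nil => rfl
  | cons p w ih =>
    obtain ⟨_ | _ | _ | _, i⟩ := p <;> simp only [stateSum, ih] <;> ring

theorem stateSum_add (w : List Piece) (f g : List Piece → ℤ[T;T⁻¹]) :
    (stateSum w fun s => f s + g s) = stateSum w f + stateSum w g := by
  induction w generalizing f g with
  | nil => rfl
  | cons p w ih =>
    obtain ⟨_ | _ | _ | _, i⟩ := p <;> simp only [stateSum, ih] <;> ring

theorem stateSum_shift (k : ℕ) (w : List Piece) (f : List Piece → ℤ[T;T⁻¹]) :
    stateSum (w.map (Piece.shift k)) f = stateSum w fun s => f (s.map (Piece.shift k)) := by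
  induction w generalizing f with
  | nil => rfl
  | cons p w ih =>
    obtain ⟨_ | _ | _ | _, i⟩ := p <;> simp only [List.map_cons, Piece.shift, stateSum, ih]

theorem Crossingless.of_cons {p : Piece} {w : List Piece} (h : Crossingless (p :: w)) :
    Crossingless w := fun q hq => h q (List.mem_cons_of_mem _ hq)

theorem stateSum_crossingless {w : List Piece} (hw : Crossingless w) (f : List Piece → ℤ[T;T⁻¹]) :
    stateSum w f = f w := by
  induction w generalizing f with
  | nil => rfl
  | cons p w ih =>
    have := hw p List.mem_cons_self
    obtain ⟨_ | _ | _ | _, i⟩ := p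
    · exact ih hw.of_cons _
    · exact ih hw.of_cons _
    · simp at this
    · simp at this

theorem fits_crossing {κ : Kind} (hκ : κ = .pos ∨ κ = .neg) {m n i : ℕ} {w : List Piece} :
    Fits m (⟨κ, i⟩ :: w) n ↔ i + 2 ≤ m ∧ Fits m w n := by
  have : Fits m (⟨κ, i⟩ :: w) n ↔ i + 2 ≤ m ∧ Fits (m - 2 + 2) w n := by
    obtain rfl | rfl := hκ <;> rfl
  rw [this]
  refine and_congr_right fun h => ?_
  rw [Nat.sub_add_cancel (by omega)]

theorem fits_cap_cup {m n i : ℕ} {w : List Piece} (hi : i + 2 ≤ m) :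
    Fits m (⟨.cap, i⟩ :: ⟨.cup, i⟩ :: w) n ↔ Fits m w n := by
  obtain ⟨m, rfl⟩ := Nat.exists_eq_add_of_le' (show 2 ≤ m by omega)
  rw [fits_cap, fits_cup]
  have : i ≤ m := by omega
  simp [this]

theorem Crossingless.cons_cup {w : List Piece} (h : Crossingless w) (i : ℕ) :
    Crossingless (⟨.cup, i⟩ :: w) := List.forall_mem_cons.mpr ⟨.inl rfl, h⟩

theorem Crossingless.cons_cap {w : List Piece} (h : Crossingless w) (i : ℕ) :
    Crossingless (⟨.cap, i⟩ :: w) := List.forall_mem_cons.mpr ⟨.inr rfl, h⟩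

theorem Crossingless.append {v w : List Piece} (hv : Crossingless v) (hw : Crossingless w) :
    Crossingless (v ++ w) := List.forall_mem_append.mpr ⟨hv, hw⟩

theorem stateSum_congr {w : List Piece} {m n : ℕ} (h : Fits m w n) {f g : List Piece → ℤ[T;T⁻¹]}
    (hfg : ∀ s, Crossingless s → Fits m s n → f s = g s) : stateSum w f = stateSum w g := by
  induction w generalizing m f g with
  | nil => exact hfg [] (by simp [Crossingless]) h
  | cons p w ih =>
    obtain ⟨_ | _ | _ | _, i⟩ := p
    · obtain ⟨hi, h⟩ := fits_cup.mp h
      exact ih h fun s hs hs' => hfg _ (hs.cons_cup i) (fits_cup.mpr ⟨hi, hs'⟩)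
    · obtain ⟨m, rfl, hi, h⟩ := h.cap_elim
      exact ih h fun s hs hs' => hfg _ (hs.cons_cap i) (fits_cap.mpr ⟨hi, hs'⟩)
    · obtain ⟨hi, h⟩ := (fits_crossing (.inl rfl)).mp h
      simp only [stateSum]
      rw [ih h hfg, ih h fun s hs hs' => hfg _ ((hs.cons_cup i).cons_cap i) ((fits_cap_cup hi).mpr hs')]
    · obtain ⟨hi, h⟩ := (fits_crossing (.inr rfl)).mp h
      simp only [stateSum]
      rw [ih h hfg, ih h fun s hs hs' => hfg _ ((hs.cons_cup i).cons_cap i) ((fits_cap_cup hi).mpr hs')]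

/-- To prove something for all diagrams, resolve the crossings. -/
theorem skein_induction {m n : ℕ} (Q : List Piece → Prop)
    (h0 : ∀ s, Crossingless s → Fits m s n → Q s)
    (h1 : ∀ u v κ i, κ = .pos ∨ κ = .neg → Fits m (u ++ ⟨κ, i⟩ :: v) n → Q (u ++ v) →
      Q (u ++ ⟨.cap, i⟩ :: ⟨.cup, i⟩ :: v) → Q (u ++ ⟨κ, i⟩ :: v))
    (w : List Piece) (hw : Fits m w n) : Q w := by
  -- The prefix `u` is already resolved. Both smoothings go into `u`, so the unresolved rest shrinks
  -- although the diagram may grow.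
  suffices ∀ w u, Crossingless u → Fits m (u ++ w) n → Q (u ++ w) from
    this w [] (by simp [Crossingless]) hw
  clear hw w
  intro w
  induction w with
  | nil => exact fun u hu h => h0 _ (by simpa using hu) h
  | cons p w ih =>
    intro u hu h
    have hc (i : ℕ) (κ : Kind) (hκ : κ = .pos ∨ κ = .neg) (h : Fits m (u ++ ⟨κ, i⟩ :: w) n) :
        Q (u ++ ⟨κ, i⟩ :: w) := by
      obtain ⟨r, hu', hw⟩ := h.append_elim
      obtain ⟨hi, hw⟩ := (fits_crossing hκ).mp hw
      refine h1 u w κ i hκ h (ih u hu (hu'.append hw)) ?_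
      have := ih (u ++ [⟨.cap, i⟩, ⟨.cup, i⟩]) (hu.append (by simp [Crossingless]))
        (by simpa using hu'.append ((fits_cap_cup hi).mpr hw))
      simpa using this
    obtain ⟨_ | _ | _ | _, i⟩ := p
    · have := ih (u ++ [⟨.cup, i⟩]) (hu.append (by simp [Crossingless])) (by simpa using h)
      simpa using this
    · have := ih (u ++ [⟨.cap, i⟩]) (hu.append (by simp [Crossingless])) (by simpa using h)
      simpa using this
    · exact hc i _ (.inl rfl) h
    · exact hc i _ (.inr rfl) h

/-- The relations of the Temperley–Lieb category. -/
structure IsTemperleyLieb (f : List Piece → ℤ[T;T⁻¹]) : Prop where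
  zigzag : ∀ x y i, f (x ++ ⟨.cup, i⟩ :: ⟨.cap, i + 1⟩ :: y) = f (x ++ y)
  zigzag' : ∀ x y i, f (x ++ ⟨.cup, i + 1⟩ :: ⟨.cap, i⟩ :: y) = f (x ++ y)
  loop : ∀ x y i, f (x ++ ⟨.cup, i⟩ :: ⟨.cap, i⟩ :: y) = loopValue * f (x ++ y)
  far : ∀ x y p q i d, f (x ++ ⟨p, i⟩ :: ⟨q, i + p.outs + d⟩ :: y) =
    f (x ++ ⟨q, i + p.ins + d⟩ :: ⟨p, i⟩ :: y)

/-- With the state below fixed and the states above summed over, the weight still satisfies the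
relations as a function of the middle part. Invariance therefore needs checking only on the two
sides of a move. -/
theorem IsTemperleyLieb.context {f : List Piece → ℤ[T;T⁻¹]} (hf : IsTemperleyLieb f)
    (u v : List Piece) : IsTemperleyLieb fun s => stateSum v fun s' => f (u ++ (s ++ s')) where
  zigzag x y i := by
    congr 1; ext1 s'; simpa using hf.zigzag (u ++ x) (y ++ s') i
  zigzag' x y i := by
    congr 1; ext1 s'; simpa using hf.zigzag' (u ++ x) (y ++ s') i
  loop x y i := by
    rw [← stateSum_mul_left]
    congr 1; ext1 s'; simpa using hf.loop (u ++ x) (y ++ s') i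
  far x y p q i d := by
    congr 1; ext1 s'; simpa using hf.far (u ++ x) (y ++ s') p q i d

section
open LaurentPolynomial

theorem T_one_mul_T_neg_one : (T 1 : ℤ[T;T⁻¹]) * T (-1) = 1 := by
  rw [← T_add]; exact T_zero

theorem loopValue_eq : loopValue = -(T 1 * T 1) - T (-1) * T (-1) := by
  rw [← T_add, ← T_add]; rfl

theorem loopValue_ne_zero : loopValue ≠ 0 := by
  intro h
  have : loopValue.coeff 2 = 0 := by rw [h]; rfl
  simp [loopValue] at this

theorem IsTemperleyLieb.far_left {f : List Piece → ℤ[T;T⁻¹]} (hf : IsTemperleyLieb f)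
    (x y : List Piece) (q : Kind) (i d : ℕ) :
    f (x ++ ⟨.cap, i⟩ :: ⟨.cup, i⟩ :: ⟨q, i + 2 + d⟩ :: y) =
      f (x ++ ⟨q, i + 2 + d⟩ :: ⟨.cap, i⟩ :: ⟨.cup, i⟩ :: y) := by
  have h1 := hf.far (x ++ [⟨.cap, i⟩]) y .cup q i d
  have h2 := hf.far x (⟨.cup, i⟩ :: y) .cap q i d
  simp only [Kind.ins, Kind.outs, List.append_assoc, List.cons_append, List.nil_append] at h1 h2
  rw [h1, h2]

theorem IsTemperleyLieb.far_right {f : List Piece → ℤ[T;T⁻¹]} (hf : IsTemperleyLieb f)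
    (x y : List Piece) (p : Kind) (i d : ℕ) :
    f (x ++ ⟨p, i⟩ :: ⟨.cap, i + p.outs + d⟩ :: ⟨.cup, i + p.outs + d⟩ :: y) =
      f (x ++ ⟨.cap, i + p.ins + d⟩ :: ⟨.cup, i + p.ins + d⟩ :: ⟨p, i⟩ :: y) := by
  have h1 := hf.far x (⟨.cup, i + p.outs + d⟩ :: y) p .cap i d
  have h2 := hf.far (x ++ [⟨.cap, i + p.ins + d⟩]) y p .cup i d
  simp only [List.append_assoc, List.cons_append, List.nil_append] at h1 h2
  rw [h1, h2]

/-- Kauffman's computation: the loop value is chosen for the second Reidemeister move, the third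
then follows, and the first costs a unit. -/
theorem LocalMove.stateSum_eq {L R : List Piece} (h : LocalMove L R) :
    ∃ e : ℤ[T;T⁻¹]ˣ, ∀ f, IsTemperleyLieb f → stateSum L f = e * stateSum R f := by
  have hT := T_one_mul_T_neg_one
  have hd := loopValue_eq
  set A : ℤ[T;T⁻¹] := T 1 with hA
  set B : ℤ[T;T⁻¹] := T (-1) with hB
  -- The framing factor `-A³`, with inverse `-A⁻³`.
  let p : ℤ[T;T⁻¹]ˣ := ⟨-(A * A * A), -(B * B * B), by linear_combination (A * B * (A * B + 1) + 1) * hT, by linear_combination (A * B * (A * B + 1) + 1) * hT⟩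
  cases h with
  | far p q i d =>
    refine ⟨1, fun f hf => ?_⟩
    have h1 := hf.far [] [] p q i d
    have h2 := hf.far_left [] [] q i d
    have h3 := hf.far_right [] [] p i d
    have h4 := hf.far_left [] [⟨.cup, i + 2 + d⟩] .cap i d
    have h5 := hf.far_left [⟨.cap, i + 2 + d⟩] [] .cup i d
    cases p <;> cases q <;>
      simp only [stateSum, List.cons_append, List.nil_append, Units.val_one, Kind.ins, Kind.outs,
        one_mul] at h1 h2 h3 h4 h5 ⊢ <;>
      simp only [h1, h2, h3, h4, h5] <;> ring
  | zigzag i => exact ⟨1, fun f hf => by simpa [stateSum] using hf.zigzag [] [] i⟩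
  | zigzag' i => exact ⟨1, fun f hf => by simpa [stateSum] using hf.zigzag' [] [] i⟩
  | slide_cap_pos i =>
    refine ⟨1, fun f hf => ?_⟩
    have h1 := hf.zigzag [⟨.cap, i⟩] [] i
    have h2 := hf.zigzag' [⟨.cap, i + 1⟩] [] i
    simp only [stateSum, List.nil_append, Units.val_one, List.cons_append] at h1 h2 ⊢
    rw [h1, h2]; ring
  | slide_cap_neg i =>
    refine ⟨1, fun f hf => ?_⟩
    have h1 := hf.zigzag [⟨.cap, i⟩] [] i
    have h2 := hf.zigzag' [⟨.cap, i + 1⟩] [] i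
    simp only [stateSum, List.nil_append, Units.val_one, List.cons_append] at h1 h2 ⊢
    rw [h1, h2]; ring
  | slide_cup_pos i =>
    refine ⟨1, fun f hf => ?_⟩
    have h1 := hf.zigzag [] [⟨.cup, i + 1⟩] i
    have h2 := hf.zigzag' [] [⟨.cup, i⟩] i
    simp only [stateSum, List.nil_append, Units.val_one, List.cons_append] at h1 h2 ⊢
    rw [h1, h2]; ring
  | slide_cup_neg i =>
    refine ⟨1, fun f hf => ?_⟩
    have h1 := hf.zigzag [] [⟨.cup, i + 1⟩] i
    have h2 := hf.zigzag' [] [⟨.cup, i⟩] i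
    simp only [stateSum, List.nil_append, Units.val_one, List.cons_append] at h1 h2 ⊢
    rw [h1, h2]; ring
  | R1_cap_pos i =>
    refine ⟨p⁻¹, fun f hf => ?_⟩
    have h1 := hf.loop [⟨.cap, i⟩] [] i
    simp only [stateSum, List.cons_append, List.nil_append, hd] at h1 ⊢
    rw [h1]; change _ = -(B * B * B) * _; linear_combination -A * f [⟨.cap, i⟩] * hT
  | R1_cap_neg i =>
    refine ⟨p, fun f hf => ?_⟩
    have h1 := hf.loop [⟨.cap, i⟩] [] i
    simp only [stateSum, List.cons_append, List.nil_append, hd] at h1 ⊢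
    rw [h1]; change _ = -(A * A * A) * _; linear_combination -B * f [⟨.cap, i⟩] * hT
  | R1_cup_pos i =>
    refine ⟨p⁻¹, fun f hf => ?_⟩
    have h1 := hf.loop [] [⟨.cup, i⟩] i
    simp only [stateSum, List.cons_append, List.nil_append, hd] at h1 ⊢
    rw [h1]; change _ = -(B * B * B) * _; linear_combination -A * f [⟨.cup, i⟩] * hT
  | R1_cup_neg i =>
    refine ⟨p, fun f hf => ?_⟩
    have h1 := hf.loop [] [⟨.cup, i⟩] i
    simp only [stateSum, List.cons_append, List.nil_append, hd] at h1 ⊢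
    rw [h1]; change _ = -(A * A * A) * _; linear_combination -B * f [⟨.cup, i⟩] * hT
  | R2_pos_neg i =>
    refine ⟨1, fun f hf => ?_⟩
    have h1 := hf.loop [⟨.cap, i⟩] [⟨.cup, i⟩] i
    simp only [stateSum, List.cons_append, List.nil_append, hd, Units.val_one] at h1 ⊢
    rw [h1]; linear_combination (f [] - (A * A + B * B) * f [⟨.cap, i⟩, ⟨.cup, i⟩]) * hT
  | R2_neg_pos i =>
    refine ⟨1, fun f hf => ?_⟩
    have h1 := hf.loop [⟨.cap, i⟩] [⟨.cup, i⟩] i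
    simp only [stateSum, List.cons_append, List.nil_append, hd, Units.val_one] at h1 ⊢
    rw [h1]; linear_combination (f [] - (A * A + B * B) * f [⟨.cap, i⟩, ⟨.cup, i⟩]) * hT
  | R3_pos i =>
    refine ⟨1, fun f hf => ?_⟩
    have h1 := hf.loop [⟨.cap, i⟩] [⟨.cup, i⟩] i
    have h2 := hf.loop [⟨.cap, i + 1⟩] [⟨.cup, i + 1⟩] (i + 1)
    have h3 := hf.zigzag [⟨.cap, i⟩] [⟨.cup, i + 1⟩, ⟨.cap, i⟩, ⟨.cup, i⟩] i
    have h3' := hf.zigzag' [⟨.cap, i⟩] [⟨.cup, i⟩] i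
    have h4 := hf.zigzag' [⟨.cap, i + 1⟩] [⟨.cup, i⟩, ⟨.cap, i + 1⟩, ⟨.cup, i + 1⟩] i
    have h4' := hf.zigzag [⟨.cap, i + 1⟩] [⟨.cup, i + 1⟩] i
    simp only [stateSum, List.cons_append, List.nil_append, hd, Units.val_one] at h1 h2 h3 h3' h4 h4' ⊢
    rw [h1, h2, h3, h3', h4, h4']
    linear_combination (f [⟨.cap, i⟩, ⟨.cup, i⟩] - f [⟨.cap, i + 1⟩, ⟨.cup, i + 1⟩]) *
      (-(A * A * B + B * B * B)) * hT
  | R3_neg i =>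
    refine ⟨1, fun f hf => ?_⟩
    have h1 := hf.loop [⟨.cap, i⟩] [⟨.cup, i⟩] i
    have h2 := hf.loop [⟨.cap, i + 1⟩] [⟨.cup, i + 1⟩] (i + 1)
    have h3 := hf.zigzag [⟨.cap, i⟩] [⟨.cup, i + 1⟩, ⟨.cap, i⟩, ⟨.cup, i⟩] i
    have h3' := hf.zigzag' [⟨.cap, i⟩] [⟨.cup, i⟩] i
    have h4 := hf.zigzag' [⟨.cap, i + 1⟩] [⟨.cup, i⟩, ⟨.cap, i + 1⟩, ⟨.cup, i + 1⟩] i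
    have h4' := hf.zigzag [⟨.cap, i + 1⟩] [⟨.cup, i + 1⟩] i
    simp only [stateSum, List.cons_append, List.nil_append, hd, Units.val_one] at h1 h2 h3 h3' h4 h4' ⊢
    rw [h1, h2, h3, h3', h4, h4']
    linear_combination (f [⟨.cap, i⟩, ⟨.cup, i⟩] - f [⟨.cap, i + 1⟩, ⟨.cup, i + 1⟩]) *
      (-(B * B * A + A * A * A)) * hT

end

end

section

/-! ### The Kauffman bracket of an extension of a tangle -/

section
variable {T : Type*} [AddCommGroup T] [Fintype T] [DecidableEq T]

/-- The zero colouring always exists. Positivity is needed to take logarithms of counts. -/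
theorem count_zero_pos (w : List Piece) : 0 < count w (0 : ℕ → T) := by
  induction w with
  | nil => exact Nat.one_pos
  | cons p w ih =>
    have h1 (i : ℕ) : pad i (0 : T) 0 0 = 0 := by ext j; simp [pad]
    have h2 (i : ℕ) : del i (0 : ℕ → T) = 0 := by ext j; simp [del]
    have h3 (i : ℕ) : bump i (0 : T) 0 = 0 := by ext j; simp [bump]
    obtain ⟨_ | _ | _ | _, i⟩ := p
    · rw [count_cup]
      exact Finset.sum_pos' (fun _ _ => Nat.zero_le _) ⟨0, Finset.mem_univ _, by rwa [h1]⟩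
    · rw [count_cap]; simpa [h2] using ih
    · rw [count_pos]; simpa [h3] using ih
    · rw [count_neg]; simpa [h3] using ih

theorem count_append_congr {v w : List Piece} (u : List Piece)
    (h : ∀ a : ℕ → T, count v a = count w a) (a : ℕ → T) : count (u ++ v) a = count (u ++ w) a := by
  rw [count_append, count_append, funext h]

end

/-- The weight of a state. -/
noncomputable def stateWeight (s : List Piece) : ℤ[T;T⁻¹] :=
  loopValue ^ Nat.log 2 (count s (0 : ℕ → ZMod 2))

theorem log_two_pow_mul (j : ℕ) {x : ℕ} (hx : 0 < x) : Nat.log 2 (2 ^ j * x) = j + Nat.log 2 x := by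
  induction j with
  | zero => simp
  | succ j ih =>
    rw [pow_succ, show 2 ^ j * 2 * x = 2 ^ j * x * 2 by ring,
      Nat.log_mul_base one_lt_two (by positivity), ih]
    ring

/-- A factor `2 ^ j` in the number of colourings modulo 2 stands for `j` additional closed curves.
-/
theorem stateWeight_of_count {s s' : List Piece} (j : ℕ)
    (h : count s (0 : ℕ → ZMod 2) = 2 ^ j * count s' (0 : ℕ → ZMod 2)) :
    stateWeight s = loopValue ^ j * stateWeight s' := by
  rw [stateWeight, h, log_two_pow_mul j (count_zero_pos s'), pow_add, stateWeight]

theorem isTemperleyLieb_stateWeight : IsTemperleyLieb stateWeight where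
  zigzag x y i := by rw [stateWeight, count_append_congr x (count_zigzag i y), stateWeight]
  zigzag' x y i := by rw [stateWeight, count_append_congr x (count_zigzag' i y), stateWeight]
  loop x y i := by
    have := stateWeight_of_count (s := x ++ ⟨.cup, i⟩ :: ⟨.cap, i⟩ :: y) (s' := x ++ y) 1 (by
      rw [count_append, funext (count_loop i y), cnt_mul_left, ← count_append, ZMod.card, pow_one])
    rwa [pow_one] at this
  far x y p q i d := by
    rw [stateWeight, count_append_congr x (count_far p q i d y), stateWeight]

theorem Diagram.Isotopic.stateSum_eq {m n : ℕ} {D E : Diagram m n} (h : D.Isotopic E) :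
    ∃ e : ℤ[T;T⁻¹]ˣ, stateSum D.pieces stateWeight = e * stateSum E.pieces stateWeight := by
  induction h with
  | rel D E h =>
    obtain ⟨u, v, L, R, h, h1, h2⟩ := h
    obtain ⟨e, he⟩ := h.stateSum_eq
    refine ⟨e, ?_⟩
    rw [h1, h2, List.append_assoc, List.append_assoc, stateSum_append, stateSum_append,
      ← stateSum_mul_left]
    congr 1
    ext1 s
    rw [stateSum_append, stateSum_append]
    exact he _ (isTemperleyLieb_stateWeight.context s v)
  | refl => exact ⟨1, by simp⟩
  | symm _ _ _ ih =>
    obtain ⟨e, he⟩ := ih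
    exact ⟨e⁻¹, by rw [he, Units.inv_mul_cancel_left]⟩
  | trans _ _ _ _ _ h1 h2 =>
    obtain ⟨e, he⟩ := h1
    obtain ⟨e', he'⟩ := h2
    exact ⟨e * e', by rw [he, he', Units.val_mul, mul_assoc]⟩

theorem bracketFrom_eq_stateSum (u w : List Piece) :
    bracketFrom u w = stateSum w fun s => loopValue ^ (Nat.card (Component 0 (u ++ s)) - 1) := by
  induction w generalizing u with
  | nil => simp [bracketFrom, stateSum, loopValue]
  | cons p w ih => obtain ⟨_ | _ | _ | _, i⟩ := p <;> simp [bracketFrom, stateSum, ih]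

theorem Fits.cons_zero {p : Piece} {w : List Piece} {n : ℕ} (h : Fits 0 (p :: w) n) :
    p = ⟨.cup, 0⟩ := by
  have := h.1
  obtain ⟨_ | _ | _ | _, i⟩ := p <;> simp [Kind.ins] at this ⊢
  exact this

/-- The state sum counts all closed curves, the bracket one fewer. The empty diagram is excluded,
since it has value 1 in both. -/
theorem stateSum_eq_bracket (D : LinkDiagram) (hD : D.pieces ≠ []) :
    stateSum D.pieces stateWeight = loopValue * bracket D := by
  rw [bracket, bracketFrom_eq_stateSum, ← stateSum_mul_left]
  obtain ⟨w, h⟩ := D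
  cases w with
  | nil => exact absurd rfl hD
  | cons p w =>
    obtain rfl := h.cons_zero
    simp only [stateSum]
    obtain ⟨-, h'⟩ := fits_cup.mp h
    refine stateSum_congr h' fun s hs hs' => ?_
    have hc := hs.cons_cup 0
    have hf : Fits 0 (⟨.cup, 0⟩ :: s) 0 := fits_cup.mpr ⟨le_rfl, hs'⟩
    have : 0 < Nat.card (Component 0 (⟨.cup, 0⟩ :: s)) := by
      have : Nonempty (Component 0 (⟨.cup, 0⟩ :: s)) :=
        ⟨Quot.mk _ ⟨(1, 0), by simp, by
          simp [width, Piece.above, Kind.ins, Kind.outs]⟩⟩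
      exact Nat.card_pos
    rw [stateWeight, count_crossingless hc hf, ZMod.card, Nat.log_pow one_lt_two, List.nil_append,
      mul_pow_sub_one this.ne']

/-- Each extension of a tangle has its state sum in the ideal of the closures of the tangle. -/
theorem stateSum_extension_mem (I : Ideal ℤ[T;T⁻¹]) {t below above : List Piece} {k l r : ℕ}
    (ht : Fits 0 t r) (hfb : Fits 0 below (k + l)) (hfa : Fits (k + r + l) above 0)
    (hI : ∀ c, Fits r (caps c) 0 → stateSum (t ++ caps c) stateWeight ∈ I) :
    stateSum (below ++ t.map (Piece.shift k) ++ above) stateWeight ∈ I := by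
  have skein (u v x : List Piece) (κ : Kind) (i : ℕ) (hκ : κ = .pos ∨ κ = .neg)
      (h1 : stateSum (u ++ (v ++ x)) stateWeight ∈ I)
      (h2 : stateSum (u ++ ⟨.cap, i⟩ :: ⟨.cup, i⟩ :: (v ++ x)) stateWeight ∈ I) :
      stateSum (u ++ ⟨κ, i⟩ :: (v ++ x)) stateWeight ∈ I := by
    have key (a b : ℤ[T;T⁻¹]) (hab : ∀ f, stateSum (⟨κ, i⟩ :: (v ++ x)) f =
        a * stateSum (v ++ x) f + b * stateSum (⟨.cap, i⟩ :: ⟨.cup, i⟩ :: (v ++ x)) f) :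
        stateSum (u ++ ⟨κ, i⟩ :: (v ++ x)) stateWeight = a * stateSum (u ++ (v ++ x)) stateWeight +
          b * stateSum (u ++ ⟨.cap, i⟩ :: ⟨.cup, i⟩ :: (v ++ x)) stateWeight := by
      simp only [stateSum_append u, hab]
      rw [stateSum_add, stateSum_mul_left, stateSum_mul_left]
    obtain rfl | rfl := hκ
    · rw [key _ _ fun f => rfl]
      exact I.add_mem (I.mul_mem_left _ h1) (I.mul_mem_left _ h2)
    · rw [key _ _ fun f => add_comm _ _]
      exact I.add_mem (I.mul_mem_left _ h1) (I.mul_mem_left _ h2)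
  -- First the crossings below or beside the tangle are resolved, then those above; the crossings of
  -- the tangle itself stay.
  refine skein_induction (m := 0) (n := k + l)
    (fun below => stateSum (below ++ t.map (Piece.shift k) ++ above) stateWeight ∈ I)
    (fun below hb hfb => ?_) (fun u v κ i hκ h h1 h2 => ?_) below hfb
  · refine skein_induction (m := k + r + l) (n := 0)
      (fun above => stateSum (below ++ t.map (Piece.shift k) ++ above) stateWeight ∈ I)
      (fun above ha hfa => ?_) (fun u v κ i hκ h h1 h2 => ?_) above hfa
    · obtain ⟨c, j, hc, H⟩ := exists_caps_outside hb ha hfb hfa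
      have : stateSum (below ++ t.map (Piece.shift k) ++ above) stateWeight =
          loopValue ^ j * stateSum (t ++ caps c) stateWeight := by
        rw [← stateSum_mul_left, List.append_assoc, stateSum_append, stateSum_crossingless hb,
          stateSum_append, stateSum_append, stateSum_shift]
        -- The maxima `c` and the number `j` depend only on the outside, so the comparison applies
        -- to each state `s` of the tangle with the same factor.
        refine stateSum_congr ht fun s hs hs' => ?_
        rw [stateSum_crossingless ha, stateSum_crossingless (crossingless_caps c),
          ← List.append_assoc]
        refine stateWeight_of_count j ?_
        rw [H (ZMod 2) s hs', ZMod.card]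
      rw [this]
      exact I.mul_mem_left _ (hI c hc)
    · have := skein (below ++ t.map (Piece.shift k) ++ u) v [] κ i hκ
        (by simpa using h1) (by simpa using h2)
      simpa using this
  · have := skein u v (t.map (Piece.shift k) ++ above) κ i hκ
      (by simpa using h1) (by simpa using h2)
    simpa using this

end

/-! ### Translation invariance of colourings and nonempty diagrams -/

section

section
variable {T : Type*} [AddCommGroup T] [Fintype T] [DecidableEq T]

/-- The colour rules are invariant under translations. -/
theorem cnt_add_const (w : List StrandOp) (a : ℕ → T) (x : T) :
    cnt w (fun j => a j + x) (fun _ => 1) = cnt w a fun _ => 1 := by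
  induction w generalizing a with
  | nil => rfl
  | cons p w ih =>
    cases p with
    | cup i =>
      refine (Fintype.sum_equiv (Equiv.addRight x) _ _ fun y => ?_).symm
      rw [← ih]
      congr 1; ext j; simp only [pad, Equiv.coe_addRight]; grind
    | cap i =>
      simp only [cnt, add_left_inj]
      rw [← ih (del i a)]
      congr 2; ext j; simp only [del]; grind
    | mix α β i =>
      simp only [cnt, add_sub_add_right_eq_sub]
      refine Finset.sum_congr rfl fun z _ => ?_
      rw [← ih (bump i z a)]
      congr 2; ext j; simp only [bump]; grind

/-- Both strands of the first minimum carry the same colour, which a translation moves to zero; this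
leaves one free factor. -/
theorem cnt_cup_zero {w : List StrandOp} {n : ℕ} (h : OpFits 2 w n) :
    cnt (.cup 0 :: w) (0 : ℕ → T) (fun _ => 1) = Fintype.card T * cnt w (0 : ℕ → T) fun _ => 1 := by
  have key (x : T) : cnt w (pad 0 x x 0) (fun _ => 1) = cnt w (0 : ℕ → T) fun _ => 1 := by
    rw [← cnt_add_const w 0 x]
    refine cnt_congr h (fun j hj => ?_) fun _ _ _ => rfl
    simp only [pad, Pi.zero_apply]; grind
  simp [cnt, key]

theorem count_cup_zero {w : List Piece} {n : ℕ} (h : Fits 2 w n) :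
    count (⟨.cup, 0⟩ :: w) (0 : ℕ → T) = Fintype.card T * count w (0 : ℕ → T) :=
  cnt_cup_zero h.opFits

end

theorem TangleDiagram.pieces_ne_nil {n : ℕ} (hn : 0 < n) (t : TangleDiagram n) : t.pieces ≠ [] := by
  obtain ⟨w, ht⟩ := t
  rintro rfl
  have : 0 = 2 * n := ht
  omega

/-- Isotopies do not create something out of nothing. -/
theorem Diagram.Isotopic.pieces_ne_nil {D E : LinkDiagram} (h : D.Isotopic E)
    (hD : D.pieces ≠ []) : E.pieces ≠ [] := by
  intro hE
  have h1 := h.count_eq (0 : ℕ → ZMod 2)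
  obtain ⟨w, hw⟩ := D
  cases w with
  | nil => exact hD rfl
  | cons p w =>
    obtain rfl := hw.cons_zero
    -- The empty diagram has one colouring modulo 2, a nonempty one an even number.
    rw [hE, count_nil, count_cup_zero (fits_cup.mp hw).2, ZMod.card] at h1
    omega

theorem Embeds.pieces_ne_nil {n : ℕ} (hn : 0 < n) {t : TangleDiagram n} {l : LinkDiagram}
    (h : Embeds t l) : l.pieces ≠ [] := by
  obtain ⟨t', l', -, hl, below, above, k, hD⟩ := h
  refine Diagram.Isotopic.pieces_ne_nil (Relation.EqvGen.symm _ _ hl) ?_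
  rw [hD]
  simp [t'.pieces_ne_nil hn]

/-! ### The Jones polynomial of an extension of a tangle -/

/-- Below any point the strand descends to the bottom, as maxima create no strands upwards. So
systems of maxima have no closed components. -/
theorem caps_connected (c : List ℕ) {m : ℕ} (hc : Fits m (caps c) 0) (x : Point m (caps c)) :
    ∃ e : Point m (caps c), e.1.1 = 0 ∧ Relation.EqvGen (Adjacent m (caps c)) x e := by
  obtain ⟨⟨k, i⟩, hk, hi⟩ := x
  simp only at hk hi
  induction k generalizing i with
  | zero => exact ⟨_, rfl, .refl _⟩
  | succ k ih =>
    have hp : (caps c)[k]? = some (caps c)[k] := List.getElem?_eq_getElem hk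
    have hcap : (caps c)[k].kind = .cap := by simp [caps]
    have h1 := hc.le_width hp
    have h2 := width_succ (m := m) hp
    rw [Piece.above] at h2
    generalize (caps c)[k] = p at *
    obtain ⟨κ, j⟩ := p
    obtain rfl : κ = .cap := hcap
    simp only [Kind.ins, Kind.outs] at h1 h2
    by_cases h : i < j
    · obtain ⟨e, he, h'⟩ := ih i (by omega) (by omega)
      exact ⟨e, he, .trans _ _ _ (.symm _ _ (.rel _ _ (.inl (.left hp h)))) h'⟩
    · obtain ⟨e, he, h'⟩ := ih (i + 2) (by omega) (by omega)
      refine ⟨e, he, .trans _ _ _ (.symm _ _ (.rel _ _ (.inl ?_))) h'⟩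
      have := Beside.right (i - j) hp
      simp only [Kind.ins, Kind.outs] at this
      rwa [show j + 2 + (i - j) = i + 2 by omega, show j + 0 + (i - j) = i by omega] at this

/-- The Catalan tangle given by maxima. -/
def capsTangle {n : ℕ} (c : List ℕ) (hc : Fits (2 * n) (caps c) 0) : CatalanTangle n :=
  ⟨⟨caps c, hc⟩, crossingless_caps c, caps_connected c hc⟩

theorem Fits.unique {m n n' : ℕ} {w : List Piece} (h : Fits m w n) (h' : Fits m w n') : n = n' := by
  rw [← h.width_length le_rfl, h'.width_length le_rfl]

/-- The numbers of strands on the left and on the right of a tangle in a diagram. -/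
theorem Diagram.ExtendsTo.exists_fits {n : ℕ} (hn : 0 < n) {t : TangleDiagram n} {D : LinkDiagram}
    (h : t.ExtendsTo D) : ∃ (below above : List Piece) (k l : ℕ),
      D.pieces = below ++ t.pieces.map (Piece.shift k) ++ above ∧ Fits 0 below (k + l) ∧
      Fits (k + 2 * n + l) above 0 := by
  obtain ⟨below, above, k, h⟩ := h
  have hD := D.fits
  rw [h, List.append_assoc] at hD
  obtain ⟨M, h1, h2⟩ := hD.append_elim
  obtain ⟨M', h2, h3⟩ := h2.append_elim
  -- The offset `k` is bounded because a tangle with ends has a first piece, which must fit at its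
  -- shifted place.
  have hk : k ≤ M := by
    obtain ⟨w, ht⟩ := t
    cases w with
    | nil => have : 0 = 2 * n := ht; omega
    | cons p w => have := h2.1; simp only [Piece.shift] at this; omega
  obtain ⟨l, rfl⟩ := Nat.exists_eq_add_of_le hk
  obtain rfl : k + 2 * n + l = M' := (t.fits.shift k l).unique (by simpa using h2)
  exact ⟨below, above, k, l, h, h1, h3⟩

theorem Embeds.bracket_mem {n : ℕ} (hn : 0 < n) {t : TangleDiagram n} {l : LinkDiagram}
    (h : Embeds t l) (hl : l.pieces ≠ []) :
    bracket l ∈ Ideal.span (Set.range fun c : CatalanTangle n => bracket (t.close c)) := by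
  obtain ⟨t', l', ht, hl', hE⟩ := h
  obtain ⟨below, above, k, r, hD, hb, ha⟩ := hE.exists_fits hn
  set I := Ideal.span (Set.range fun c : CatalanTangle n => bracket (t.close c)) with hI
  -- The closures carry the factor `loopValue` too. It is kept in the ideal so that it can be
  -- cancelled against that of the link.
  have h1 : stateSum l'.pieces stateWeight ∈ Ideal.span {loopValue} * I := by
    rw [hD]
    refine stateSum_extension_mem _ t'.fits hb ha fun c hc => ?_
    obtain ⟨e, he⟩ := (ht.glue ⟨caps c, hc⟩).stateSum_eq
    have h2 : stateSum (t'.pieces ++ caps c) stateWeight =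
        (e⁻¹ : ℤ[T;T⁻¹]ˣ) * (loopValue * bracket (t.close (capsTangle c hc))) := by
      rw [← stateSum_eq_bracket _ (by
        simp [Diagram.close, Diagram.glue, t.pieces_ne_nil hn])]
      exact (Units.eq_inv_mul_iff_mul_eq e).mpr he.symm
    rw [h2]
    exact Ideal.mul_mem_left _ _ (Ideal.mul_mem_mul (Ideal.mem_span_singleton_self _)
      (Ideal.subset_span ⟨_, rfl⟩))
  obtain ⟨e, he⟩ := hl'.stateSum_eq
  rw [stateSum_eq_bracket l hl] at he
  obtain ⟨y, hy, h3⟩ := Ideal.mem_span_singleton_mul.mp h1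
  have : bracket l = e * y := by
    apply mul_left_cancel₀ loopValue_ne_zero
    rw [he, ← h3]; ring
  rw [this]
  exact I.mul_mem_left _ hy

/-! #### Parity of the exponents -/

open LaurentPolynomial

/-- The substitution `T ↦ T⁻²`. -/
noncomputable def substInvSq : ℤ[T;T⁻¹] →+* ℤ[T;T⁻¹] :=
  AddMonoidAlgebra.mapDomainRingHom ℤ (AddMonoidHom.mulLeft (-2 : ℤ))

theorem substInvSq_T (k : ℤ) : substInvSq (T k) = T (-2 * k) := by
  change AddMonoidAlgebra.mapDomain _ (AddMonoidAlgebra.single k 1) = AddMonoidAlgebra.single _ 1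
  rw [AddMonoidAlgebra.mapDomain_single]
  rfl

theorem substInvSq_C (a : ℤ) : substInvSq (C a) = C a := by
  change AddMonoidAlgebra.mapDomain _ (AddMonoidAlgebra.single 0 a) = AddMonoidAlgebra.single 0 a
  rw [AddMonoidAlgebra.mapDomain_single]
  simp

/-- The inverse substitution, which forgets odd exponents. -/
noncomputable def unsubst : ℤ[T;T⁻¹] →+ ℤ[T;T⁻¹] :=
  AddMonoidAlgebra.comapDomainAddMonoidHom (fun k : ℤ => -2 * k)
    (mul_right_injective₀ (by norm_num))

theorem unsubst_coeff (p : ℤ[T;T⁻¹]) (k : ℤ) : (unsubst p).coeff k = p.coeff (-2 * k) := by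
  simp [unsubst]

/-- A projection formula: forgetting odd exponents is linear over the subring of even exponents. -/
theorem unsubst_mul_subst (p q : ℤ[T;T⁻¹]) : unsubst (p * substInvSq q) = unsubst p * q := by
  induction q using LaurentPolynomial.induction_on' with
  | add q r hq hr => rw [map_add, mul_add, map_add, hq, hr, mul_add]
  | C_mul_T n a =>
    rw [RingHom.map_mul, substInvSq_T, substInvSq_C, ← single_eq_C_mul_T, ← single_eq_C_mul_T]
    ext k
    rw [unsubst_coeff,
      AddMonoidAlgebra.coeff_mul_single_eq_coeff_mul (-2 * (k - n)) fun m _ => by omega,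
      AddMonoidAlgebra.coeff_mul_single_eq_coeff_mul (k - n) fun m _ => by omega, unsubst_coeff]

theorem unsubst_subst (q : ℤ[T;T⁻¹]) : unsubst (substInvSq q) = q := by
  have : unsubst 1 = 1 := by
    ext k; rw [unsubst_coeff, ← T_zero, T_apply, T_apply]; congr 1; simp; omega
  simpa [this] using unsubst_mul_subst 1 q

/-- The number of crossings. -/
def crossingNumber (w : List Piece) : ℕ := w.countP fun p => match p.kind with
  | .cup => false
  | .cap => false
  | .pos => true
  | .neg => true

/-- Each crossing contributes `A` or `A⁻¹` and closed curves contribute even powers, so the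
exponents all have the parity of the number of crossings. -/
theorem bracketFrom_parity (u w : List Piece) :
    ∃ q, bracketFrom u w = T (crossingNumber w) * substInvSq q := by
  induction w generalizing u with
  | nil =>
    refine ⟨(-T (-1) - T 1) ^ (Nat.card (Component 0 u) - 1), ?_⟩
    simp [bracketFrom, crossingNumber, substInvSq_T]
  | cons p w ih =>
    obtain ⟨_ | _ | _ | _, i⟩ := p
    · obtain ⟨q, hq⟩ := ih (u ++ [⟨.cup, i⟩])
      exact ⟨q, by simpa [bracketFrom, crossingNumber] using hq⟩
    · obtain ⟨q, hq⟩ := ih (u ++ [⟨.cap, i⟩])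
      exact ⟨q, by simpa [bracketFrom, crossingNumber] using hq⟩
    · obtain ⟨q, hq⟩ := ih u
      obtain ⟨q', hq'⟩ := ih (u ++ [⟨.cap, i⟩, ⟨.cup, i⟩])
      -- Once `A` is factored out, the other term carries `A⁻²`, the image of `T 1` under the
      -- substitution.
      refine ⟨q + T 1 * q', ?_⟩
      have hc : crossingNumber (⟨.pos, i⟩ :: w) = crossingNumber w + 1 := by simp [crossingNumber]
      rw [bracketFrom, hq, hq', hc, map_add, map_mul, substInvSq_T, mul_add, ← mul_assoc,
        ← mul_assoc, ← mul_assoc, ← T_add, ← T_add, ← T_add]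
      push_cast
      congr 3 <;> ring_nf
    · obtain ⟨q, hq⟩ := ih u
      obtain ⟨q', hq'⟩ := ih (u ++ [⟨.cap, i⟩, ⟨.cup, i⟩])
      refine ⟨q' + T 1 * q, ?_⟩
      have hc : crossingNumber (⟨.neg, i⟩ :: w) = crossingNumber w + 1 := by simp [crossingNumber]
      rw [bracketFrom, hq, hq', hc, map_add, map_mul, substInvSq_T, mul_add, ← mul_assoc,
        ← mul_assoc, ← mul_assoc, ← T_add, ← T_add, ← T_add]
      push_cast
      congr 3 <;> ring_nf

theorem sum_crossing_indicator (w : List Piece) :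
    ∑ k ∈ Finset.range w.length, ((match w[k]? with
      | some ⟨.pos, _⟩ => 1
      | some ⟨.neg, _⟩ => 1
      | _ => 0 : ℤ)) = (crossingNumber w : ℤ) := by
  induction w with
  | nil => simp [crossingNumber]
  | cons p w ih =>
    rw [List.length_cons, Finset.sum_range_succ']
    simp only [List.getElem?_cons_succ, List.getElem?_cons_zero]
    rw [ih]
    obtain ⟨_ | _ | _ | _, i⟩ := p <;> simp [crossingNumber]

/-- Each crossing has sign `±1`, and hence is odd in both sums. -/
theorem DiagramOrientation.even_writhe {D : LinkDiagram} (o : DiagramOrientation D) :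
    Even (o.writhe + crossingNumber D.pieces) := by
  rw [← sum_crossing_indicator, DiagramOrientation.writhe, ← Finset.sum_add_distrib]
  refine Finset.even_sum _ fun k _ => ?_
  rw [DiagramOrientation.sign]
  rcases D.pieces[k]? with _ | ⟨_ | _ | _ | _, i⟩ <;> simp only
  · simp
  · simp
  · simp
  · split_ifs <;> decide
  · split_ifs <;> decide

theorem normalizedBracket_eq_subst (D : LinkDiagram) (o : DiagramOrientation D) :
    normalizedBracket D o = substInvSq (jones D o) := by
  suffices ∃ q, normalizedBracket D o = substInvSq q by
    obtain ⟨q, hq⟩ := this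
    have : jones D o = unsubst (normalizedBracket D o) := rfl
    rw [this, hq, unsubst_subst]
  obtain ⟨q, hq⟩ := bracketFrom_parity [] D.pieces
  obtain ⟨a, ha⟩ := o.even_writhe
  -- With `2a` the sum of the writhe `w` and the number of crossings, `-3w + (2a - w) = -2(2w - a)`.
  refine ⟨((-1 : ℤˣ) ^ o.writhe : ℤˣ).val • (T (2 * o.writhe - a) * q), ?_⟩
  rw [normalizedBracket, bracket, hq, map_zsmul, map_mul, substInvSq_T, ← mul_assoc, ← T_add]
  congr 3
  linarith

theorem exists_unit_normalizedBracket (D : LinkDiagram) (o : DiagramOrientation D) :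
    ∃ e : ℤ[T;T⁻¹]ˣ, normalizedBracket D o = e * bracket D := by
  obtain ⟨e, he⟩ := isUnit_T (R := ℤ) (-3 * o.writhe)
  refine ⟨Units.map (Int.castRingHom ℤ[T;T⁻¹]).toMonoidHom ((-1) ^ o.writhe) * e, ?_⟩
  rw [normalizedBracket, zsmul_eq_mul, ← he, Units.val_mul, mul_assoc]
  rfl

theorem Embeds.jones_mem {n : ℕ} (hn : 0 < n) {t : TangleDiagram n} {l : LinkDiagram}
    (h : Embeds t l) (hl : l.pieces ≠ []) (ol : DiagramOrientation l)
    (o : ∀ c : CatalanTangle n, DiagramOrientation (t.close c)) :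
    jones l ol ∈ Ideal.span (Set.range fun c : CatalanTangle n => jones (t.close c) (o c)) := by
  obtain ⟨e, he⟩ := exists_unit_normalizedBracket l ol
  have h1 : normalizedBracket l ol ∈
      Ideal.span (Set.range fun c : CatalanTangle n => normalizedBracket (t.close c) (o c)) := by
    rw [he]
    refine Ideal.mul_mem_left _ _ ?_
    refine Ideal.span_le.mpr ?_ (h.bracket_mem hn hl)
    rintro _ ⟨c, rfl⟩
    obtain ⟨e', he'⟩ := exists_unit_normalizedBracket (t.close c) (o c)
    have : bracket (t.close c) = (e'⁻¹ : ℤ[T;T⁻¹]ˣ) * normalizedBracket (t.close c) (o c) :=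
      (Units.eq_inv_mul_iff_mul_eq e').mpr he'.symm
    simp only [SetLike.mem_coe]
    rw [this]
    exact Ideal.mul_mem_left _ _ (Ideal.subset_span ⟨c, rfl⟩)
  -- The arbitrary multiplier `p` is carried along because `unsubst` is only additive, not linear
  -- over the whole ring.
  suffices ∀ x ∈ Ideal.span (Set.range fun c : CatalanTangle n =>
      normalizedBracket (t.close c) (o c)), ∀ p, unsubst (p * x) ∈
      Ideal.span (Set.range fun c : CatalanTangle n => jones (t.close c) (o c)) by
    have := this _ h1 1
    rwa [one_mul] at this
  intro x hx
  induction hx using Submodule.span_induction with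
  | mem x hx =>
    obtain ⟨c, rfl⟩ := hx
    intro p
    simp only
    rw [normalizedBracket_eq_subst, unsubst_mul_subst]
    exact Ideal.mul_mem_left _ _ (Ideal.subset_span ⟨c, rfl⟩)
  | zero => simp
  | add x y _ _ hx hy => intro p; rw [mul_add, map_add]; exact Ideal.add_mem _ (hx p) (hy p)
  | smul a x _ hx => intro p; rw [smul_eq_mul, ← mul_assoc]; exact hx _

end

section

/-! ### Determinants and numbers of solutions modulo `N` -/

section KernelCard
variable {ι : Type*} [Fintype ι] (A : Matrix ι ι ℤ)

/-- The number of solutions modulo `N` of a homogeneous linear system. -/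
noncomputable def kernelCard (N : ℕ) : ℕ :=
  Nat.card {x : ι → ZMod N // (A.map (Int.cast : ℤ → ZMod N)).mulVec x = 0}

/-- A matrix as a homomorphism. -/
def mulVecHom {R : Type*} [CommRing R] (A : Matrix ι ι R) : (ι → R) →+ (ι → R) :=
  A.mulVecLin.toAddMonoidHom

/-- Reduction modulo `N`. -/
def reduceHom (ι : Type*) (N : ℕ) : (ι → ℤ) →+ (ι → ZMod N) :=
  (Int.castAddHom (ZMod N)).compLeft ι

theorem reduceHom_surjective (ι : Type*) (N : ℕ) : Function.Surjective (reduceHom ι N) := fun x => by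
  choose y hy using fun i => ZMod.intCast_surjective (x i)
  exact ⟨y, funext hy⟩

theorem reduceHom_mulVec (N : ℕ) (x : ι → ℤ) :
    reduceHom ι N (A.mulVec x) = (A.map (Int.cast : ℤ → ZMod N)).mulVec (reduceHom ι N x) := by
  ext i
  simp [reduceHom, Matrix.mulVec, dotProduct]

/-- The kernel and the cokernel of an endomorphism of a finite group have the same order. -/
theorem kernelCard_eq_index (N : ℕ) [NeZero N] :
    kernelCard A N = (mulVecHom (A.map (Int.cast : ℤ → ZMod N))).range.index := by
  set φ := mulVecHom (A.map (Int.cast : ℤ → ZMod N))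
  have h1 : kernelCard A N = Nat.card φ.ker := rfl
  have h2 := φ.ker.card_mul_index
  rw [AddSubgroup.index_ker, ← φ.range.card_mul_index, mul_comm] at h2
  rw [h1]
  exact Nat.eq_of_mul_eq_mul_left Nat.card_pos h2

theorem range_le_comap (N : ℕ) : (mulVecHom A).range ≤
    (mulVecHom (A.map (Int.cast : ℤ → ZMod N))).range.comap (reduceHom ι N) := by
  rintro _ ⟨x, rfl⟩
  exact ⟨reduceHom ι N x, (reduceHom_mulVec A N x).symm⟩

variable [DecidableEq ι] {A}

theorem index_range_mulVecHom (hA : A.det ≠ 0) : (mulVecHom A).range.index = A.det.natAbs := by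
  have hinj : Function.Injective A.mulVecLin := by
    rw [← LinearMap.ker_eq_bot, LinearMap.ker_eq_bot']
    intro x hx
    by_contra h
    exact hA (Matrix.exists_mulVec_eq_zero_iff.mp ⟨x, h, hx⟩)
  have h := Submodule.natAbs_det_equiv (LinearMap.range A.mulVecLin)
    (LinearEquiv.ofInjective A.mulVecLin hinj)
  have h2 : (LinearMap.range A.mulVecLin).subtype ∘ₗ AddMonoidHom.toIntLinearMap
      ((LinearEquiv.ofInjective A.mulVecLin hinj : (ι → ℤ) →+ _)) = Matrix.toLin' A := by
    ext; rfl
  rw [h2, LinearMap.det_toLin'] at h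
  rw [h]
  rfl

/-- The cokernel modulo `N` is a quotient of the integral cokernel, whose order is the absolute
value of the determinant. -/
theorem kernelCard_dvd (hA : A.det ≠ 0) (N : ℕ) [NeZero N] : kernelCard A N ∣ A.det.natAbs := by
  rw [kernelCard_eq_index, ← AddSubgroup.index_comap_of_surjective _ (reduceHom_surjective ι N),
    ← index_range_mulVecHom hA]
  exact AddSubgroup.index_dvd_of_le (range_le_comap A N)

/-- Multiples of the determinant lie in the image by Cramer's rule, so reduction modulo `N` does not
shrink the cokernel. -/
theorem kernelCard_eq (hA : A.det ≠ 0) (N : ℕ) [NeZero N] (hN : A.det.natAbs ∣ N) :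
    kernelCard A N = A.det.natAbs := by
  rw [kernelCard_eq_index, ← AddSubgroup.index_comap_of_surjective _ (reduceHom_surjective ι N),
    ← index_range_mulVecHom hA]
  congr 1
  refine le_antisymm ?_ (range_le_comap A N)
  rintro v ⟨w, hw⟩
  obtain ⟨y, rfl⟩ := reduceHom_surjective ι N w
  have h1 : reduceHom ι N (v - A.mulVec y) = 0 := by
    rw [map_sub, reduceHom_mulVec, ← hw]; exact sub_self _
  have h2 (i : ι) : A.det ∣ (v - A.mulVec y) i := by
    have h3 : (N : ℤ) ∣ (v - A.mulVec y) i := by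
      rw [← ZMod.intCast_zmod_eq_zero_iff_dvd]
      exact congrFun h1 i
    exact (Int.natAbs_dvd.mp (Int.natCast_dvd_natCast.mpr hN)).trans h3
  choose z hz using h2
  refine ⟨y + A.adjugate.mulVec z, ?_⟩
  change A.mulVec (y + A.adjugate.mulVec z) = v
  rw [Matrix.mulVec_add, Matrix.mulVec_mulVec, Matrix.mul_adjugate, Matrix.smul_mulVec,
    Matrix.one_mulVec]
  ext i
  have := hz i
  simp only [Pi.sub_apply] at this
  simp only [Pi.add_apply, Pi.smul_apply, smul_eq_mul]
  omega

/-- An integral kernel vector stays nonzero modulo large primes, and its multiples are solutions. -/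
theorem kernelCard_unbounded (hA : A.det = 0) :
    ∃ B, ∀ p, p.Prime → B < p → p ≤ kernelCard A p := by
  obtain ⟨v, hv, h⟩ := Matrix.exists_mulVec_eq_zero_iff.mpr hA
  obtain ⟨i, hi⟩ := Function.ne_iff.mp hv
  refine ⟨(v i).natAbs, fun p hp hB => ?_⟩
  have : Fact p.Prime := ⟨hp⟩
  have hvi : ((v i : ℤ) : ZMod p) ≠ 0 := by
    intro h0
    rw [ZMod.intCast_zmod_eq_zero_iff_dvd, Int.natCast_dvd] at h0
    exact (Nat.le_of_dvd (Int.natAbs_pos.mpr hi) h0).not_gt hB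
  let g : ZMod p → {x : ι → ZMod p // (A.map (Int.cast : ℤ → ZMod p)).mulVec x = 0} :=
    fun c => ⟨c • reduceHom ι p v, by rw [Matrix.mulVec_smul, ← reduceHom_mulVec, h, map_zero, smul_zero]⟩
  have hg : Function.Injective g := fun c d hcd => by
    have := congrFun (congrArg Subtype.val hcd) i
    exact mul_right_cancel₀ hvi this
  have := Nat.card_le_card_of_injective g hg
  rwa [Nat.card_zmod] at this

end KernelCard

/-- The function `f` counts the solutions, with one free variable in addition, of a square linear
system with determinant `±d`. -/
def HasDet (f : ℕ → ℕ) (d : ℕ) : Prop :=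
  ∃ (ι : Type) (_ : Fintype ι) (_ : DecidableEq ι) (A : Matrix ι ι ℤ), A.det.natAbs = d ∧
    ∀ N, f N = (N + 1) * kernelCard A (N + 1)

/-- A nonzero determinant bounds the kernels for all moduli, while a zero one gives at least `p`
solutions for large primes `p`. If both are nonzero, a common multiple as modulus reveals both. -/
theorem HasDet.unique {f : ℕ → ℕ} {d e : ℕ} (hd : HasDet f d) (he : HasDet f e) : d = e := by
  obtain ⟨ι, _, _, A, rfl, hA⟩ := hd
  obtain ⟨κ, _, _, B, rfl, hB⟩ := he
  have key (N : ℕ) (hN : N ≠ 0) : kernelCard A N = kernelCard B N := by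
    obtain ⟨N, rfl⟩ := Nat.exists_eq_succ_of_ne_zero hN
    exact Nat.eq_of_mul_eq_mul_left N.succ_pos ((hA N).symm.trans (hB N))
  have aux {ι κ : Type} [Fintype ι] [DecidableEq ι] [Fintype κ] [DecidableEq κ] {A : Matrix ι ι ℤ} {B : Matrix κ κ ℤ}
      (key : ∀ N, N ≠ 0 → kernelCard A N = kernelCard B N) (h : A.det = 0) : B.det = 0 := by
    by_contra hB
    obtain ⟨b, hb⟩ := kernelCard_unbounded h
    obtain ⟨p, hp, hpp⟩ := Nat.exists_infinite_primes (b + B.det.natAbs + 1)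
    have : NeZero p := ⟨hpp.ne_zero⟩
    have h1 := hb p hpp (by omega)
    rw [key p hpp.ne_zero] at h1
    have h2 := Nat.le_of_dvd (Int.natAbs_pos.mpr hB) (kernelCard_dvd hB p)
    omega
  by_cases h : A.det = 0
  · rw [h, aux key h]
  · have h' : B.det ≠ 0 := fun h' => h (aux (fun N hN => (key N hN).symm) h')
    have hN : A.det.natAbs * B.det.natAbs ≠ 0 := by simp [h, h']
    have : NeZero (A.det.natAbs * B.det.natAbs) := ⟨hN⟩
    rw [← kernelCard_eq h _ (dvd_mul_right _ B.det.natAbs), key _ hN,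
      kernelCard_eq h' _ (dvd_mul_left _ _)]

/-- Additional free variables. -/
theorem HasDet.mul_pow {f : ℕ → ℕ} {d : ℕ} (h : HasDet f d) (j : ℕ) :
    HasDet (fun N => (N + 1) ^ j * f N) (if j = 0 then d else 0) := by
  obtain ⟨ι, _, _, A, rfl, hA⟩ := h
  -- The free variables are kept square by `j` zero equations, so the determinant vanishes unless `j
  -- = 0`.
  refine ⟨Fin j ⊕ ι, inferInstance, inferInstance, Matrix.fromBlocks 0 0 0 A, ?_, fun N => ?_⟩
  · rw [Matrix.det_fromBlocks_zero₂₁]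
    split_ifs with hj
    · subst hj; simp
    · have : Nonempty (Fin j) := ⟨⟨0, by omega⟩⟩
      rw [Matrix.det_zero]; simp
  · have e : {x : Fin j ⊕ ι → ZMod (N + 1) // ((Matrix.fromBlocks (0 : Matrix (Fin j) (Fin j) ℤ) 0 0
        A).map (Int.cast : ℤ → ZMod (N + 1))).mulVec x = 0} ≃ (Fin j → ZMod (N + 1)) ×
        {x : ι → ZMod (N + 1) // (A.map (Int.cast : ℤ → ZMod (N + 1))).mulVec x = 0} :=
      have h (x : Fin j ⊕ ι → ZMod (N + 1)) : ((Matrix.fromBlocks (0 : Matrix (Fin j) (Fin j) ℤ) 0 0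
          A).map (Int.cast : ℤ → ZMod (N + 1))).mulVec x = 0 ↔
          (A.map (Int.cast : ℤ → ZMod (N + 1))).mulVec (x ∘ Sum.inr) = 0 := by
        rw [Matrix.fromBlocks_map, Matrix.fromBlocks_mulVec]
        constructor
        · intro h
          funext i
          simpa [Matrix.map_zero] using congrFun h (.inr i)
        · intro h
          funext i
          obtain i | i := i
          · simp [Matrix.map_zero]
          · simpa [Matrix.map_zero] using congrFun h i
      { toFun := fun x => ⟨x.1 ∘ Sum.inl, x.1 ∘ Sum.inr, (h _).mp x.2⟩
        invFun := fun y => ⟨Sum.elim y.1 y.2.1, (h _).mpr y.2.2⟩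
        left_inv := fun x => Subtype.ext (Sum.elim_comp_inl_inr _)
        right_inv := fun y => rfl }
    simp only [hA]
    rw [kernelCard, kernelCard, Nat.card_congr e, Nat.card_prod, Nat.card_fun]
    simp
    ring

end

section

/-! ### Colourings as solutions of a square linear system -/

section Alternating
variable {T : Type*} [AddCommGroup T]

/-- The alternating sum of the first `m` entries. -/
def altSum : ℕ → (ℕ → T) → T
  | 0, _ => 0
  | m + 1, a => a 0 - altSum m fun j => a (j + 1)

theorem altSum_succ (m : ℕ) (a : ℕ → T) :
    altSum (m + 1) a = a 0 - altSum m fun j => a (j + 1) := rfl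

/-- The alternating sum of colours is the same at all levels: turns insert or delete equal
neighbours, and crossings add one element to two neighbours. When two strands remain it forces them
to agree, which makes the last maximum redundant. -/
theorem altSum_pad {i m : ℕ} (hi : i ≤ m) (x : T) (a : ℕ → T) :
    altSum (m + 2) (pad i x x a) = altSum m a := by
  induction i generalizing m a with
  | zero =>
    have : (fun j => pad 0 x x a (j + 1 + 1)) = a := by ext j; simp [pad]
    simp only [altSum, this]
    simp [pad]
  | succ i ih =>
    obtain ⟨m, rfl⟩ := Nat.exists_eq_add_of_le' (show 1 ≤ m by omega)
    have : (fun j => pad (i + 1) x x a (j + 1)) = pad i x x fun j => a (j + 1) := by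
      ext j; simp only [pad]; grind
    rw [show m + 1 + 2 = m + 2 + 1 by ring, altSum_succ (m + 2), altSum_succ m, this, ih (by omega)]
    simp [pad]

theorem altSum_del {i m : ℕ} (hi : i ≤ m) {a : ℕ → T} (h : a i = a (i + 1)) :
    altSum m (del i a) = altSum (m + 2) a := by
  rw [← altSum_pad hi (a i)]
  congr 1; ext j; simp only [pad, del]; grind

theorem altSum_bump {i m : ℕ} (hi : i + 2 ≤ m) (z : T) (a : ℕ → T) :
    altSum m (bump i z a) = altSum m a := by
  induction i generalizing m a with
  | zero =>
    obtain ⟨m, rfl⟩ := Nat.exists_eq_add_of_le' hi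
    simp only [altSum, zero_add]
    simp [bump]
    abel
  | succ i ih =>
    obtain ⟨m, rfl⟩ := Nat.exists_eq_add_of_le' (show 1 ≤ m by omega)
    have : (fun j => bump (i + 1) z a (j + 1)) = bump i z fun j => a (j + 1) := by
      ext j; simp only [bump]; grind
    rw [altSum, altSum, this, ih (by omega)]
    simp [bump]

theorem altSum_zero (m : ℕ) : altSum m (0 : ℕ → T) = 0 := by
  induction m with
  | zero => rfl
  | succ m ih => rw [altSum, show (fun j => (0 : ℕ → T) (j + 1)) = 0 from rfl, ih]; simp

/-- The condition at the last maximum is redundant. -/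
theorem cnt_cap_last [Fintype T] [DecidableEq T] {w : List StrandOp} {m : ℕ} (h : OpFits m w 2)
    {a : ℕ → T} (ha : altSum m a = 0) :
    cnt (w ++ [.cap 0]) a (fun _ => 1) = cnt w a fun _ => 1 := by
  induction w generalizing m a with
  | nil =>
    obtain rfl : m = 2 := h
    simp only [altSum, zero_add, sub_zero, sub_eq_zero] at ha
    simp [cnt, ha]
  | cons p w ih =>
    cases p with
    | cup i => exact Finset.sum_congr rfl fun x _ => ih h.2 (by rw [altSum_pad h.1, ha])
    | cap i =>
      obtain ⟨m, rfl, hi, h⟩ := h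
      simp only [cnt, List.cons_append]
      split_ifs with h'
      · exact ih h (by rw [altSum_del hi h', ha])
      · rfl
    | mix α β i =>
      simp only [cnt, List.cons_append]
      refine Finset.sum_congr rfl fun x _ => ?_
      rw [ih h.2 (by rw [altSum_bump h.1, ha])]

end Alternating

section LinearForms
variable {H : ℕ}

/-- The number of variables of the linear system of `w`. -/
def numVars : List StrandOp → ℕ
  | [] => 0
  | .cup _ :: w => numVars w + 1
  | .cap _ :: w => numVars w
  | .mix _ _ _ :: w => numVars w + 1

/-- The variable number `s`, as a linear form. -/
def formVar (s : ℕ) : Fin H → ℤ := fun j => if j.1 = s then 1 else 0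

/-- The equations of `w`, with `s` the number of the next variable and `a` the colours. -/
def equations : List StrandOp → ℕ → (ℕ → Fin H → ℤ) → List (Fin H → ℤ)
  | [], _, _ => []
  | .cup i :: w, s, a => equations w (s + 1) (pad i (formVar s) (formVar s) a)
  | .cap i :: w, s, a => (a i - a (i + 1)) :: equations w s (del i a)
  | .mix α β i :: w, s, a =>
      (α • formVar s + β • (a i - a (i + 1))) :: equations w (s + 1) (bump i (formVar s) a)

/-- The equations of a prefix and the state it leaves do not depend on what follows. This isolates
the row of a chosen `mix`. -/
theorem equations_append (u : List StrandOp) (s : ℕ) (a : ℕ → Fin H → ℤ) :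
    ∃ R s' a', ∀ w, equations (u ++ w) s a = R ++ equations w s' a' := by
  induction u generalizing s a with
  | nil => exact ⟨[], s, a, fun w => rfl⟩
  | cons p u ih =>
    cases p with
    | cup i => exact ih _ _
    | cap i =>
      obtain ⟨R, s', a', h⟩ := ih s (del i a)
      exact ⟨_ :: R, s', a', fun w => congrArg (List.cons _) (h w)⟩
    | mix α β i =>
      obtain ⟨R, s', a', h⟩ := ih (s + 1) (bump i (formVar s) a)
      exact ⟨_ :: R, s', a', fun w => congrArg (List.cons _) (h w)⟩

/-- A minimum adds a variable, a maximum an equation, a crossing both. With two strands at either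
end the system is square. -/
theorem length_equations {w : List StrandOp} {m n : ℕ} (h : OpFits m w n) (s : ℕ)
    (a : ℕ → Fin H → ℤ) : m + 2 * numVars w = n + 2 * (equations w s a).length := by
  induction w generalizing m s a with
  | nil => simpa [numVars, equations, OpFits] using h
  | cons p w ih =>
    cases p with
    | cup i =>
      have := ih h.2 (s + 1) (pad i (formVar s) (formVar s) a)
      simp only [numVars, equations]; omega
    | cap i =>
      obtain ⟨m, rfl, -, h⟩ := h
      have := ih h s (del i a)
      simp only [numVars, equations, List.length_cons]; omega
    | mix α β i =>
      have := ih h.2 (s + 1) (bump i (formVar s) a)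
      simp only [numVars, equations, List.length_cons]; omega

variable {T : Type*} [AddCommGroup T]

/-- The value of a linear form. -/
def evalForm (x : Fin H → T) : (Fin H → ℤ) →+ T where
  toFun f := ∑ j, f j • x j
  map_zero' := by simp
  map_add' f g := by simp [add_smul, Finset.sum_add_distrib]

theorem evalForm_var (x : Fin H → T) (s : Fin H) : evalForm x (formVar s.1) = x s := by
  change ∑ j, (if j.1 = s.1 then (1 : ℤ) else 0) • x j = x s
  rw [Finset.sum_eq_single s]
  · simp
  · intro j _ hj
    rw [if_neg (Fin.val_ne_of_ne hj), zero_smul]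
  · simp

theorem evalForm_congr {x y : Fin H → T} {s : ℕ} (h : ∀ j : Fin H, j.1 < s → x j = y j)
    {f : Fin H → ℤ} (hf : ∀ j : Fin H, s ≤ j.1 → f j = 0) : evalForm x f = evalForm y f := by
  change ∑ j, f j • x j = ∑ j, f j • y j
  refine Finset.sum_congr rfl fun j _ => ?_
  by_cases hj : j.1 < s
  · rw [h j hj]
  · rw [hf j (by omega), zero_smul, zero_smul]

theorem evalForm_update (x : Fin H → T) (s : Fin H) (t : T) {f : Fin H → ℤ}
    (hf : ∀ j : Fin H, s.1 ≤ j.1 → f j = 0) : evalForm (Function.update x s t) f = evalForm x f :=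
  evalForm_congr (fun j hj => Function.update_of_ne (ne_of_lt (show j < s from hj)) _ _) hf

/-- The solutions of linear equations, with the first `s` variables given. -/
def Solutions (x : Fin H → T) (s : ℕ) (R : List (Fin H → ℤ)) : Type _ :=
  {y : Fin H → T // (∀ j : Fin H, j.1 < s → y j = x j) ∧ ∀ r ∈ R, evalForm y r = 0}

instance [Finite T] (x : Fin H → T) (s : ℕ) (R : List (Fin H → ℤ)) : Finite (Solutions x s R) :=
  inferInstanceAs (Finite (Subtype _))

theorem card_solutions_succ [Fintype T] (x : Fin H → T) (s : Fin H) (R : List (Fin H → ℤ)) :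
    Nat.card (Solutions x s R) =
      ∑ t, Nat.card (Solutions (Function.update x s t) (s + 1) R) := by
  rw [← Nat.card_sigma]
  refine Nat.card_congr
    { toFun := fun y => ⟨y.1 s, y.1, fun j hj => ?_, y.2.2⟩
      invFun := fun y => ⟨y.2.1, fun j hj => ?_, y.2.2.2⟩
      left_inv := fun y => rfl
      right_inv := fun y => ?_ }
  · obtain rfl | h := eq_or_ne j s
    · simp
    · rw [Function.update_of_ne h]
      exact y.2.1 j (lt_of_le_of_ne (Nat.lt_succ_iff.mp hj) (Fin.val_ne_of_ne h))
  · rw [y.2.2.1 j (by omega), Function.update_of_ne]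
    rintro rfl
    exact lt_irrefl _ hj
  · obtain ⟨t, y, h1, h2⟩ := y
    have : y s = t := by rw [h1 s (Nat.lt_succ_self _)]; simp
    subst this
    rfl

theorem card_solutions_cons (x : Fin H → T) (s : ℕ) (r : Fin H → ℤ)
    (hr : ∀ j : Fin H, s ≤ j.1 → r j = 0) (R : List (Fin H → ℤ)) [Decidable (evalForm x r = 0)] :
    Nat.card (Solutions x s (r :: R)) = if evalForm x r = 0 then Nat.card (Solutions x s R) else 0 := by
  split_ifs with h
  · refine Nat.card_congr (Equiv.subtypeEquivRight fun y => ?_)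
    refine and_congr_right fun hy => ?_
    rw [List.forall_mem_cons, evalForm_congr hy hr]
    simp [h]
  · rw [Nat.card_eq_zero]
    left
    refine ⟨fun y => h ?_⟩
    rw [← evalForm_congr y.2.1 hr]
    exact y.2.2 r List.mem_cons_self

/-- Colours become linear forms in the variables introduced so far. The hypothesis `ha` keeps them
free of later variables, so choosing those does not change earlier equations. -/
theorem cnt_eq_card_solutions [Fintype T] [DecidableEq T] (w : List StrandOp) (s : ℕ)
    (hs : s + numVars w = H) (a : ℕ → Fin H → ℤ) (ha : ∀ i, ∀ j : Fin H, s ≤ j.1 → a i j = 0)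
    (x : Fin H → T) : cnt w (fun i => evalForm x (a i)) (fun _ => 1) =
      Nat.card (Solutions x s (equations w s a)) := by
  induction w generalizing s a x with
  | nil =>
    have : Unique (Solutions x s (equations [] s a)) :=
      { default := ⟨x, fun _ _ => rfl, by simp [equations]⟩
        uniq := fun y => Subtype.ext <| funext fun j =>
          y.2.1 j (by have := j.2; simp only [numVars] at hs; omega) }
    simp [cnt]
  | cons p w ih =>
    cases p with
    | cup i =>
      simp only [numVars] at hs
      have hsH : s < H := by omega
      rw [equations, card_solutions_succ x ⟨s, hsH⟩, cnt]
      refine Finset.sum_congr rfl fun t _ => ?_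
      rw [← ih (s + 1) (by omega)]
      · congr 1; ext j
        have h1 : evalForm (Function.update x ⟨s, hsH⟩ t) (formVar s) = t := by
          rw [evalForm_var _ ⟨s, hsH⟩]; simp
        have h2 (l : ℕ) : evalForm (Function.update x ⟨s, hsH⟩ t) (a l) = evalForm x (a l) :=
          evalForm_update x ⟨s, hsH⟩ t (ha l)
        simp only [pad]
        split_ifs <;> simp only [h1, h2]
      · intro l j hj
        replace hj : s + 1 ≤ j.1 := hj
        have h0 : formVar s j = 0 := if_neg (by omega)
        simp only [pad]
        split_ifs <;> first | exact h0 | exact ha _ _ (by omega)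
    | cap i =>
      rw [equations, card_solutions_cons _ _ _ (by simp +contextual [ha]), cnt, ← ih s hs]
      · simp only [map_sub, sub_eq_zero]
        congr 2; ext j; simp only [del]; split_ifs <;> rfl
      · intro l j hj
        simp only [del]
        split_ifs <;> exact ha _ _ hj
    | mix α β i =>
      simp only [numVars] at hs
      have hsH : s < H := by omega
      rw [equations, card_solutions_succ x ⟨s, hsH⟩, cnt]
      refine Finset.sum_congr rfl fun t _ => ?_
      have h1 : evalForm (Function.update x ⟨s, hsH⟩ t) (formVar s) = t := by
        rw [evalForm_var _ ⟨s, hsH⟩]; simp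
      have h2 (l : ℕ) : evalForm (Function.update x ⟨s, hsH⟩ t) (a l) = evalForm x (a l) :=
        evalForm_update x ⟨s, hsH⟩ t (ha l)
      rw [card_solutions_cons, ← ih (s + 1) (by omega)]
      · simp only [map_add, map_sub, map_zsmul, h1, h2]
        congr 2; ext j
        simp only [bump]
        split_ifs <;> simp only [h1, h2, map_add]
      · intro l j hj
        replace hj : s + 1 ≤ j.1 := hj
        have h0 (l : ℕ) : a l j = 0 := ha l j (by omega)
        have h1 : formVar s j = 0 := if_neg (by omega)
        simp only [bump]
        split_ifs <;> simp [h0, h1]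
      · intro j hj
        replace hj : s + 1 ≤ j.1 := hj
        have h0 (l : ℕ) : a l j = 0 := ha l j (le_trans (Nat.le_succ s) hj)
        simp only [formVar, Pi.add_apply, Pi.smul_apply, Pi.sub_apply]
        rw [h0, h0, if_neg (by omega)]
        simp

end LinearForms

/-- The square matrix with the given rows. -/
def rowMatrix {H : ℕ} (R : List (Fin H → ℤ)) : Matrix (Fin H) (Fin H) ℤ :=
  Matrix.of fun i => R.getD i.1 0

theorem card_solutions_zero {H : ℕ} (R : List (Fin H → ℤ)) (hR : R.length = H) (N : ℕ) :
    Nat.card (Solutions (0 : Fin H → ZMod N) 0 R) = kernelCard (rowMatrix R) N := by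
  refine Nat.card_congr (Equiv.subtypeEquivRight fun y => ?_)
  have h (i : Fin H) : ((rowMatrix R).map (Int.cast : ℤ → ZMod N)).mulVec y i =
      evalForm y (R.getD i.1 0) := by
    simp [Matrix.mulVec, dotProduct, rowMatrix, evalForm, zsmul_eq_mul]
  constructor
  · rintro ⟨-, h'⟩
    funext i
    rw [h]
    refine h' _ ?_
    have hi : i.1 < R.length := by omega
    rw [List.getD_eq_getElem _ _ hi]
    exact List.getElem_mem hi
  · intro h'
    refine ⟨by simp, fun r hr => ?_⟩
    obtain ⟨i, hi, rfl⟩ := List.getElem_of_mem hr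
    have := congrFun h' ⟨i, by omega⟩
    rw [h] at this
    rwa [Fin.val_mk, List.getD_eq_getElem _ _ hi] at this

/-- The numbers of colourings by the elements of the groups `ℤ / (N + 1)`. -/
def opColourings (w : List StrandOp) (N : ℕ) : ℕ := cnt w (0 : ℕ → ZMod (N + 1)) fun _ => 1

theorem OpFits.append {u v : List StrandOp} {m n r : ℕ} (hu : OpFits m u n) (hv : OpFits n v r) :
    OpFits m (u ++ v) r := by
  induction u generalizing m with
  | nil => cases hu; exact hv
  | cons p u ih =>
    cases p with
    | cup i => exact ⟨hu.1, ih hu.2⟩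
    | cap i => obtain ⟨m', rfl, hi, h⟩ := hu; exact ⟨m', rfl, hi, ih h⟩
    | mix α β i => exact ⟨hu.1, ih hu.2⟩

/-- The colour of the first minimum is normalized to zero, giving the factor `N + 1`, and the last
maximum imposes nothing; what remains is square. -/
theorem hasDet_opColourings {w : List StrandOp} (h : OpFits 2 w 2) :
    HasDet (opColourings (.cup 0 :: (w ++ [.cap 0])))
      (rowMatrix (equations (H := numVars w) w 0 0)).det.natAbs := by
  refine ⟨_, inferInstance, inferInstance, _, rfl, fun N => ?_⟩
  rw [opColourings, cnt_cup_zero (h.append (show OpFits 2 [.cap 0] 0 from ⟨0, rfl, le_rfl, rfl⟩)), cnt_cap_last h (altSum_zero 2), ZMod.card,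
    ← card_solutions_zero _ (by have := length_equations h 0 (0 : ℕ → Fin (numVars w) → ℤ); omega),
    ← cnt_eq_card_solutions w 0 (zero_add _) 0 (fun _ _ _ => rfl)]
  congr 2
  funext i
  exact (map_zero _).symm

theorem numVars_append (u v : List StrandOp) : numVars (u ++ v) = numVars u + numVars v := by
  induction u with
  | nil => simp [numVars]
  | cons p u ih => cases p <;> simp only [List.cons_append, numVars, ih] <;> ring

/-- The determinant is a linear function of a mixed operation. -/
theorem exists_hasDet_mix (u v : List StrandOp) (i : ℕ)
    (h : ∀ α β, OpFits 2 (u ++ .mix α β i :: v) 2) :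
    ∃ x y : ℤ, ∀ α β, HasDet (opColourings (.cup 0 :: (u ++ .mix α β i :: v ++ [.cap 0])))
      (α * x + β * y).natAbs := by
  set H := numVars (u ++ .mix 0 0 i :: v) with hH
  have hv (α β : ℤ) : numVars (u ++ .mix α β i :: v) = H := by
    rw [hH, numVars_append, numVars_append]; rfl
  obtain ⟨R, s, a, hR⟩ := equations_append (H := H) u 0 0
  set R' := equations (H := H) v (s + 1) (bump i (formVar s) a) with hR'
  have hrow (α β : ℤ) : equations (H := H) (u ++ .mix α β i :: v) 0 0 =
      R ++ (α • formVar s + β • (a i - a (i + 1))) :: R' := hR _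
  have hlen : R.length < H := by
    have := length_equations (h 0 0) 0 (0 : ℕ → Fin H → ℤ)
    rw [hrow, List.length_append, List.length_cons, ← hH] at this
    omega
  -- The rows other than that of the operation are independent of `α` and `β`; a zero row holds its
  -- place.
  set M : Matrix (Fin H) (Fin H) ℤ := rowMatrix (R ++ 0 :: R') with hM
  have hmat (α β : ℤ) : rowMatrix (equations (H := H) (u ++ .mix α β i :: v) 0 0) =
      M.updateRow ⟨R.length, hlen⟩ (α • formVar s + β • (a i - a (i + 1))) := by
    rw [hrow]
    ext k l
    obtain rfl | hk := eq_or_ne k ⟨R.length, hlen⟩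
    · simp [rowMatrix]
    · rw [Matrix.updateRow_ne hk, hM]
      simp only [rowMatrix, Matrix.of_apply]
      have hk' : k.1 ≠ R.length := fun h => hk (Fin.ext h)
      obtain h | h := lt_or_gt_of_ne hk'
      · rw [List.getD_append _ _ _ _ h, List.getD_append _ _ _ _ h]
      · rw [List.getD_append_right _ _ _ _ h.le, List.getD_append_right _ _ _ _ h.le]
        obtain ⟨q, hq⟩ := Nat.exists_eq_add_of_lt h
        rw [show k.1 - R.length = q + 1 by omega]
        rfl
  refine ⟨(M.updateRow ⟨R.length, hlen⟩ (formVar s)).det,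
    (M.updateRow ⟨R.length, hlen⟩ (a i - a (i + 1))).det, fun α β => ?_⟩
  have := hasDet_opColourings (h α β)
  rw [hv α β, hmat, Matrix.det_updateRow_add, Matrix.det_updateRow_smul,
    Matrix.det_updateRow_smul] at this
  exact this

theorem cnt_mix_one_zero {T : Type*} [AddCommGroup T] [Fintype T] [DecidableEq T] (i : ℕ)
    (w : List StrandOp) (a : ℕ → T) (φ : (ℕ → T) → ℕ) : cnt (.mix 1 0 i :: w) a φ = cnt w a φ := by
  have : bump i 0 a = a := by ext j; simp [bump]
  simp [cnt, this]

/-- The equation closes the two lower strands by a maximum, and the now unconstrained `z` gives a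
free colour to a new minimum. -/
theorem cnt_mix_zero_one {T : Type*} [AddCommGroup T] [Fintype T] [DecidableEq T] (i : ℕ)
    (w : List StrandOp) (a : ℕ → T) (φ : (ℕ → T) → ℕ) :
    cnt (.mix 0 1 i :: w) a φ = cnt (.cap i :: .cup i :: w) a φ := by
  simp only [cnt, zero_smul, one_smul, zero_add, sub_eq_zero]
  split_ifs with h
  · refine Fintype.sum_equiv (Equiv.addLeft (a i)) _ _ fun x => ?_
    congr 1; ext j; simp only [pad, del, bump, Equiv.coe_addLeft]; grind
  · simp

/-- The numbers of colourings of a diagram by the elements of the groups `ℤ / (N + 1)`. -/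
def colourings (w : List Piece) (N : ℕ) : ℕ := count w (0 : ℕ → ZMod (N + 1))

theorem Fits.exists_last {w : List Piece} {m : ℕ} (h : Fits m w 0) (hm : m ≠ 0) :
    ∃ w', w = w' ++ [⟨.cap, 0⟩] ∧ Fits m w' 2 := by
  induction w using List.reverseRecOn with
  | nil => exact absurd h hm
  | append_singleton w p =>
    obtain ⟨n, h1, h2⟩ := h.append_elim
    obtain ⟨κ, i⟩ := p
    have h3 : Piece.above n ⟨κ, i⟩ = 0 := h2.2
    have h4 := h2.1
    cases κ <;> simp only [Piece.above, Kind.ins, Kind.outs] at h3 h4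
    · omega
    · obtain rfl : n = 2 := by omega
      obtain rfl : i = 0 := by omega
      exact ⟨w, rfl, h1⟩
    · omega
    · omega

/-- The skein relation for determinants. -/
theorem exists_hasDet_skein {u v : List Piece} {κ : Kind} (hκ : κ = .pos ∨ κ = .neg) {i : ℕ}
    (h : Fits 0 (u ++ ⟨κ, i⟩ :: v) 0) :
    ∃ x y : ℤ, HasDet (colourings (u ++ v)) x.natAbs ∧
      HasDet (colourings (u ++ ⟨.cap, i⟩ :: ⟨.cup, i⟩ :: v)) y.natAbs ∧
      HasDet (colourings (u ++ ⟨κ, i⟩ :: v)) (x + y).natAbs := by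
  obtain ⟨m, hu, hv⟩ := h.append_elim
  obtain ⟨hi, hv⟩ := (fits_crossing hκ).mp hv
  obtain ⟨v, rfl, hv'⟩ := hv.exists_last (by omega)
  cases u with
  | nil => have : 0 = m := hu; omega
  | cons p u =>
    obtain rfl := hu.cons_zero
    obtain ⟨-, hu'⟩ := fits_cup.mp hu
    obtain ⟨x, y, H⟩ := exists_hasDet_mix (u.map Piece.toOp) (v.map Piece.toOp) i fun α β =>
      hu'.opFits.append ⟨hi, hv'.opFits⟩
    have hx : HasDet (colourings (⟨.cup, 0⟩ :: u ++ (v ++ [⟨.cap, 0⟩]))) x.natAbs := by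
      have := H 1 0
      simp only [one_mul, zero_mul, add_zero] at this
      convert this using 1
      funext N
      simp only [colourings, opColourings, count, List.map_append, List.map_cons, List.map_nil,
        Piece.toOp, List.cons_append, List.append_assoc]
      rw [← List.cons_append, ← List.cons_append, cnt_append, cnt_append]
      simp only [cnt_mix_one_zero]
    have hy : HasDet (colourings (⟨.cup, 0⟩ :: u ++ ⟨.cap, i⟩ :: ⟨.cup, i⟩ :: (v ++ [⟨.cap, 0⟩])))
        y.natAbs := by
      have := H 0 1
      simp only [one_mul, zero_mul, zero_add] at this
      convert this using 1
      funext N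
      simp only [colourings, opColourings, count, List.map_append, List.map_cons, List.map_nil,
        Piece.toOp, List.cons_append, List.append_assoc]
      rw [← List.cons_append, ← List.cons_append, ← List.cons_append, ← List.cons_append, cnt_append, cnt_append]
      simp only [cnt_mix_zero_one]
      rfl
    have hz (κ : Kind) (β : ℤ) (hβ : Piece.toOp ⟨κ, i⟩ = .mix 1 β i) :
        HasDet (colourings (⟨.cup, 0⟩ :: u ++ ⟨κ, i⟩ :: (v ++ [⟨.cap, 0⟩])))
          (1 * x + β * y).natAbs := by
      convert H 1 β using 1
      funext N
      simp only [colourings, opColourings, count, List.map_append, List.map_cons, List.map_nil,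
        hβ, List.cons_append, List.append_assoc]
      rfl
    obtain rfl | rfl := hκ
    -- A positive crossing has `β = -1`; the sign is moved into the integer attached to the second
    -- smoothing.
    · refine ⟨x, -y, hx, by rwa [Int.natAbs_neg], ?_⟩
      have := hz .pos (-1) rfl
      rwa [one_mul, neg_one_mul] at this
    · refine ⟨x, y, hx, hy, ?_⟩
      have := hz .neg 1 rfl
      rwa [one_mul, one_mul] at this

/-- Common divisors of the determinants of the closures of a tangle divide the determinants of its
extensions. -/
theorem exists_hasDet_extension (g : ℕ) {t below above : List Piece} {k l r : ℕ}
    (ht : Fits 0 t r) (hfb : Fits 0 below (k + l)) (hfa : Fits (k + r + l) above 0)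
    (hI : ∀ c, Fits r (caps c) 0 → ∃ d, HasDet (colourings (t ++ caps c)) d ∧ g ∣ d) :
    ∃ d, HasDet (colourings (below ++ t.map (Piece.shift k) ++ above)) d ∧ g ∣ d := by
  have skein (u v : List Piece) (κ : Kind) (i : ℕ) (hκ : κ = .pos ∨ κ = .neg)
      (h : Fits 0 (u ++ ⟨κ, i⟩ :: v) 0) (h1 : ∃ d, HasDet (colourings (u ++ v)) d ∧ g ∣ d)
      (h2 : ∃ d, HasDet (colourings (u ++ ⟨.cap, i⟩ :: ⟨.cup, i⟩ :: v)) d ∧ g ∣ d) :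
      ∃ d, HasDet (colourings (u ++ ⟨κ, i⟩ :: v)) d ∧ g ∣ d := by
    obtain ⟨x, y, hx, hy, hxy⟩ := exists_hasDet_skein hκ h
    obtain ⟨d, hd, hgd⟩ := h1
    obtain ⟨e, he, hge⟩ := h2
    -- The determinants known to be divisible are those of the skein relation, by uniqueness.
    rw [hd.unique hx] at hgd
    rw [he.unique hy] at hge
    refine ⟨_, hxy, ?_⟩
    rw [← Int.natCast_dvd] at hgd hge ⊢
    exact dvd_add hgd hge
  have hS : Fits (k + l) (t.map (Piece.shift k)) (k + r + l) := ht.shift k l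
  refine skein_induction (m := 0) (n := k + l)
    (fun below => ∃ d, HasDet (colourings (below ++ t.map (Piece.shift k) ++ above)) d ∧ g ∣ d)
    (fun below hb hfb => ?_) (fun u v κ i hκ h h1 h2 => ?_) below hfb
  · refine skein_induction (m := k + r + l) (n := 0)
      (fun above => ∃ d, HasDet (colourings (below ++ t.map (Piece.shift k) ++ above)) d ∧ g ∣ d)
      (fun above ha hfa => ?_) (fun u v κ i hκ h h1 h2 => ?_) above hfa
    · obtain ⟨c, j, hc, H⟩ := exists_caps_outside hb ha hfb hfa
      obtain ⟨d, hd, hgd⟩ := hI c hc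
      -- A split closed curve makes the determinant zero, which is harmless for divisibility.
      refine ⟨_, ?_, show g ∣ if j = 0 then d else 0 from ?_⟩
      · convert hd.mul_pow j using 1
        funext N
        rw [colourings, H _ t ht, ZMod.card]
        rfl
      · split_ifs <;> simp [hgd]
    · have := skein (below ++ t.map (Piece.shift k) ++ u) v κ i hκ
        (by simpa using hfb.append (hS.append h))
        (by simpa using h1) (by simpa using h2)
      simpa using this
  · have := skein u (v ++ t.map (Piece.shift k) ++ above) κ i hκ
      (by simpa using h.append (hS.append hfa)) (by simpa using h1) (by simpa using h2)
    simpa using this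

end

section

/-! ### Matrices with one redundant row and one redundant column -/

section Redundant
variable {R K α : Type*} [CommRing R] {p : ℕ}

theorem exists_rows (S : Finset K) [Nonempty K] (hS : S.card ≤ p + 1) :
    ∃ (r : Fin p → K) (k₀ : K), ∀ k ∈ S, k = k₀ ∨ k ∈ Set.range r := by
  classical
  obtain rfl | ⟨k₀, hk₀⟩ := S.eq_empty_or_nonempty
  · exact ⟨fun _ => Classical.arbitrary K, Classical.arbitrary K, by simp⟩
  · have hc : Fintype.card (S.erase k₀) ≤ Fintype.card (Fin p) := by
      rw [Fintype.card_coe, Finset.card_erase_of_mem hk₀, Fintype.card_fin]; omega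
    obtain ⟨g⟩ := Function.Embedding.nonempty_of_card_le hc
    -- All rows of `S` but `k₀` are selected; surplus places of the square block repeat `k₀`.
    refine ⟨Function.extend g Subtype.val fun _ => k₀, k₀, fun k hk => ?_⟩
    refine or_iff_not_imp_left.mpr fun h => ⟨g ⟨k, Finset.mem_erase.mpr ⟨h, hk⟩⟩, ?_⟩
    exact g.injective.extend_apply _ _ _

/-- Because the coefficients are units, the relation can be solved for the one omitted row. -/
theorem exists_row_combination [Fintype K] (M : Matrix K α R) (u : K → R) (hu : ∀ k, IsUnit (u k))
    (hM : ∀ a, ∑ k, u k * M k a = 0) (S : Finset K) (hS : ∀ k ∉ S, M k = 0) (r : Fin p → K) (k₀ : K)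
    (hr : ∀ k ∈ S, k = k₀ ∨ k ∈ Set.range r) :
    ∃ B : Matrix K (Fin p) R, M = B * M.submatrix r id := by
  classical
  have h1 (k : K) (hk : k ≠ k₀) : M k ∈ Submodule.span R (Set.range (M ∘ r)) := by
    by_cases hkS : k ∈ S
    · obtain h | ⟨i, rfl⟩ := hr k hkS
      · exact absurd h hk
      · exact Submodule.subset_span ⟨i, rfl⟩
    · rw [hS k hkS]; exact Submodule.zero_mem _
  have h2 (k : K) : M k ∈ Submodule.span R (Set.range (M ∘ r)) := by
    obtain rfl | hk := eq_or_ne k k₀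
    · rw [← Submodule.smul_mem_iff_of_isUnit _ (hu k)]
      have h3 : u k • M k = -∑ j ∈ Finset.univ.erase k, u j • M j := by
        rw [eq_neg_iff_add_eq_zero, Finset.add_sum_erase _ (fun j => u j • M j) (Finset.mem_univ k)]
        funext a
        simpa using hM a
      rw [h3]
      exact Submodule.neg_mem _ (Submodule.sum_mem _ fun j hj =>
        Submodule.smul_mem _ _ (h1 j (Finset.ne_of_mem_erase hj)))
    · exact h1 k hk
  choose B hB using fun k => (Submodule.mem_span_range_iff_exists_fun R).mp (h2 k)
  refine ⟨B, Matrix.ext fun k a => ?_⟩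
  rw [← hB k, Finset.sum_apply]
  rfl

variable {M : Matrix K α R} {r : Fin p → K} {B : Matrix K (Fin p) R} (e : Option (Fin p) ≃ α)

theorem sum_option_equiv [Fintype α] {A : Type*} [AddCommMonoid A] (f : α → A) :
    ∑ a, f a = f (e none) + ∑ j, f (e (some j)) := by
  rw [← e.sum_comp, Fintype.sum_option]

/-- The matrix factors through its selected block as `B * block * C`, so each minor of this size is
a product of three determinants, one being that of the block. -/
theorem det_dvd_minor [Fintype α] (hB : M = B * M.submatrix r id) (hM : ∀ k, ∑ a, M k a = 0)
    (r' : Fin p → K) (c' : Fin p → α) :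
    (M.submatrix r (e ∘ some)).det ∣ (M.submatrix r' c').det := by
  -- The omitted column is minus the sum of the others.
  let C : Matrix (Fin p) α R := fun j a => (e.symm a).elim (-1) fun i => if j = i then 1 else 0
  have hC : M = M.submatrix id (e ∘ some) * C := by
    ext k a
    obtain ⟨o, rfl⟩ := e.surjective a
    rw [Matrix.mul_apply]
    cases o with
    | none =>
      have := hM k
      rw [sum_option_equiv e] at this
      simp [C, eq_neg_of_add_eq_zero_left this]
    | some i => simp [C]
  have : M.submatrix r' c' = B.submatrix r' id * (M.submatrix r (e ∘ some) * C.submatrix id c') := by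
    rw [← Matrix.submatrix_id_id (M.submatrix r (e ∘ some))]
    conv_lhs => rw [hB, hC]
    ext i j
    rfl
  rw [this, Matrix.det_mul, Matrix.det_mul]
  exact (dvd_mul_right _ _).mul_left _

/-- Constants are solutions, so one coordinate can be normalized to zero at the cost of a factor
`N`; the omitted rows follow from the chosen ones. -/
theorem card_solutions_eq_mul_kernelCard [Fintype α] {M : Matrix K α ℤ} {B : Matrix K (Fin p) ℤ}
    (hB : M = B * M.submatrix r id) (hM : ∀ k, ∑ a, M k a = 0) (N : ℕ) [NeZero N] :
    Nat.card {f : α → ZMod N // ∀ k, ∑ a, M k a • f a = 0} =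
      N * kernelCard (M.submatrix r (e ∘ some)) N := by
  have shift (k : K) (f : α → ZMod N) (t : ZMod N) :
      ∑ a, M k a • (f a + t) = ∑ a, M k a • f a := by
    simp only [smul_add, Finset.sum_add_distrib, ← Finset.sum_smul, hM, zero_smul, add_zero]
  have row (i : Fin p) (x : Fin p → ZMod N) :
      ((M.submatrix r (e ∘ some)).map (Int.cast : ℤ → ZMod N)).mulVec x i =
        ∑ j, M (r i) (e (some j)) • x j := by
    simp [Matrix.mulVec, dotProduct, zsmul_eq_mul]
  have ext (x : Fin p → ZMod N) (k : K) :
      ∑ a, M k a • (e.symm a).elim 0 x = ∑ j, M k (e (some j)) • x j := by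
    rw [sum_option_equiv e]; simp
  rw [← Nat.card_zmod N, kernelCard, ← Nat.card_prod, Nat.card_zmod]
  refine Nat.card_congr
    { toFun := fun f => ⟨f.1 (e none), fun j => f.1 (e (some j)) - f.1 (e none), ?_⟩
      invFun := fun x => ⟨fun a => (e.symm a).elim 0 x.2.1 + x.1, fun k => ?_⟩
      left_inv := fun f => Subtype.ext <| funext fun a => ?_
      right_inv := fun x => ?_ }
  · funext i
    have h := shift (r i) f.1 (-f.1 (e none))
    rw [f.2, sum_option_equiv e] at h
    rw [row]
    simpa [sub_eq_add_neg] using h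
  · rw [shift, ext]
    have h (i : Fin p) : ∑ j, M (r i) (e (some j)) • x.2.1 j = 0 := by
      rw [← row, x.2.2]; rfl
    have hk (j : Fin p) : M k (e (some j)) = ∑ i, B k i * M (r i) (e (some j)) := by
      conv_lhs => rw [hB]
      rfl
    simp only [hk, Finset.sum_smul, mul_smul]
    rw [Finset.sum_comm]
    simp only [← Finset.smul_sum, h, smul_zero, Finset.sum_const_zero]
  · obtain ⟨o, rfl⟩ := e.surjective a
    cases o <;> simp
  · obtain ⟨t, x, hx⟩ := x
    simp

end Redundant

end

section

open LaurentPolynomial (T)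

/-! ### The redundant relation of the Alexander module -/

/-- The sum of the arcs that cross a level, weighted by monomials that depend on the
orientations. -/
noncomputable def foxSum : ℕ → (ℕ → Bool) → (ℕ → ℤ[T;T⁻¹]) → ℤ[T;T⁻¹]
  | 0, _, _ => 0
  | m + 1, ε, v =>
      if ε 0 then v 0 + T (-1) * foxSum m (fun j => ε (j + 1)) (fun j => v (j + 1))
      else T 1 * (foxSum m (fun j => ε (j + 1)) (fun j => v (j + 1)) - v 0)

theorem foxSum_succ (m : ℕ) (ε : ℕ → Bool) (v : ℕ → ℤ[T;T⁻¹]) :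
    foxSum (m + 1) ε v =
      if ε 0 then v 0 + T (-1) * foxSum m (fun j => ε (j + 1)) (fun j => v (j + 1))
      else T 1 * (foxSum m (fun j => ε (j + 1)) (fun j => v (j + 1)) - v 0) := rfl

/-- `foxSum` is the Fox derivative of the word of meridians along a level, with generators sent to
`T (-1)`. A turn contributes a generator next to its inverse, which does not alter the word. -/
theorem foxSum_pad {i m : ℕ} (hi : i ≤ m) (b : Bool) (x : ℤ[T;T⁻¹]) (ε : ℕ → Bool)
    (v : ℕ → ℤ[T;T⁻¹]) : foxSum (m + 2) (pad i b (!b) ε) (pad i x x v) = foxSum m ε v := by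
  induction i generalizing m ε v with
  | zero =>
    have h1 : (fun j => pad 0 b (!b) ε (j + 1 + 1)) = ε := by ext j; simp [pad]
    have h2 : (fun j => pad 0 x x v (j + 1 + 1)) = v := by ext j; simp [pad]
    rw [foxSum_succ, foxSum_succ, h1, h2]
    cases b
    · simp [pad]
    · simp [pad]
  | succ i ih =>
    obtain ⟨m, rfl⟩ := Nat.exists_eq_add_of_le' (show 1 ≤ m by omega)
    have h1 : (fun j => pad (i + 1) b (!b) ε (j + 1)) = pad i b (!b) fun j => ε (j + 1) := by
      ext j; simp only [pad]; grind
    have h2 : (fun j => pad (i + 1) x x v (j + 1)) = pad i x x fun j => v (j + 1) := by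
      ext j; simp only [pad]; grind
    rw [show m + 1 + 2 = m + 2 + 1 by ring, foxSum_succ (m + 2), foxSum_succ m, h1, h2,
      ih (by omega)]
    simp [pad]

/-- The words below and above a crossing differ by a Wirtinger relation, so their Fox derivatives
differ by a unit times the Alexander relation. The unit depends on the orientations only, hence is
common to all arcs. -/
theorem foxSum_pos {i m : ℕ} (hi : i + 2 ≤ m) (ε ε' : ℕ → Bool)
    (hε : ∀ j, j ≠ i → j ≠ i + 1 → ε' j = ε j) (h1 : ε' i = ε (i + 1)) (h2 : ε' (i + 1) = ε i) :
    ∃ u : ℤ[T;T⁻¹], IsUnit u ∧ ∀ v v' : ℕ → ℤ[T;T⁻¹], (∀ j, j ≠ i → j ≠ i + 1 → v' j = v j) →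
      v' (i + 1) = v i → foxSum m ε' v' - foxSum m ε v =
        u * if ε i then (1 - T 1) * v i + T 1 * v' i - v (i + 1)
          else (1 - T 1) * v i + T 1 * v (i + 1) - v' i := by
  have hT := T_one_mul_T_neg_one
  induction i generalizing m ε ε' with
  | zero =>
    obtain ⟨m, rfl⟩ := Nat.exists_eq_add_of_le' hi
    have h3 : (fun j => ε' (j + 1 + 1)) = fun j => ε (j + 1 + 1) := by
      ext j; exact hε _ (by omega) (by omega)
    have key (u : ℤ[T;T⁻¹]) (hu : ∀ a b c F : ℤ[T;T⁻¹],
        (if ε 1 then b + T (-1) * (if ε 0 then a + T (-1) * F else T 1 * (F - a))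
          else T 1 * ((if ε 0 then a + T (-1) * F else T 1 * (F - a)) - b)) -
        (if ε 0 then a + T (-1) * (if ε 1 then c + T (-1) * F else T 1 * (F - c))
          else T 1 * ((if ε 1 then c + T (-1) * F else T 1 * (F - c)) - a)) =
        u * if ε 0 then (1 - T 1) * a + T 1 * b - c else (1 - T 1) * a + T 1 * c - b)
        (v v' : ℕ → ℤ[T;T⁻¹]) (hv : ∀ j, j ≠ 0 → j ≠ 0 + 1 → v' j = v j) (hv' : v' (0 + 1) = v 0) :
        foxSum (m + 2) ε' v' - foxSum (m + 2) ε v =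
        u * if ε 0 then (1 - T 1) * v 0 + T 1 * v' 0 - v (0 + 1)
          else (1 - T 1) * v 0 + T 1 * v (0 + 1) - v' 0 := by
      have h4 : (fun j => v' (j + 1 + 1)) = fun j => v (j + 1 + 1) := by
        ext1 j; exact hv _ (by omega) (by omega)
      simp only [foxSum_succ, h1, h2, h3, h4, hv']
      exact hu _ _ _ _
    rcases Bool.eq_false_or_eq_true (ε 0) with hb | hb <;>
      rcases Bool.eq_false_or_eq_true (ε 1) with hc | hc
    · refine ⟨T (-1), LaurentPolynomial.isUnit_T _, key _ fun a b c F => ?_⟩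
      simp only [hb, hc, if_true, if_false, Bool.false_eq_true]
      linear_combination (a - b) * hT
    · refine ⟨-1, isUnit_one.neg, key _ fun a b c F => ?_⟩
      simp only [hb, hc, if_true, if_false, Bool.false_eq_true]
      linear_combination c * hT
    · refine ⟨-1, isUnit_one.neg, key _ fun a b c F => ?_⟩
      simp only [hb, hc, if_true, if_false, Bool.false_eq_true]
      linear_combination (- a) * hT
    · refine ⟨T 1, LaurentPolynomial.isUnit_T _, key _ fun a b c F => ?_⟩
      simp only [hb, hc, if_true, if_false, Bool.false_eq_true]; ring
  | succ i ih =>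
    obtain ⟨m, rfl⟩ := Nat.exists_eq_add_of_le' (show 1 ≤ m by omega)
    obtain ⟨u, hu, h⟩ := ih (m := m) (by omega) (fun j => ε (j + 1)) (fun j => ε' (j + 1))
      (fun j hj hj' => hε _ (by omega) (by omega)) h1 h2
    have h0 := hε 0 (by omega) (by omega)
    -- Each strand to the left of the crossing multiplies the difference by its own monomial.
    refine ⟨(if ε 0 then T (-1) else T 1) * u, ?_, fun v v' hv hv' => ?_⟩
    · split_ifs <;> exact (LaurentPolynomial.isUnit_T _).mul hu
    · have := h (fun j => v (j + 1)) (fun j => v' (j + 1))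
        (fun j hj hj' => hv _ (by omega) (by omega)) hv'
      rw [foxSum_succ, foxSum_succ, h0, hv 0 (by omega) (by omega), mul_assoc, ← this]
      split_ifs <;> ring

theorem foxSum_neg {i m : ℕ} (hi : i + 2 ≤ m) (ε ε' : ℕ → Bool)
    (hε : ∀ j, j ≠ i → j ≠ i + 1 → ε' j = ε j) (h1 : ε' i = ε (i + 1)) (h2 : ε' (i + 1) = ε i) :
    ∃ u : ℤ[T;T⁻¹], IsUnit u ∧ ∀ v v' : ℕ → ℤ[T;T⁻¹], (∀ j, j ≠ i → j ≠ i + 1 → v' j = v j) →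
      v' i = v (i + 1) → foxSum m ε' v' - foxSum m ε v =
        u * if ε (i + 1) then (1 - T 1) * v (i + 1) + T 1 * v i - v' (i + 1)
          else (1 - T 1) * v (i + 1) + T 1 * v' (i + 1) - v i := by
  have hT := T_one_mul_T_neg_one
  induction i generalizing m ε ε' with
  | zero =>
    obtain ⟨m, rfl⟩ := Nat.exists_eq_add_of_le' hi
    have h3 : (fun j => ε' (j + 1 + 1)) = fun j => ε (j + 1 + 1) := by
      ext j; exact hε _ (by omega) (by omega)
    have key (u : ℤ[T;T⁻¹]) (hu : ∀ a b c F : ℤ[T;T⁻¹],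
        (if ε 1 then a + T (-1) * (if ε 0 then c + T (-1) * F else T 1 * (F - c))
          else T 1 * ((if ε 0 then c + T (-1) * F else T 1 * (F - c)) - a)) -
        (if ε 0 then b + T (-1) * (if ε 1 then a + T (-1) * F else T 1 * (F - a))
          else T 1 * ((if ε 1 then a + T (-1) * F else T 1 * (F - a)) - b)) =
        u * if ε 1 then (1 - T 1) * a + T 1 * b - c else (1 - T 1) * a + T 1 * c - b)
        (v v' : ℕ → ℤ[T;T⁻¹]) (hv : ∀ j, j ≠ 0 → j ≠ 0 + 1 → v' j = v j) (hv' : v' 0 = v (0 + 1)) :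
        foxSum (m + 2) ε' v' - foxSum (m + 2) ε v =
        u * if ε (0 + 1) then (1 - T 1) * v (0 + 1) + T 1 * v 0 - v' (0 + 1)
          else (1 - T 1) * v (0 + 1) + T 1 * v' (0 + 1) - v 0 := by
      have h4 : (fun j => v' (j + 1 + 1)) = fun j => v (j + 1 + 1) := by
        ext1 j; exact hv _ (by omega) (by omega)
      simp only [foxSum_succ, h1, h2, h3, h4, hv']
      exact hu _ _ _ _
    rcases Bool.eq_false_or_eq_true (ε 0) with hb | hb <;>
      rcases Bool.eq_false_or_eq_true (ε 1) with hc | hc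
    · refine ⟨-T (-1), (LaurentPolynomial.isUnit_T _).neg, key _ fun a b c F => ?_⟩
      simp only [hb, hc, if_true, if_false, Bool.false_eq_true]
      linear_combination (b - a) * hT
    · refine ⟨1, isUnit_one, key _ fun a b c F => ?_⟩
      simp only [hb, hc, if_true, if_false, Bool.false_eq_true]
      linear_combination a * hT
    · refine ⟨1, isUnit_one, key _ fun a b c F => ?_⟩
      simp only [hb, hc, if_true, if_false, Bool.false_eq_true]
      linear_combination (-c) * hT
    · refine ⟨-T 1, (LaurentPolynomial.isUnit_T _).neg, key _ fun a b c F => ?_⟩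
      simp only [hb, hc, if_true, if_false, Bool.false_eq_true]; ring
  | succ i ih =>
    obtain ⟨m, rfl⟩ := Nat.exists_eq_add_of_le' (show 1 ≤ m by omega)
    obtain ⟨u, hu, h⟩ := ih (m := m) (by omega) (fun j => ε (j + 1)) (fun j => ε' (j + 1))
      (fun j hj hj' => hε _ (by omega) (by omega)) h1 h2
    have h0 := hε 0 (by omega) (by omega)
    refine ⟨(if ε 0 then T (-1) else T 1) * u, ?_, fun v v' hv hv' => ?_⟩
    · split_ifs <;> exact (LaurentPolynomial.isUnit_T _).mul hu
    · have := h (fun j => v (j + 1)) (fun j => v' (j + 1))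
        (fun j hj hj' => hv _ (by omega) (by omega)) hv'
      rw [foxSum_succ, foxSum_succ, h0, hv 0 (by omega) (by omega), mul_assoc, ← this]
      split_ifs <;> ring

end

section

open LaurentPolynomial (T)

/-! ### The matrix of the relations of the Alexander module -/

section Incidence
variable {m n : ℕ} {w : List Piece}

/-- `Beside.right` also relates pairs to the right of all strands; the two ends of a relation are
both points of the diagram or both are not. -/
theorem mem_range_iff (h : Fits m w n) {x y : ℕ × ℕ}
    (hxy : Beside w x y ∨ Turn w x y ∨ Over w x y) :
    (x.1 ≤ w.length ∧ x.2 < width m w x.1) ↔ (y.1 ≤ w.length ∧ y.2 < width m w y.1) := by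
  have aux (k : ℕ) (p : Piece) (hk : w[k]? = some p) : k < w.length ∧
      width m w (k + 1) = p.above (width m w k) ∧ p.at_ + p.kind.ins ≤ width m w k :=
    ⟨(List.getElem?_eq_some_iff.mp hk).1, width_succ hk, h.le_width hk⟩
  rcases hxy with (@⟨k, i, p, hk, hi⟩ | @⟨k, p, i, hk⟩) | (@⟨k, i, hk⟩ | @⟨k, i, hk⟩) |
    (@⟨k, i, hk⟩ | @⟨k, i, hk⟩)
  · have := aux _ _ hk
    obtain ⟨κ, i⟩ := p
    cases κ <;> simp only [Piece.above, Kind.ins, Kind.outs] at * <;> omega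
  · have := aux _ _ hk
    obtain ⟨κ, i⟩ := p
    cases κ <;> simp only [Piece.above, Kind.ins, Kind.outs] at * <;> omega
  all_goals
    have := aux _ _ hk
    simp only [Piece.above, Kind.ins, Kind.outs] at *
    omega

open scoped Classical in
theorem Arc.ind_coe (α : Arc m w) (x : Point m w) :
    α.ind x.1 = if Quot.mk _ x = α then 1 else 0 := by
  unfold Arc.ind
  congr 1
  refine propext ⟨?_, fun h => ⟨x, rfl, h⟩⟩
  rintro ⟨y, hy, h⟩
  rwa [← Subtype.ext hy]

theorem Arc.ind_eq_zero (α : Arc m w) {x : ℕ × ℕ} (hx : ¬(x.1 ≤ w.length ∧ x.2 < width m w x.1)) :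
    α.ind x = 0 := by
  refine if_neg ?_
  rintro ⟨y, rfl, -⟩
  exact hx y.2

theorem Arc.ind_congr (h : Fits m w n) (α : Arc m w) {x y : ℕ × ℕ}
    (hxy : Beside w x y ∨ Turn w x y ∨ Over w x y) : α.ind x = α.ind y := by
  by_cases hx : x.1 ≤ w.length ∧ x.2 < width m w x.1
  · have hy := (mem_range_iff h hxy).mp hx
    let X : Point m w := ⟨x, hx⟩
    let Y : Point m w := ⟨y, hy⟩
    have : Quot.mk (AdjacentOver m w) X = Quot.mk _ Y := Quot.sound hxy
    rw [show x = X.1 from rfl, show y = Y.1 from rfl, α.ind_coe, α.ind_coe, this]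
  · rw [α.ind_eq_zero hx, α.ind_eq_zero (mt (mem_range_iff h hxy).mpr hx)]

theorem sum_ind [Fintype (Arc m w)] (x : Point m w) : ∑ α : Arc m w, α.ind x.1 = 1 := by
  let a : Arc m w := Quot.mk _ x
  rw [Finset.sum_eq_single a]
  · rw [Arc.ind_coe, if_pos rfl]
  · intro α _ hα
    rw [Arc.ind_coe]
    exact if_neg hα.symm
  · exact fun h => absurd (Finset.mem_univ _) h

end Incidence

variable {D : LinkDiagram} (o : DiagramOrientation D)

/-- The piece number `k` is a crossing. -/
def IsCrossing (w : List Piece) (k : ℕ) : Prop :=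
  ∃ i, w[k]? = some ⟨.pos, i⟩ ∨ w[k]? = some ⟨.neg, i⟩

theorem DiagramOrientation.relation_eq_zero {k : ℕ} (hk : ¬IsCrossing D.pieces k)
    (α : Arc 0 D.pieces) : o.relation k α = 0 := by
  unfold DiagramOrientation.relation
  split
  · rename_i i h; exact absurd ⟨i, .inl h⟩ hk
  · rename_i i h; exact absurd ⟨i, .inr h⟩ hk
  · rfl

theorem crossingDefect_eq_zero {M : Type*} [AddCommGroup M] {w : List Piece} {k : ℕ}
    (hk : ¬IsCrossing w k) (v : ℕ × ℕ → M) : crossingDefect w v k = 0 := by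
  unfold crossingDefect
  split
  · rename_i i h; exact absurd ⟨i, .inl h⟩ hk
  · rename_i i h; exact absurd ⟨i, .inr h⟩ hk
  · rfl

/-- Orientation only decides which lower arc is `b` and which is `c`. The colouring rule, to which
the relation specializes at `-1`, is symmetric in them. -/
theorem DiagramOrientation.exists_relation_eq (M : Type*) [AddCommGroup M] {k : ℕ}
    (hk : IsCrossing D.pieces k) : ∃ a b c : Point 0 D.pieces,
      (∀ α, o.relation k α = (1 - T 1) * α.ind a.1 + T 1 * α.ind b.1 - α.ind c.1) ∧
      ∀ v : ℕ × ℕ → M, crossingDefect D.pieces v k = (2 : ℤ) • v a.1 - v b.1 - v c.1 := by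
  obtain ⟨i, hk | hk⟩ := hk
  all_goals
    have hl := (List.getElem?_eq_some_iff.mp hk).1
    have hw := width_succ (m := 0) hk
    have hi := D.fits.le_width hk
    simp only [Piece.above, Kind.ins, Kind.outs] at hw hi
    let p : Point 0 D.pieces := ⟨(k, i), hl.le, by dsimp only; omega⟩
    let q : Point 0 D.pieces := ⟨(k, i + 1), hl.le, by dsimp only; omega⟩
    let p' : Point 0 D.pieces := ⟨(k + 1, i), hl, by dsimp only; omega⟩
    let q' : Point 0 D.pieces := ⟨(k + 1, i + 1), hl, by dsimp only; omega⟩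
  · by_cases hu : o.up (k, i)
    · exact ⟨p, p', q, fun α => by simp [DiagramOrientation.relation, hk, hu, p, p', q],
        fun v => by simp [crossingDefect, hk, p, p', q]⟩
    · exact ⟨p, q, p', fun α => by simp [DiagramOrientation.relation, hk, hu, p, p', q],
        fun v => by simp only [crossingDefect, hk, p, p', q]; abel⟩
  · by_cases hu : o.up (k, i + 1)
    · exact ⟨q, p, q', fun α => by simp [DiagramOrientation.relation, hk, hu, p, q', q],
        fun v => by simp [crossingDefect, hk, p, q', q]⟩
    · exact ⟨q, q', p, fun α => by simp [DiagramOrientation.relation, hk, hu, p, q', q],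
        fun v => by simp only [crossingDefect, hk, p, q', q]; abel⟩

theorem DiagramOrientation.sum_relation [Fintype (Arc 0 D.pieces)] (k : ℕ) :
    ∑ α, o.relation k α = 0 := by
  by_cases hk : IsCrossing D.pieces k
  · obtain ⟨a, b, c, h, -⟩ := o.exists_relation_eq ℤ hk
    simp only [h, Finset.sum_sub_distrib, Finset.sum_add_distrib, ← Finset.mul_sum, sum_ind]
    ring
  · simp [o.relation_eq_zero hk]

/-- The weighted sum of the arcs at the level `k`. -/
noncomputable def DiagramOrientation.levelSum (k : ℕ) (α : Arc 0 D.pieces) : ℤ[T;T⁻¹] :=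
  foxSum (width 0 D.pieces k) (fun j => o.up (k, j)) fun j => α.ind (k, j)

/-- Each row is, up to a unit, a difference of consecutive level sums; at turns both sides vanish.
-/
theorem DiagramOrientation.exists_unit (k : ℕ) (hk : k < D.pieces.length) :
    ∃ u : ℤ[T;T⁻¹], IsUnit u ∧
      ∀ α, u * o.relation k α = o.levelSum (k + 1) α - o.levelSum k α := by
  obtain ⟨⟨κ, i⟩, hp⟩ : ∃ p, D.pieces[k]? = some p := ⟨_, List.getElem?_eq_getElem hk⟩
  have hw := width_succ (m := 0) hp
  have hi := D.fits.le_width hp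
  have hl (j : ℕ) (hj : j < i) : Beside D.pieces (k, j) (k + 1, j) := .left hp hj
  have hr (j : ℕ) := Beside.right j hp
  simp only [DiagramOrientation.levelSum]
  cases κ <;> simp only [Piece.above, Kind.ins, Kind.outs, add_zero, Nat.sub_zero] at hw hi hr
  · refine ⟨1, isUnit_one, fun α => ?_⟩
    rw [o.relation_eq_zero (by simp [IsCrossing, hp]), mul_zero, eq_comm, sub_eq_zero]
    have ht : Turn D.pieces (k + 1, i) (k + 1, i + 1) := .cup hp
    rw [hw, ← foxSum_pad hi (o.up (k + 1, i)) (α.ind (k + 1, i))]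
    congr 1 <;> ext1 j <;> simp only [pad] <;> split_ifs with h1 h2 h3
    · exact (o.beside _ _ (hl j h1)).symm
    · rw [h2]
    · rw [h3, o.turn _ _ ht, Bool.not_not]
    · obtain ⟨j, rfl⟩ := Nat.exists_eq_add_of_le (show i + 2 ≤ j by omega)
      rw [show i + 2 + j - 2 = i + j by omega]
      exact (o.beside _ _ (hr j)).symm
    · exact (α.ind_congr D.fits (.inl (hl j h1))).symm
    · rw [h2]
    · rw [h3]; exact (α.ind_congr D.fits (.inr (.inl ht))).symm
    · obtain ⟨j, rfl⟩ := Nat.exists_eq_add_of_le (show i + 2 ≤ j by omega)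
      rw [show i + 2 + j - 2 = i + j by omega]
      exact (α.ind_congr D.fits (.inl (hr j))).symm
  · refine ⟨1, isUnit_one, fun α => ?_⟩
    rw [o.relation_eq_zero (by simp [IsCrossing, hp]), mul_zero, eq_comm, sub_eq_zero]
    have ht : Turn D.pieces (k, i) (k, i + 1) := .cap hp
    obtain ⟨r, hw'⟩ := Nat.exists_eq_add_of_le' (show 2 ≤ width 0 D.pieces k by omega)
    rw [hw, hw', Nat.add_sub_cancel,
      ← foxSum_pad (show i ≤ r by omega) (o.up (k, i)) (α.ind (k, i))]
    congr 1 <;> ext1 j <;> simp only [pad] <;> split_ifs with h1 h2 h3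
    · exact (o.beside _ _ (hl j h1)).symm
    · rw [h2]
    · rw [h3, o.turn _ _ ht, Bool.not_not]
    · obtain ⟨j, rfl⟩ := Nat.exists_eq_add_of_le (show i + 2 ≤ j by omega)
      rw [show i + 2 + j - 2 = i + j by omega]
      exact (o.beside _ _ (hr j)).symm
    · exact (α.ind_congr D.fits (.inl (hl j h1))).symm
    · rw [h2]
    · rw [h3]; exact α.ind_congr D.fits (.inr (.inl ht))
    · obtain ⟨j, rfl⟩ := Nat.exists_eq_add_of_le (show i + 2 ≤ j by omega)
      rw [show i + 2 + j - 2 = i + j by omega]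
      exact (α.ind_congr D.fits (.inl (hr j))).symm
  all_goals
    have hb (j : ℕ) (h1 : j ≠ i) (h2 : j ≠ i + 1) : Beside D.pieces (k, j) (k + 1, j) := by
      obtain h | h := lt_or_ge j i
      · exact hl j h
      · obtain ⟨j, rfl⟩ := Nat.exists_eq_add_of_le (show i + 2 ≤ j by omega)
        exact hr j
    rw [Nat.sub_add_cancel (by omega)] at hw
    rw [hw]
  · have ho : Over D.pieces (k, i) (k + 1, i + 1) := .pos hp
    have hu : Under D.pieces (k, i + 1) (k + 1, i) := .pos hp
    obtain ⟨u, h1, h2⟩ := foxSum_pos hi (fun j => o.up (k, j)) (fun j => o.up (k + 1, j))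
      (fun j h1 h2 => (o.beside _ _ (hb j h1 h2)).symm) (o.lower _ _ hu).symm (o.upper _ _ ho).symm
    refine ⟨u, h1, fun α => ?_⟩
    rw [h2 (fun j => α.ind (k, j)) (fun j => α.ind (k + 1, j))
      (fun j h1 h2 => (α.ind_congr D.fits (.inl (hb j h1 h2))).symm)
      (α.ind_congr D.fits (.inr (.inr ho))).symm]
    simp only [DiagramOrientation.relation, hp]
  · have ho : Over D.pieces (k, i + 1) (k + 1, i) := .neg hp
    have hu : Under D.pieces (k, i) (k + 1, i + 1) := .neg hp
    obtain ⟨u, h1, h2⟩ := foxSum_neg hi (fun j => o.up (k, j)) (fun j => o.up (k + 1, j))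
      (fun j h1 h2 => (o.beside _ _ (hb j h1 h2)).symm) (o.upper _ _ ho).symm (o.lower _ _ hu).symm
    refine ⟨u, h1, fun α => ?_⟩
    rw [h2 (fun j => α.ind (k, j)) (fun j => α.ind (k + 1, j))
      (fun j h1 h2 => (α.ind_congr D.fits (.inl (hb j h1 h2))).symm)
      (α.ind_congr D.fits (.inr (.inr ho))).symm]
    simp only [DiagramOrientation.relation, hp]

/-- The differences of level sums telescope, and a closed diagram has no strands at its bottom and
top. -/
theorem DiagramOrientation.exists_row_relation : ∃ u : Fin D.pieces.length → ℤ[T;T⁻¹],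
    (∀ k, IsUnit (u k)) ∧ ∀ α, ∑ k, u k * o.relation k α = 0 := by
  choose u hu h using fun k : Fin D.pieces.length => o.exists_unit k k.2
  refine ⟨u, hu, fun α => ?_⟩
  simp only [h]
  rw [Fin.sum_univ_eq_sum_range (fun k => o.levelSum (k + 1) α - o.levelSum k α),
    Finset.sum_range_sub (fun k => o.levelSum k α), DiagramOrientation.levelSum, DiagramOrientation.levelSum,
    D.fits.width_length le_rfl, width_zero]
  simp [foxSum]

end

section

open LaurentPolynomial (T)

/-! ### The determinant counts colourings -/

/-- The ends of the strand number `j` at the piece number `k`. -/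
def strandEnds (p : Piece) (k j : ℕ) : (ℕ × ℕ) × ℕ × ℕ :=
  if j < p.at_ then ((k, j), (k + 1, j))
  else if j = p.at_ then
    match p.kind with
    | .cup => ((k + 1, j), (k + 1, j + 1))
    | .cap => ((k, j), (k, j + 1))
    | .pos => ((k, j), (k + 1, j + 1))
    | .neg => ((k, j + 1), (k + 1, j))
  else ((k, j - 1 + p.kind.ins), (k + 1, j - 1 + p.kind.outs))

theorem exists_strandEnds {w : List Piece} (h : Fits 0 w 0) {x y : ℕ × ℕ}
    (hx : x.2 < width 0 w x.1) (hxy : Beside w x y ∨ Turn w x y ∨ Over w x y) :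
    ∃ (k : Fin w.length) (j : Fin (width 0 w k + 1 - w[k].kind.ins)),
      strandEnds w[k] k j = (x, y) := by
  have aux (k : ℕ) (p : Piece) (j : ℕ) (hk : w[k]? = some p)
      (hj : j < width 0 w k + 1 - p.kind.ins) (he : strandEnds p k j = (x, y)) :
      ∃ (k : Fin w.length) (j : Fin (width 0 w k + 1 - w[k].kind.ins)),
        strandEnds w[k] k j = (x, y) := by
    obtain ⟨hl, rfl⟩ := List.getElem?_eq_some_iff.mp hk
    exact ⟨⟨k, hl⟩, ⟨j, hj⟩, he⟩
  rcases hxy with (@⟨k, i, p, hk, hi⟩ | @⟨k, p, i, hk⟩) | (@⟨k, i, hk⟩ | @⟨k, i, hk⟩) |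
    (@⟨k, i, hk⟩ | @⟨k, i, hk⟩)
  · have := h.le_width hk
    exact aux k p i hk (by omega) (by simp [strandEnds, hi])
  · refine aux k p (p.at_ + 1 + i) hk (by dsimp only at hx; omega) ?_
    rw [strandEnds, if_neg (by omega), if_neg (by omega),
      show p.at_ + 1 + i - 1 = p.at_ + i by omega, Nat.add_right_comm, Nat.add_right_comm p.at_ i]
  all_goals
    have := h.le_width hk
    simp only [Kind.ins] at this
    exact aux k _ i hk (by simp only [Kind.ins]; omega) (by simp [strandEnds])

theorem Point.card_eq (w : List Piece) :
    Nat.card (Point 0 w) = ∑ k ∈ Finset.range (w.length + 1), width 0 w k := by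
  let e : Point 0 w ≃ Σ k : Fin (w.length + 1), Fin (width 0 w k) :=
    { toFun := fun x => ⟨⟨x.1.1, Nat.lt_succ_of_le x.2.1⟩, ⟨x.1.2, x.2.2⟩⟩
      invFun := fun x => ⟨(x.1, x.2), Nat.le_of_lt_succ x.1.2, x.2.2⟩
      left_inv := fun _ => rfl
      right_inv := fun _ => rfl }
  rw [Nat.card_congr e, Nat.card_sigma, ← Fin.sum_univ_eq_sum_range]
  simp

/-- The arcs are the components of the graph with the points as vertices and the non-undercrossing
strands as edges. There are at least as many as vertices minus edges, and this difference is the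
number of crossings. -/
theorem card_crossings_le {w : List Piece} (h : Fits 0 w 0) (S : Finset (Fin w.length))
    (hS : ∀ k ∈ S, IsCrossing w k) : S.card ≤ Nat.card (Arc 0 w) := by
  classical
  let E := Σ k : Fin w.length, Fin (width 0 w k + 1 - w[k].kind.ins)
  -- A function on the vertices is determined by its differences along the edges and its value at
  -- one vertex of each component. Counting functions to `Bool` gives the inequality of exponents.
  let Φ (f : Point 0 w → Bool) : (E → Bool) × (Arc 0 w → Bool) :=
    (fun e => xor (Point.extend (T := ZMod 2) (fun x => if f x then 1 else 0) (strandEnds w[e.1] e.1 e.2).1 = 1)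
      (Point.extend (T := ZMod 2) (fun x => if f x then 1 else 0) (strandEnds w[e.1] e.1 e.2).2 = 1),
      fun α => f (Quot.out α))
  have hΦ : Function.Injective Φ := fun f g hfg => by
    have h1 (x y : Point 0 w) (hxy : AdjacentOver 0 w x y) : xor (f x) (g x) = xor (f y) (g y) := by
      obtain ⟨k, j, hkj⟩ := exists_strandEnds h x.2.2 hxy
      have := congrFun (congrArg Prod.fst hfg) ⟨k, j⟩
      simp only [Φ, hkj, Point.extend_coe] at this
      revert this
      cases f x <;> cases f y <;> cases g x <;> cases g y <;> simp
    funext x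
    let a : Arc 0 w := Quot.mk _ x
    have h2 : xor (f (Quot.out a)) (g (Quot.out a)) = xor (f x) (g x) :=
      congrArg (Quot.lift (fun x => xor (f x) (g x)) h1) (Quot.out_eq a)
    have h3 := congrFun (congrArg Prod.snd hfg) a
    simp only [Φ] at h3
    rw [h3] at h2
    revert h2
    cases f x <;> cases g x <;> simp
  have hcard := Nat.card_le_card_of_injective Φ hΦ
  rw [Nat.card_prod, Nat.card_fun, Nat.card_fun, Nat.card_fun, ← pow_add,
    Nat.card_eq_fintype_card, Fintype.card_bool, Nat.pow_le_pow_iff_right one_lt_two, Point.card_eq,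
    Finset.sum_range_succ, h.width_length le_rfl, add_zero, ← Fin.sum_univ_eq_sum_range] at hcard
  have hE : Nat.card E = ∑ k : Fin w.length, (width 0 w k + 1 - w[k].kind.ins) := by
    rw [Nat.card_sigma]; simp
  have htel : ∑ k : Fin w.length, ((width 0 w (k + 1) : ℤ) - width 0 w k) = 0 := by
    rw [Fin.sum_univ_eq_sum_range fun k => ((width 0 w (k + 1) : ℤ) - width 0 w k),
      Finset.sum_range_sub fun k => (width 0 w k : ℤ), h.width_length le_rfl, width_zero, sub_self]
  -- Doubling the count and adding the change of width, which telescopes to zero, treats minima and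
  -- maxima alike.
  have hstep (k : Fin w.length) : 2 * ((width 0 w k + 1 - w[k].kind.ins : ℕ) : ℤ) +
      2 * (if k ∈ S then 1 else 0) ≤ 2 * width 0 w k + ((width 0 w (k + 1) : ℤ) - width 0 w k) := by
    have hk : w[k.1]? = some w[k] := List.getElem?_eq_getElem k.2
    have h1 := width_succ (m := 0) hk
    have h2 := h.le_width hk
    have h3 := hS k
    rw [IsCrossing, hk] at h3
    clear_value Φ
    generalize w[k] = p at h1 h2 h3 ⊢
    obtain ⟨κ, i⟩ := p
    cases κ <;> simp only [Piece.above, Kind.ins, Kind.outs] at * <;> split_ifs with h4 <;>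
      simp [h4] at h3 <;> omega
  have := Finset.sum_le_sum fun k (_ : k ∈ Finset.univ) => hstep k
  rw [Finset.sum_add_distrib, Finset.sum_add_distrib, htel, ← Finset.mul_sum, ← Finset.mul_sum,
    ← Finset.mul_sum, Finset.sum_boole, ← Nat.cast_sum, ← Nat.cast_sum, ← hE] at this
  simp only [Finset.filter_mem_eq_inter, Finset.univ_inter] at this
  omega

/-- The relation at the piece number `k`, for the variable `-1`. -/
noncomputable def DiagramOrientation.relationAt {D : LinkDiagram} (o : DiagramOrientation D) (k : ℕ)
    (α : Arc 0 D.pieces) : ℤ :=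
  LaurentPolynomial.eval₂ (RingHom.id ℤ) (-1) (o.relation k α)

variable {D : LinkDiagram} (o : DiagramOrientation D)

theorem DiagramOrientation.sum_relationAt_smul [Fintype (Arc 0 D.pieces)] {M : Type*}
    [AddCommGroup M] (g : Arc 0 D.pieces → M) (k : ℕ) :
    ∑ α, o.relationAt k α • g α =
      crossingDefect D.pieces (Point.extend fun x => g (Quot.mk _ x)) k := by
  classical
  by_cases hk : IsCrossing D.pieces k
  · obtain ⟨a, b, c, h1, h2⟩ := o.exists_relation_eq M hk
    let i (α : Arc 0 D.pieces) (x : Point 0 D.pieces) : ℤ := if Quot.mk _ x = α then 1 else 0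
    have hi (α : Arc 0 D.pieces) (x : Point 0 D.pieces) :
        LaurentPolynomial.eval₂ (RingHom.id ℤ) (-1) (α.ind x.1) = i α x := by
      rw [Arc.ind_coe]
      simp only [i]
      split_ifs <;> simp
    have hs (x : Point 0 D.pieces) : ∑ α, i α x • g α = g (Quot.mk _ x) := by
      let y : Arc 0 D.pieces := Quot.mk _ x
      rw [Finset.sum_eq_single y]
      · simp [i, y]
      · intro α _ hα
        rw [show i α x = 0 from if_neg hα.symm, zero_smul]
      · exact fun h => absurd (Finset.mem_univ _) h
    have hr (α : Arc 0 D.pieces) : o.relationAt k α = 2 * i α a - i α b - i α c := by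
      rw [DiagramOrientation.relationAt, h1]
      simp only [map_sub, map_add, map_mul, map_one, hi, LaurentPolynomial.eval₂_T, zpow_one,
        Units.val_neg, Units.val_one]
      ring
    simp only [hr, h2, Point.extend_coe, sub_smul, mul_smul, Finset.sum_sub_distrib,
      ← Finset.smul_sum, hs]
  · simp [crossingDefect_eq_zero hk, DiagramOrientation.relationAt, o.relation_eq_zero hk]

theorem DiagramOrientation.colourings_eq [Fintype (Arc 0 D.pieces)] (N : ℕ) :
    colourings D.pieces N = Nat.card {f : Arc 0 D.pieces → ZMod (N + 1) //
      ∀ k : Fin D.pieces.length, ∑ α, o.relationAt k α • f α = 0} := by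
  rw [colourings, count_eq_card_colouring D.fits]
  refine Nat.card_congr
    { toFun := fun f => ⟨Quot.lift f.1 f.2.1, fun k => ?_⟩
      invFun := fun g => ⟨fun x => g.1 (Quot.mk _ x), fun x y h => ?_, fun k => ?_⟩
      left_inv := fun f => rfl
      right_inv := fun g => Subtype.ext <| funext fun α => ?_ }
  · exact (o.sum_relationAt_smul (Quot.lift f.1 f.2.1) k).trans (f.2.2 k)
  · exact congrArg g.1 (Quot.sound h)
  · obtain hk | hk := lt_or_ge k D.pieces.length
    · rw [← o.sum_relationAt_smul]
      exact g.2 ⟨k, hk⟩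
    · refine crossingDefect_eq_zero (fun ⟨i, h⟩ => ?_) _
      rw [List.getElem?_eq_none hk] at h
      simp at h
  · obtain ⟨x, rfl⟩ := Quot.exists_rep α
    rfl

/-- The determinant of a link determines the numbers of its colourings. -/
theorem hasDet_colourings (hD : D.pieces ≠ []) : HasDet (colourings D.pieces) (determinant D o) := by
  classical
  let _ : Fintype (Arc 0 D.pieces) := Fintype.ofFinite _
  have hlen : 0 < D.pieces.length := List.length_pos_iff.mpr hD
  have hArc : 0 < Nat.card (Arc 0 D.pieces) := by
    have hp : D.pieces[0]? = some D.pieces[0] := List.getElem?_eq_getElem hlen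
    have h1 := D.fits.le_width hp
    have h2 := width_succ (m := 0) hp
    rw [width_zero] at h1 h2
    generalize D.pieces[0] = p at h1 h2
    obtain ⟨κ, i⟩ := p
    have h3 : 0 < width 0 D.pieces 1 := by
      cases κ <;> simp [Kind.ins, Kind.outs, Piece.above] at h1 h2
      rw [h2]; exact two_pos
    let x : Point 0 D.pieces := ⟨(1, 0), hlen, h3⟩
    have : Nonempty (Arc 0 D.pieces) := ⟨Quot.mk _ x⟩
    exact Nat.card_pos
  have : Nonempty (Fin D.pieces.length) := ⟨⟨0, hlen⟩⟩
  let M : Matrix (Fin D.pieces.length) (Arc 0 D.pieces) ℤ[T;T⁻¹] := Matrix.of fun k α => o.relation k α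
  let S : Finset (Fin D.pieces.length) := Finset.univ.filter fun k => IsCrossing D.pieces k
  obtain ⟨r, k₀, hr⟩ := exists_rows (p := Nat.card (Arc 0 D.pieces) - 1) S (by
    have := card_crossings_le D.fits S (by simp [S])
    omega)
  have e : Option (Fin (Nat.card (Arc 0 D.pieces) - 1)) ≃ Arc 0 D.pieces :=
    Fintype.equivOfCardEq (by
      rw [Fintype.card_option, Fintype.card_fin, ← Nat.card_eq_fintype_card]; omega)
  obtain ⟨u, hu, hMu⟩ := o.exists_row_relation
  obtain ⟨B, hB⟩ := exists_row_combination M u hu hMu S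
    (fun k hk => funext fun α => o.relation_eq_zero (by simpa [S] using hk) α) r k₀ hr
  have hM (k) : ∑ α, M k α = 0 := o.sum_relation k
  have hgcd : IsGcd o.minors (alexanderPolynomial D o) := (exists_isGcd o.minors_finite).choose_spec
  let φ : ℤ[T;T⁻¹] →+* ℤ := LaurentPolynomial.eval₂ (RingHom.id ℤ) (-1)
  -- The selected minor is among the minors and divides all of them, so it and their greatest common
  -- divisor divide each other, also after evaluation at `-1`.
  have h1 : alexanderPolynomial D o ∣ (M.submatrix r (e ∘ some)).det := hgcd.1 _ ⟨r, e ∘ some, rfl⟩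
  have h2 : (M.submatrix r (e ∘ some)).det ∣ alexanderPolynomial D o := hgcd.2 _ (by
    rintro _ ⟨r', c', rfl⟩
    exact det_dvd_minor e hB hM r' c')
  have hdet : (((M.map φ).submatrix r (e ∘ some)).det).natAbs = determinant D o := by
    have : ((M.map φ).submatrix r (e ∘ some)).det = φ (M.submatrix r (e ∘ some)).det :=
      (φ.map_det _).symm
    rw [this]
    exact Nat.dvd_antisymm (Int.natAbs_dvd_natAbs.mpr (map_dvd φ h2))
      (Int.natAbs_dvd_natAbs.mpr (map_dvd φ h1))
  refine ⟨_, inferInstance, inferInstance, _, hdet, fun N => ?_⟩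
  have hB' : M.map φ = B.map φ * (M.map φ).submatrix r id := by
    conv_lhs => rw [hB, Matrix.map_mul]
    rfl
  have hM' (k) : ∑ α, M.map φ k α = 0 := by
    have := congrArg φ (hM k)
    rwa [map_sum, map_zero] at this
  rw [o.colourings_eq N]
  exact card_solutions_eq_mul_kernelCard e hB' hM' (N + 1)

end

/-! ### Determinants of links in which a tangle embeds -/

section

theorem exists_isGcd_nat (S : Set ℕ) : ∃ g, IsGcd S g := by
  let I : Ideal ℤ := Ideal.span ((↑) '' S)
  refine ⟨(Submodule.IsPrincipal.generator I).natAbs, fun a ha => ?_, fun e he => ?_⟩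
  · rw [← Int.natCast_dvd_natCast, Int.natCast_natAbs, abs_dvd,
      ← Submodule.IsPrincipal.mem_iff_generator_dvd]
    exact Ideal.subset_span ⟨a, ha, rfl⟩
  · rw [← Int.natCast_dvd, ← Ideal.mem_span_singleton]
    refine Ideal.span_le.mpr ?_ (Submodule.IsPrincipal.generator_mem I)
    rintro _ ⟨a, ha, rfl⟩
    exact Ideal.mem_span_singleton.mpr (Int.natCast_dvd_natCast.mpr (he a ha))

/-- Isotopies of tangle and link are handled by colourings alone: these are invariant, and they
determine the determinants. -/
theorem Embeds.dvd_determinant {n : ℕ} (hn : 0 < n) {t : TangleDiagram n} {l : LinkDiagram}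
    (h : Embeds t l) (ol : DiagramOrientation l)
    (o : ∀ c : CatalanTangle n, DiagramOrientation (t.close c)) (g : ℕ)
    (hg : ∀ c, g ∣ determinant (t.close c) (o c)) : g ∣ determinant l ol := by
  have hl := hasDet_colourings ol (h.pieces_ne_nil hn)
  obtain ⟨t', l', ht, hl', hE⟩ := h
  obtain ⟨below, above, k, r, hD, hb, ha⟩ := hE.exists_fits hn
  obtain ⟨d, hd, hgd⟩ := exists_hasDet_extension g t'.fits hb ha fun c hc => by
    refine ⟨_, ?_, hg (capsTangle c hc)⟩
    have hne : (t.close (capsTangle c hc)).pieces ≠ [] := by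
      simp [Diagram.close, Diagram.glue, t.pieces_ne_nil hn]
    convert hasDet_colourings (o (capsTangle c hc)) hne using 1
    funext N
    exact ((ht.glue (capsTangle c hc).1).count_eq (0 : ℕ → ZMod (N + 1))).symm
  have hcol : colourings l.pieces = colourings (below ++ t'.pieces.map (Piece.shift k) ++ above) := by
    funext N
    rw [← hD]
    exact hl'.count_eq (0 : ℕ → ZMod (N + 1))
  rw [hcol] at hl
  rwa [hl.unique hd]

end

theorem corollary5p2 (n : ℕ) (hn : 0 < n) (t : TangleDiagram n) (l : LinkDiagram)
    (h : Embeds t l) (ol : DiagramOrientation l) (o : ∀ c : CatalanTangle n, DiagramOrientation (t.close c)) :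
    jones l ol ∈ Ideal.span (Set.range fun c : CatalanTangle n => jones (t.close c) (o c)) ∧
      ∃ g : ℕ, IsGcd (Set.range fun c : CatalanTangle n => determinant (t.close c) (o c)) g ∧
        g ∣ determinant l ol := by
  refine ⟨h.jones_mem hn (h.pieces_ne_nil hn) ol o, ?_⟩
  obtain ⟨g, hg⟩ := exists_isGcd_nat (Set.range fun c : CatalanTangle n => determinant (t.close c) (o c))
  exact ⟨g, hg, h.dvd_determinant hn ol o g fun c => hg.1 _ ⟨c, rfl⟩⟩
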